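/- **Lemma (JSCC Distortion Redundancy).** Let $P$ be a probability distribution on a finite set $\mathcal S$, let $d:\mathcal S\times\hat{\mathcal S}\to[0,\infty)$ be a distortion measure with finite $\hat{\mathcal S}$ such that every $s$ has some $\hat s$ with $d(s,\hat s)=0$, let $W$ be a discrete memoryless channel with finite alphabets $\mathcal X\to\mathcal Y$, let $\rho>0$, $0<\varepsilon<1$ and $m=\lfloor\rho n\rfloor$. For a distribution $\Phi$ on $\mathcal X$ write $\Phi W(y)=\sum_x\Phi(x)W(y|x)$, $I(\Phi,W)=\sum_{x,y}\Phi(x)W(y|x)\log\frac{W(y|x)}{\Phi W(y)}$, $V(\Phi,W)=\sum_x\Phi(x)\,\mathrm{Var}_{Y\sim W(\cdot|x)}\big[\log\frac{W(Y|x)}{\Phi W(Y)}\big]$ and $C(W)=\max_\Phi I(\Phi,W)$; let $V_{\min}(W),V_{\max}(W)$ be the minimum and maximum of $V(\Phi,W)$ over the $\Phi$ with $I(\Phi,W)=C(W)$. Let $R(Q,D)=\min\{I(Q,\Lambda):\ \sum_{s,\hat s}Q(s)\Lambda(\hat s|s)d(s,\hat s)\le D\}$ be the rate-distortion function, and $V_S(P,D)=\mathrm{Var}_{S\sim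 P}\big[\frac{\partial R(Q,D)}{\partial Q(S)}\big|_{Q=P}\big]$. Let $Q^{-1}$ be the inverse of the standard Gaussian tail function $Q(t)=\Pr[N(0,1)>t]$. Types (empirical distributions) of sequences are written $P_{\mathbf s},P_{\mathbf x}$, and conditional types $P_{\mathbf y|\mathbf x}$. Let $\xi_n=O(\log n/n)$ and $\zeta_n=O(\log n/\sqrt n)$ be given real sequences (for instance $\xi_n=\zeta_n=0$). For a map $f:\mathcal S^n\to\mathcal X^m$ let $D_n=D_n(f)$ be the infimum of all $D>0$ such that $$\Pr\big[R(P_{\mathbf S},D)>\rho I(P_{\mathbf x},P_{\mathbf Y|\mathbf x})+\xi_n\big]\le\varepsilon+\zeta_n,$$ where $\mathbf S\sim P^n$, $\mathbf x=f(\mathbf S)$ and $\mathbf Y\sim W^m(\cdot|\mathbf x)$. (The probability is a nonincreasing step function of $D$, so this is the infimal $D$ at which it equals $\varepsilon+\zeta_n$ whenever that value is attained.) 1. Let $\Phi$ be a distribution on $\mathcal X$ with $I(\Phi,W)>0$, and let $D^*(\Phi)>0$ be the solution of $R(P,D^*(\Phi))=\rho I(\Phi,W)$. Assume that $R(Q,D)$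 is twice differentiable with respect to $D$ and the elements of $Q$ in a neighbourhood of $(P,D^*(\Phi))$. Then for all large $n$ and all constant inputs $\mathbf x\in\mathcal X^m$ whose type $\Phi_m$ satisfies $\|\Phi-\Phi_m\|_\infty\le 1/m$, the threshold $D_n$ exists and $$R(P,D_n)=\rho I(\Phi,W)-\sqrt{\frac{V_S(P,D^*(\Phi))+\rho V(\Phi,W)}{n}}\,Q^{-1}(\varepsilon)+O\Big(\frac{\log n}{n}\Big).$$ 2. Let $D^*>0$ satisfy $R(P,D^*)=\rho C(W)$, assume that $R(Q,D)$ is twice differentiable as above in a neighbourhood of $(P,D^*)$, and that $V_{\min}(W)=V_{\max}(W)>0$. Put $V_J=V_S(P,D^*)+\rho V_{\min}(W)$. Then for arbitrary channel inputs $\mathbf x=f(\mathbf S)$, which may depend on the source sequence, whenever the threshold $D_n(f)$ exists, $$R(P,D_n(f))\le\rho C(W)-\sqrt{\frac{V_J}{n}}\,Q^{-1}(\varepsilon)+O\Big(\frac{\log n}{n}\Big).$$ The constants in $O(\cdot)$, and how large $n$ has to be, do not depend on the choice of $\mathbf x$ or $f$. -/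

import Mathlib

open Filter Topology Asymptotics

noncomputable section

namespace JSCC

/-! Probability distributions on a finite alphabet `A` are elements of `stdSimplex ℝ A`; a channel
`A → B` is a function `W : A → B → ℝ` with every `W a ∈ stdSimplex ℝ B`.  Logarithms are natural. -/

section Information

variable {A B : Type*} [Fintype A] [Fintype B]

/-- Output distribution `ΦW` of the channel `W` under the input distribution `Φ`. -/
def outDist (Φ : A → ℝ) (W : A → B → ℝ) (b : B) : ℝ := ∑ a, Φ a * W a b

/-- Information density `i(a, b) = log (W(b|a) / ΦW(b))`. -/
def infoDensity (Φ : A → ℝ) (W : A → B → ℝ) (a : A) (b : B) : ℝ :=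
  Real.log (W a b / outDist Φ W b)

/-- Mutual information `I(Φ, W)`; terms with `Φ(a) W(b|a) = 0` contribute `0`. -/
def mutualInfo (Φ : A → ℝ) (W : A → B → ℝ) : ℝ :=
  ∑ a, ∑ b, Φ a * W a b * infoDensity Φ W a b

/-- Variance of the function `g` under the distribution `p`. -/
def distVar (p : A → ℝ) (g : A → ℝ) : ℝ := ∑ a, p a * (g a - ∑ a', p a' * g a') ^ 2

/-- Conditional information variance `V(Φ, W) = E[Var(i(X, Y) | X)]`. -/
def condInfoVar (Φ : A → ℝ) (W : A → B → ℝ) : ℝ :=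
  ∑ a, Φ a * distVar (W a) (infoDensity Φ W a)

/-- Channel capacity `C(W) = max_Φ I(Φ, W)`. -/
def capacity (W : A → B → ℝ) : ℝ :=
  sSup ((fun Φ : A → ℝ => mutualInfo Φ W) '' stdSimplex ℝ A)

/-- The set `Π(W)` of capacity-achieving input distributions. -/
def capAchieving (W : A → B → ℝ) : Set (A → ℝ) :=
  {Φ | Φ ∈ stdSimplex ℝ A ∧ mutualInfo Φ W = capacity W}

/-- `V_min(W)`, the least conditional information variance over `Π(W)`. -/
def vMin (W : A → B → ℝ) : ℝ := sInf ((fun Φ : A → ℝ => condInfoVar Φ W) '' capAchieving W)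

/-- `V_max(W)`, the largest conditional information variance over `Π(W)`. -/
def vMax (W : A → B → ℝ) : ℝ := sSup ((fun Φ : A → ℝ => condInfoVar Φ W) '' capAchieving W)

/-- Rate-distortion function `R(Q, D)`: the minimum of `I(Q, Λ)` over the test channels `Λ` whose
expected distortion is at most `D`. -/
def rdf (d : A → B → ℝ) (Q : A → ℝ) (D : ℝ) : ℝ :=
  sInf {r | ∃ Λ : A → B → ℝ, (∀ a, Λ a ∈ stdSimplex ℝ B) ∧
    ∑ a, ∑ b, Q a * Λ a b * d a b ≤ D ∧ r = mutualInfo Q Λ}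

/-- `R(Q, D)` is twice (Fréchet) differentiable in `D` and the elements of `Q` in a neighbourhood of
`(P, D₀)`.  As `Q` ranges over the simplex only, this is differentiability of a function `F` on
an open set of the ambient space that coincides with `R` wherever `Q` is a distribution. -/
def RdfTwiceDifferentiableNear (d : A → B → ℝ) (P : A → ℝ) (D₀ : ℝ) : Prop :=
  ∃ (F : (A → ℝ) × ℝ → ℝ) (U : Set ((A → ℝ) × ℝ)), IsOpen U ∧ (P, D₀) ∈ U ∧
    (∀ z ∈ U, z.1 ∈ stdSimplex ℝ A → F z = rdf d z.1 z.2) ∧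
    DifferentiableOn ℝ F U ∧ DifferentiableOn ℝ (fderiv ℝ F) U

/-- The partial derivative `∂R(Q, D)/∂Q(a)` at `Q = P`, where `R(·, D)` is extended off the simplex
by normalization.  Any other differentiable extension changes all the partial derivatives with
`P(a) > 0` by one common constant, which does not affect their variance under `P`. -/
def rdfPartial [DecidableEq A] (d : A → B → ℝ) (P : A → ℝ) (D : ℝ) (a : A) : ℝ :=
  deriv (fun t : ℝ =>
    rdf d ((∑ c, (P c + Pi.single (M := fun _ => ℝ) a t c))⁻¹ • (P + Pi.single a t)) D) 0

/-- Source dispersion `V_S(P, D) = Var[∂R(Q, D)/∂Q(S) at Q = P]` with `S ∼ P`. -/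
def sourceDispersion [DecidableEq A] (d : A → B → ℝ) (P : A → ℝ) (D : ℝ) : ℝ :=
  distVar P (rdfPartial d P D)

end Information

section Types

variable {A B : Type*} [DecidableEq A] [DecidableEq B] {k : ℕ}

/-- The type (empirical distribution) of a sequence. -/
def seqType (x : Fin k → A) (a : A) : ℝ :=
  ((Finset.univ.filter fun i => x i = a).card : ℝ) / k

/-- The conditional type `P_{y|x}(b|a) = N(a, b|x, y) / N(a|x)`. -/
def condType (x : Fin k → A) (y : Fin k → B) (a : A) (b : B) : ℝ :=
  ((Finset.univ.filter fun i => x i = a ∧ y i = b).card : ℝ) /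
    ((Finset.univ.filter fun i => x i = a).card : ℝ)

end Types

/-- The Gaussian tail function `Q(t) = P[N(0,1) > t]`. -/
def gaussQ (t : ℝ) : ℝ := (ProbabilityTheory.gaussianReal 0 1).real (Set.Ioi t)

/-- The inverse `Q⁻¹(ε)` for `0 < ε < 1` of the continuous strictly decreasing function `Q`. -/
def gaussQInv (ε : ℝ) : ℝ := sInf {t | gaussQ t ≤ ε}

section Joint

variable {S T X Y : Type*} [Fintype S] [Fintype T] [Fintype X] [Fintype Y]
  [DecidableEq S] [DecidableEq X] [DecidableEq Y]

/-- `P[ R(P_S, D) > ρ I(P_x, P_{Y|x}) + ξ ]`, where `S` is drawn i.i.d. from `P`, the channel input is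
`x = f(S)` and `Y` is the output of the memoryless channel `W` for the input `x`. -/
def excessProb (d : S → T → ℝ) (P : S → ℝ) (W : X → Y → ℝ) (ρ : ℝ) {n m : ℕ}
    (f : (Fin n → S) → (Fin m → X)) (ξ D : ℝ) : ℝ :=
  ∑ s : Fin n → S, ∑ y : Fin m → Y,
    if rdf d (seqType s) D > ρ * mutualInfo (seqType (f s)) (condType (f s) y) + ξ
    then (∏ i, P (s i)) * ∏ j, W (f s j) (y j) else 0

/-- `D₀` is the infimal `D > 0` for which the probability `excessProb` is at most `δ`.  As that
probability is a nonincreasing step function of `D`, this is the infimal `D` where it equals `δ`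
whenever the value `δ` is taken at all. -/
def IsDistortionThreshold (d : S → T → ℝ) (P : S → ℝ) (W : X → Y → ℝ) (ρ : ℝ) {n m : ℕ}
    (f : (Fin n → S) → (Fin m → X)) (ξ δ D₀ : ℝ) : Prop :=
  IsGLB {D : ℝ | 0 < D ∧ excessProb d P W ρ f ξ D ≤ δ} D₀

/-- Joint source-channel dispersion `V_J = V_S(P, D*) + ρ V_C(W)` at the distortion level `D*`, where
`V_C(W) = V_min(W)`. -/
def jsccDispersion (d : S → T → ℝ) (P : S → ℝ) (W : X → Y → ℝ) (ρ D : ℝ) : ℝ :=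
  sourceDispersion d P D + ρ * vMin W

end Joint

end JSCC

end

open JSCC

set_option linter.unusedSectionVars false

/-! Both parts reduce the excess event to a tail event for a sum of independent bounded variables,
up to errors O(log n) in the sum and O(log n/√n) in the probability, and then invert a Gaussian
approximation.

Source side. Let D have rate R(P,D) = R(P,D*) + τ with τ = O(1/√n). A second-order Taylor bound at
(P,D*) gives n(R(P_S,D) - R(P,D)) = Σ r(S_i) + O(log n) for typical source words, where r is the
P-centred gradient of R in Q, so that its variance is V_S (`exists_source_expansion`). Levels can be
indexed by τ because R has negative D-derivative where it is positive (`rdf_deriv_neg`).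

Channel side. For every suitable output law q, I(P_x,P_{Y|x}) = D(P_{Y|x}‖W|P_x) + (empirical mean
of log W/q) - D(output type‖q). The method of types bounds the conditional divergence by O(log n/n)
outside an event of probability 1/(m+1), and the middle term is a mean of independent variables once
x is fixed.

Constant inputs. With q the output law of the actual type, the last divergence is at most the
conditional one, so only the sum remains (`exists_channel_expansion`). Evaluating the excess
probability at the two rates τ = -√(V/n) Q⁻¹(ε) ± C log n/n puts it on either side of ε + ζ_n, and
monotonicity in D traps the threshold.

Arbitrary inputs. Take q to be the unique capacity-achieving output law. An input word has a deficit
η, the sum of its divergence deficit Σ P_x(a)(C - D(W_a‖q)) and of ‖P_xW - q‖. The normalized mutual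
information loses at least a multiple of η² (`exists_mutualInfo_condType_le`), while a Hoffman-type
bound shows that the normalized variance differs from V_min by at most a multiple of η
(`exists_capacity_output`). In the Gaussian comparison the linear effect of η is absorbed by the
quadratic loss through the arithmetic-geometric mean inequality, at a cost O(log n)
(`exists_gaussCdf_le`). So no input word makes small information less likely than letters drawn
i.i.d. from a capacity-achieving law (`exists_prob_le_prob_add`). The comparison is made
conditionally on the source word, hence dependence of x on S does not help.

The Gaussian approximation is a Berry–Esseen theorem for bounded variables proved by Stein's method
(`berryEsseen`); the inversion is `exists_quantile_bound`. -/

namespace JSCC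

noncomputable section

/-! ### The standard Gaussian law and the solution of Stein's equation. -/

section Gaussian

open MeasureTheory ProbabilityTheory Set

/-- Density of the standard Gaussian distribution. -/
def gaussPdf (x : ℝ) : ℝ := gaussianPDFReal 0 1 x

/-- Distribution function of the standard Gaussian distribution. -/
def gaussCdf (x : ℝ) : ℝ := (gaussianReal 0 1).real (Iic x)

lemma gaussPdf_eq (x : ℝ) : gaussPdf x = (√(2 * Real.pi))⁻¹ * Real.exp (-(x ^ 2) / 2) := by
  simp [gaussPdf, gaussianPDFReal]

lemma gaussPdf_pos (x : ℝ) : 0 < gaussPdf x := gaussianPDFReal_pos _ _ _ one_ne_zero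

lemma continuous_gaussPdf : Continuous gaussPdf := by
  have : gaussPdf = fun x => (√(2 * Real.pi))⁻¹ * Real.exp (-(x ^ 2) / 2) := funext gaussPdf_eq
  rw [this]; fun_prop

lemma integrable_gaussPdf : Integrable gaussPdf := integrable_gaussianPDFReal 0 1

lemma one_le_sqrt_two_pi : 1 ≤ √(2 * Real.pi) := by
  rw [Real.one_le_sqrt]; nlinarith [Real.pi_gt_three]

lemma gaussPdf_le_one (x : ℝ) : gaussPdf x ≤ 1 := by
  rw [gaussPdf_eq]
  have h1 : (√(2 * Real.pi))⁻¹ ≤ 1 := inv_le_one_of_one_le₀ one_le_sqrt_two_pi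
  have h2 : Real.exp (-(x ^ 2) / 2) ≤ 1 := Real.exp_le_one_iff.2 (by nlinarith [sq_nonneg x])
  exact mul_le_one₀ h1 (Real.exp_pos _).le h2

lemma gaussianReal_real_eq_integral {s : Set ℝ} : (gaussianReal 0 1).real s = ∫ x in s, gaussPdf x := by
  rw [measureReal_def, gaussianReal_apply_eq_integral 0 one_ne_zero, ENNReal.toReal_ofReal]
  · rfl
  · exact integral_nonneg fun x => gaussianPDFReal_nonneg _ _ _

lemma gaussCdf_add_gaussQ (x : ℝ) : gaussCdf x + gaussQ x = 1 := by
  have := measureReal_add_measureReal_compl (μ := gaussianReal 0 1) (measurableSet_Iic (a := x))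
  rw [compl_Iic] at this
  simpa [gaussCdf, gaussQ] using this

lemma gaussQ_eq (x : ℝ) : gaussQ x = 1 - gaussCdf x := by
  linarith [gaussCdf_add_gaussQ x]

lemma gaussCdf_nonneg (x : ℝ) : 0 ≤ gaussCdf x := measureReal_nonneg

lemma gaussQ_nonneg (x : ℝ) : 0 ≤ gaussQ x := measureReal_nonneg

lemma gaussCdf_le_one (x : ℝ) : gaussCdf x ≤ 1 := by
  linarith [gaussCdf_add_gaussQ x, gaussQ_nonneg x]

lemma gaussCdf_mono : Monotone gaussCdf := fun _ _ h => measureReal_mono (Iic_subset_Iic.2 h)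

lemma gaussCdf_sub (a b : ℝ) : gaussCdf b - gaussCdf a = ∫ x in a..b, gaussPdf x := by
  unfold gaussCdf
  rw [gaussianReal_real_eq_integral, gaussianReal_real_eq_integral,
    intervalIntegral.integral_Iic_sub_Iic integrable_gaussPdf.integrableOn
      integrable_gaussPdf.integrableOn]

lemma hasDerivAt_gaussCdf (x : ℝ) : HasDerivAt gaussCdf (gaussPdf x) x := by
  have h : gaussCdf = fun y => (∫ t in (0 : ℝ)..y, gaussPdf t) + gaussCdf 0 := by
    funext y; rw [← gaussCdf_sub]; ring
  rw [h]
  exact (intervalIntegral.integral_hasDerivAt_right (continuous_gaussPdf.intervalIntegrable _ _)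
    (continuous_gaussPdf.stronglyMeasurableAtFilter _ _) continuous_gaussPdf.continuousAt).add_const _

lemma continuous_gaussCdf : Continuous gaussCdf :=
  continuous_iff_continuousAt.2 fun x => (hasDerivAt_gaussCdf x).continuousAt

lemma gaussCdf_neg (x : ℝ) : gaussCdf (-x) = gaussQ x := by
  have h : (gaussianReal 0 1).map (fun x => -x) = gaussianReal 0 1 := by
    simpa using gaussianReal_map_neg (μ := 0) (v := 1)
  have h2 : gaussQ x = (gaussianReal 0 1).real (Ici x) := by
    unfold gaussQ
    rw [gaussianReal_real_eq_integral, gaussianReal_real_eq_integral, integral_Ici_eq_integral_Ioi]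
  rw [h2]
  unfold gaussCdf
  nth_rw 1 [← h]
  rw [map_measureReal_apply measurable_neg measurableSet_Iic]
  congr 1
  ext y; simp

lemma gaussCdf_lipschitz {a b : ℝ} (h : a ≤ b) : gaussCdf b ≤ gaussCdf a + (b - a) := by
  have : gaussCdf b - gaussCdf a ≤ ∫ _ in a..b, (1 : ℝ) := by
    rw [gaussCdf_sub]
    exact intervalIntegral.integral_mono_on h (continuous_gaussPdf.intervalIntegrable _ _)
      (by simp) fun x _ => gaussPdf_le_one x
  simp at this
  linarith

/-- On the tail w ≤ x, and x φ(x) is the derivative of -φ, so its integral over the tail is φ(w). -/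
lemma mul_gaussQ_le {w : ℝ} (hw : 0 < w) : w * gaussQ w ≤ gaussPdf w := by
  have hd : ∀ x : ℝ, HasDerivAt (fun x => -gaussPdf x) (x * gaussPdf x) x := by
    intro x
    have : gaussPdf = fun x => (√(2 * Real.pi))⁻¹ * Real.exp (-(x ^ 2) / 2) := funext gaussPdf_eq
    rw [this]
    have h1 : HasDerivAt (fun x : ℝ => -(x ^ 2) / 2) (-x) x := by
      exact (((hasDerivAt_pow 2 x).neg).div_const 2).congr_deriv (by norm_num; ring)
    exact ((h1.exp).const_mul (√(2 * Real.pi))⁻¹).neg.congr_deriv (by ring)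
  have ht : Tendsto (fun x => -gaussPdf x) atTop (𝓝 0) := by
    have h2 : Tendsto (fun x : ℝ => Real.exp (-(x ^ 2) / 2)) atTop (𝓝 0) := by
      refine Real.tendsto_exp_atBot.comp ?_
      have : Tendsto (fun x : ℝ => x ^ 2 / 2) atTop atTop :=
        (tendsto_pow_atTop two_ne_zero).atTop_div_const two_pos
      have h3 := tendsto_neg_atTop_atBot.comp this
      refine h3.congr fun x => ?_
      simp; ring
    have := (h2.const_mul (√(2 * Real.pi))⁻¹).neg
    simp only [mul_zero, neg_zero] at this
    exact this.congr fun x => by rw [gaussPdf_eq]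
  have hint : IntegrableOn (fun x => x * gaussPdf x) (Ioi w) :=
    integrableOn_Ioi_deriv_of_nonneg (hd w).continuousAt.continuousWithinAt (fun x _ => hd x)
      (fun x hx => mul_nonneg (hw.le.trans (le_of_lt hx)) (gaussPdf_pos x).le) ht
  have hval := integral_Ioi_of_hasDerivAt_of_tendsto (a := w)
    (hd w).continuousAt.continuousWithinAt (fun x _ => hd x) hint ht
  unfold gaussQ
  rw [gaussianReal_real_eq_integral, ← integral_const_mul]
  have : ∫ x in Ioi w, w * gaussPdf x ≤ ∫ x in Ioi w, x * gaussPdf x := by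
    refine setIntegral_mono_on (integrable_gaussPdf.integrableOn.const_mul w) hint measurableSet_Ioi ?_
    intro x hx
    exact mul_le_mul_of_nonneg_right (le_of_lt hx) (gaussPdf_pos x).le
  rw [hval] at this
  linarith

/-- Mills ratio bound near zero. -/
lemma gaussQ_le_mul_gaussPdf {w : ℝ} (hw : 0 ≤ w) : gaussQ w ≤ 5 * gaussPdf w := by
  rcases le_or_gt 1 w with h | h
  · have := mul_gaussQ_le (w := w) (by linarith)
    nlinarith [gaussQ_nonneg w, gaussPdf_pos w]
  · have h1 : gaussQ w ≤ 1 := by linarith [gaussCdf_add_gaussQ w, gaussCdf_nonneg w]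
    -- For 0 ≤ w < 1 the exponential is at least exp(-1/2) ≥ 0.6, while √(2π) ≤ 2.51; hence the
    -- constant 5.
    have h2 : 1 ≤ 5 * gaussPdf w := by
      rw [gaussPdf_eq]
      have e1 : (1 : ℝ) / 2 ≤ Real.exp (-(w ^ 2) / 2) := by
        have := Real.add_one_le_exp (-(w ^ 2) / 2)
        nlinarith
      have e2 : √(2 * Real.pi) ≤ 5 / 2 + 1 / 100 := by
        rw [Real.sqrt_le_left (by norm_num)]
        nlinarith [Real.pi_lt_d2]
      have e4 : √(2 * Real.pi) ≤ 5 * Real.exp (-(w ^ 2) / 2) := by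
        have e5 : (6 : ℝ) / 10 ≤ Real.exp (-(w ^ 2) / 2) := by
          have : Real.exp (-(1 / 2)) ≤ Real.exp (-(w ^ 2) / 2) := Real.exp_le_exp.2 (by nlinarith)
          refine le_trans ?_ this
          have h7 : Real.exp (1 / 2) ^ 2 ≤ 2.7182818286 := by
            rw [← Real.exp_nat_mul]; norm_num; linarith [Real.exp_one_lt_d9]
          have h8 := Real.exp_pos (1 / 2)
          rw [Real.exp_neg, le_inv_comm₀ (by norm_num) h8]
          nlinarith
        linarith
      have e3 : 0 < √(2 * Real.pi) := by linarith [one_le_sqrt_two_pi]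
      rw [← mul_assoc, mul_comm 5, mul_assoc, inv_mul_eq_div, le_div_iff₀ e3]
      linarith
    linarith

/-- The solution of Stein's equation for the indicator function of `(-∞, z]`. -/
def steinSol (z w : ℝ) : ℝ := (gaussPdf w)⁻¹ * (gaussCdf (min w z) - gaussCdf w * gaussCdf z)

/-- The difference is N(w)(1 - N(z)) for w ≤ z and N(z)(1 - N(w)) for w ≥ z, so it is at most both
N(w) and 1 - N(w). Combined with the Mills bounds this controls f_z and w f_z uniformly in z. -/
lemma steinSol_nonneg_le (z w : ℝ) :
    0 ≤ gaussCdf (min w z) - gaussCdf w * gaussCdf z ∧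
    gaussCdf (min w z) - gaussCdf w * gaussCdf z ≤ gaussQ |w| := by
  have a1 := gaussCdf_nonneg w
  have a2 := gaussCdf_nonneg z
  have b1 := gaussCdf_le_one w
  have b2 := gaussCdf_le_one z
  rcases le_total w z with h | h
  · rw [min_eq_left h]
    have hm := gaussCdf_mono h
    refine ⟨by nlinarith, ?_⟩
    rcases le_total 0 w with h0 | h0
    · rw [abs_of_nonneg h0, gaussQ_eq]; nlinarith
    · rw [abs_of_nonpos h0, ← gaussCdf_neg, neg_neg]; nlinarith
  · rw [min_eq_right h]
    have hm := gaussCdf_mono h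
    refine ⟨by nlinarith, ?_⟩
    rcases le_total 0 w with h0 | h0
    · rw [abs_of_nonneg h0, gaussQ_eq]; nlinarith
    · rw [abs_of_nonpos h0, ← gaussCdf_neg, neg_neg]; nlinarith

lemma gaussPdf_abs (w : ℝ) : gaussPdf |w| = gaussPdf w := by simp [gaussPdf_eq]

lemma abs_steinSol_le (z w : ℝ) : |steinSol z w| ≤ 5 := by
  obtain ⟨h1, h2⟩ := steinSol_nonneg_le z w
  have h3 := gaussQ_le_mul_gaussPdf (abs_nonneg w)
  rw [gaussPdf_abs] at h3
  have hp := gaussPdf_pos w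
  unfold steinSol
  rw [abs_of_nonneg (by positivity), inv_mul_eq_div, div_le_iff₀ hp]
  linarith

lemma abs_mul_steinSol_le (z w : ℝ) : |w * steinSol z w| ≤ 1 := by
  obtain ⟨h1, h2⟩ := steinSol_nonneg_le z w
  have hp := gaussPdf_pos w
  unfold steinSol
  rw [abs_mul, abs_of_nonneg (a := _ * _) (by positivity), inv_mul_eq_div, ← mul_div_assoc,
    div_le_iff₀ hp]
  rcases eq_or_ne w 0 with rfl | hw
  · simpa using hp.le
  · have h3 := mul_gaussQ_le (abs_pos.2 hw)
    rw [gaussPdf_abs] at h3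
    nlinarith [abs_nonneg w]

lemma continuous_steinSol (z : ℝ) : Continuous (steinSol z) := by
  unfold steinSol
  refine (continuous_gaussPdf.inv₀ fun x => (gaussPdf_pos x).ne').mul ?_
  exact (continuous_gaussCdf.comp (continuous_id.min continuous_const)).sub
    (continuous_gaussCdf.mul continuous_const)

/-- Stein's equation f' - w f = 1{w ≤ z} - N(z). The point z is excluded because the derivative
jumps there. -/
lemma hasDerivAt_steinSol {z w : ℝ} (h : w ≠ z) :
    HasDerivAt (steinSol z)
      (w * steinSol z w + (if w ≤ z then 1 else 0) - gaussCdf z) w := by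
  have hp := gaussPdf_pos w
  have hd : HasDerivAt (fun x => (gaussPdf x)⁻¹) (w * (gaussPdf w)⁻¹) w := by
    have : (fun x => (gaussPdf x)⁻¹) = fun x => (√(2 * Real.pi)) * Real.exp (x ^ 2 / 2) := by
      funext x; rw [gaussPdf_eq, mul_inv, inv_inv, ← Real.exp_neg]; congr 2; ring
    rw [congrFun this w, this]
    have h1 : HasDerivAt (fun x : ℝ => x ^ 2 / 2) w w := by
      exact ((hasDerivAt_pow 2 w).div_const 2).congr_deriv (by norm_num)
    exact ((h1.exp).const_mul (√(2 * Real.pi))).congr_deriv (by ring)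
  rcases lt_or_gt_of_ne h with h | h
  · have he : HasDerivAt (fun x => gaussCdf (min x z) - gaussCdf x * gaussCdf z)
        (gaussPdf w - gaussPdf w * gaussCdf z) w := by
      refine HasDerivAt.sub ?_ ((hasDerivAt_gaussCdf w).mul_const _)
      refine (hasDerivAt_gaussCdf w).congr_of_eventuallyEq ?_
      filter_upwards [gt_mem_nhds h] with x hx
      rw [min_eq_left hx.le]
    have := hd.mul he
    refine this.congr_deriv ?_
    rw [if_pos h.le]
    unfold steinSol
    field_simp
    ring
  · have he : HasDerivAt (fun x => gaussCdf (min x z) - gaussCdf x * gaussCdf z)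
        (0 - gaussPdf w * gaussCdf z) w := by
      refine HasDerivAt.sub ?_ ((hasDerivAt_gaussCdf w).mul_const _)
      refine (hasDerivAt_const w (gaussCdf z)).congr_of_eventuallyEq ?_
      filter_upwards [lt_mem_nhds h] with x hx
      rw [min_eq_right (le_of_lt hx)]
    have := hd.mul he
    refine this.congr_deriv ?_
    rw [if_neg (not_le.2 h)]
    unfold steinSol
    field_simp
    ring

/-- Mean value bounds across the jump at z: the fundamental theorem of calculus tolerates a
countable exceptional set. -/
lemma steinSol_sub_mem {z a b l u : ℝ} (hab : a ≤ b)
    (hl : ∀ w ∈ Icc a b, l ≤ w * steinSol z w + (if w ≤ z then 1 else 0) - gaussCdf z)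
    (hu : ∀ w ∈ Icc a b, w * steinSol z w + (if w ≤ z then 1 else 0) - gaussCdf z ≤ u) :
    l * (b - a) ≤ steinSol z b - steinSol z a ∧ steinSol z b - steinSol z a ≤ u * (b - a) := by
  have hint : IntervalIntegrable
      (fun w => w * steinSol z w + (if w ≤ z then 1 else 0) - gaussCdf z) volume a b := by
    refine IntervalIntegrable.sub (IntervalIntegrable.add ?_ ?_) (by simp)
    · exact (continuous_id.mul (continuous_steinSol z)).intervalIntegrable _ _
    · have : (fun w : ℝ => if w ≤ z then (1 : ℝ) else 0) = (Iic z).indicator fun _ => 1 := by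
        funext w; simp [indicator]
      rw [this, intervalIntegrable_iff]
      exact (integrableOn_const (by simp)).indicator measurableSet_Iic
  have heq := MeasureTheory.integral_eq_of_hasDerivAt_off_countable (steinSol z) _
    (countable_singleton z) (continuous_steinSol z).continuousOn
    (fun w hw => hasDerivAt_steinSol (fun h => hw.2 h)) hint
  rw [← heq]
  constructor
  · have := intervalIntegral.integral_mono_on hab (μ := volume) (f := fun _ => l) (by simp) hint hl
    simpa [mul_comm] using this
  · have := intervalIntegral.integral_mono_on hab (μ := volume) (g := fun _ => u) hint (by simp) hu
    simpa [mul_comm] using this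

lemma abs_steinDeriv_le (z w : ℝ) :
    |w * steinSol z w + (if w ≤ z then 1 else 0) - gaussCdf z| ≤ 2 := by
  have h := abs_le.1 (abs_mul_steinSol_le z w)
  have a2 := gaussCdf_nonneg z
  have b2 := gaussCdf_le_one z
  rw [abs_le]
  split_ifs <;> constructor <;> linarith

lemma steinSol_lipschitz (z a b : ℝ) : |steinSol z b - steinSol z a| ≤ 2 * |b - a| := by
  wlog hab : a ≤ b generalizing a b
  · rw [abs_sub_comm, abs_sub_comm b a]; exact this b a (le_of_not_ge hab)
  obtain ⟨h1, h2⟩ := steinSol_sub_mem (z := z) (l := -2) (u := 2) hab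
    (fun w _ => (abs_le.1 (abs_steinDeriv_le z w)).1)
    (fun w _ => (abs_le.1 (abs_steinDeriv_le z w)).2)
  rw [abs_of_nonneg (sub_nonneg.2 hab), abs_le]
  constructor <;> linarith

/-- Product rule for increments; 2 is the Lipschitz constant of f_z and 5 its sup bound. -/
lemma mul_steinSol_lipschitz (z a b : ℝ) :
    |b * steinSol z b - a * steinSol z a| ≤ (2 * |a| + 5) * |b - a| := by
  have h : b * steinSol z b - a * steinSol z a
      = a * (steinSol z b - steinSol z a) + (b - a) * steinSol z b := by ring
  rw [h]
  refine (abs_add_le _ _).trans ?_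
  rw [abs_mul, abs_mul]
  have h1 := steinSol_lipschitz z a b
  have h2 := abs_steinSol_le z b
  nlinarith [abs_nonneg a, abs_nonneg (b - a), mul_le_mul_of_nonneg_left h1 (abs_nonneg a),
    mul_le_mul_of_nonneg_left h2 (abs_nonneg (b - a))]

end Gaussian

/-! ### Berry–Esseen theorem by Stein's method. -/

section BerryEsseen

open MeasureTheory ProbabilityTheory

variable {Ω ι : Type*} [MeasurableSpace Ω] [Fintype ι]

/-- Leave-one-out argument: with W = R_i + X_i and R_i independent of the centred X_i, E[X_i f(W)] =
E[X_i (f(W) - f(R_i))] ≤ E[X_i²] E[H(R_i)] ≤ E[X_i²] E[H'(W)], and the second moments add up to 1.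
The majorants are left abstract so that the lemma applies to f and to -f. -/
lemma integral_sum_mul_le_of_exchange {μ : Measure Ω} [IsProbabilityMeasure μ] {X : ι → Ω → ℝ}
    (hm : ∀ i, Measurable (X i)) (hind : iIndepFun X μ) {β : ℝ} (hb : ∀ i ω, |X i ω| ≤ β)
    (hmean : ∀ i, ∫ ω, X i ω ∂μ = 0) (hvar : ∑ i, ∫ ω, X i ω ^ 2 ∂μ = 1)
    {f H H' : ℝ → ℝ} (hf : Continuous f) {M : ℝ} (hfM : ∀ w, |f w| ≤ M)
    (hHm : Measurable H)
    (hHi : ∀ g : Ω → ℝ, Integrable g μ → Integrable (fun ω => H (g ω)) μ)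
    (hHi' : ∀ g : Ω → ℝ, Integrable g μ → Integrable (fun ω => H' (g ω)) μ)
    (hfH : ∀ a x, |x| ≤ β → x * (f (a + x) - f a) ≤ x ^ 2 * H a)
    (hHH : ∀ a x, |x| ≤ β → H a ≤ H' (a + x)) :
    ∫ ω, (∑ i, X i ω) * f (∑ i, X i ω) ∂μ ≤ ∫ ω, H' (∑ i, X i ω) ∂μ := by
  classical
  have hXi : ∀ i, Integrable (X i) μ := fun i =>
    Integrable.of_bound (hm i).aestronglyMeasurable β (.of_forall fun ω => hb i ω)
  set R : ι → Ω → ℝ := fun i ω => ∑ j ∈ Finset.univ.erase i, X j ω with hR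
  have hRm : ∀ i, Measurable (R i) := fun i => Finset.measurable_sum _ fun j _ => hm j
  have hWm : Measurable fun ω => ∑ i, X i ω := Finset.measurable_sum _ fun j _ => hm j
  have hRi : ∀ i, Integrable (R i) μ := fun i => integrable_finsetSum _ fun j _ => hXi j
  have hWi : Integrable (fun ω => ∑ i, X i ω) μ := integrable_finsetSum _ fun j _ => hXi j
  have hsplit : ∀ i ω, ∑ j, X j ω = R i ω + X i ω := fun i ω =>
    (Finset.sum_erase_add _ _ (Finset.mem_univ i)).symm
  have hindR : ∀ i, IndepFun (R i) (X i) μ := fun i => by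
    have := hind.indepFun_finsetSum_of_notMem hm (s := Finset.univ.erase i) (i := i) (by simp)
    convert this using 1
    funext ω; simp [hR]
  have hX2 : ∀ i, Integrable (fun ω => X i ω ^ 2) μ := fun i =>
    Integrable.of_bound ((hm i).pow_const 2).aestronglyMeasurable (β ^ 2) (.of_forall fun ω => by
      rw [Real.norm_eq_abs, abs_pow]; exact pow_le_pow_left₀ (abs_nonneg _) (hb i ω) 2)
  have hfb : ∀ g : Ω → ℝ, Measurable g → Integrable (fun ω => f (g ω)) μ := fun g hg =>
    Integrable.of_bound (hf.measurable.comp hg).aestronglyMeasurable M (.of_forall fun ω => hfM _)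
  have hXf : ∀ i (g : Ω → ℝ), Measurable g → Integrable (fun ω => X i ω * f (g ω)) μ :=
    fun i g hg => (hfb g hg).bdd_mul (hm i).aestronglyMeasurable (.of_forall fun ω => hb i ω)
  have hX2H : ∀ i, Integrable (fun ω => X i ω ^ 2 * H (R i ω)) μ := fun i =>
    (hHi _ (hRi i)).bdd_mul (c := β ^ 2) ((hm i).pow_const 2).aestronglyMeasurable
      (.of_forall fun ω => by
        rw [Real.norm_eq_abs, abs_pow]; exact pow_le_pow_left₀ (abs_nonneg _) (hb i ω) 2)
  have hstep : ∀ i, ∫ ω, X i ω * f (∑ j, X j ω) ∂μ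
      ≤ (∫ ω, X i ω ^ 2 ∂μ) * ∫ ω, H' (∑ j, X j ω) ∂μ := by
    intro i
    have h0 : ∫ ω, X i ω * f (R i ω) ∂μ = 0 := by
      have h1 : IndepFun (X i) (fun ω => f (R i ω)) μ :=
        (hindR i).symm.comp measurable_id hf.measurable
      rw [h1.integral_fun_mul_eq_mul_integral (hm i).aestronglyMeasurable
        (hf.measurable.comp (hRm i)).aestronglyMeasurable, hmean, zero_mul]
    have h2 : ∫ ω, X i ω ^ 2 * H (R i ω) ∂μ = (∫ ω, X i ω ^ 2 ∂μ) * ∫ ω, H (R i ω) ∂μ := by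
      have h1 : IndepFun (fun ω => X i ω ^ 2) (fun ω => H (R i ω)) μ :=
        (hindR i).symm.comp (φ := fun x => x ^ 2) (measurable_id.pow_const 2) hHm
      exact h1.integral_fun_mul_eq_mul_integral ((hm i).pow_const 2).aestronglyMeasurable
        (hHm.comp (hRm i)).aestronglyMeasurable
    calc ∫ ω, X i ω * f (∑ j, X j ω) ∂μ
        = ∫ ω, (X i ω * f (∑ j, X j ω) - X i ω * f (R i ω)) ∂μ := by
          rw [integral_sub (hXf i _ hWm) (hXf i _ (hRm i)), h0, sub_zero]
      _ ≤ ∫ ω, X i ω ^ 2 * H (R i ω) ∂μ := by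
          refine integral_mono ((hXf i _ hWm).sub (hXf i _ (hRm i))) (hX2H i) fun ω => ?_
          have := hfH (R i ω) (X i ω) (hb i ω)
          rw [← hsplit] at this
          simpa [mul_sub] using this
      _ = (∫ ω, X i ω ^ 2 ∂μ) * ∫ ω, H (R i ω) ∂μ := h2
      _ ≤ _ := by
          refine mul_le_mul_of_nonneg_left ?_ (integral_nonneg fun ω => sq_nonneg _)
          refine integral_mono (hHi _ (hRi i)) (hHi' _ hWi) fun ω => ?_
          have := hHH (R i ω) (X i ω) (hb i ω)
          rwa [← hsplit] at this
  calc ∫ ω, (∑ i, X i ω) * f (∑ i, X i ω) ∂μ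
      = ∑ i, ∫ ω, X i ω * f (∑ j, X j ω) ∂μ := by
        rw [← integral_finsetSum _ fun i _ => hXf i _ hWm]
        simp_rw [Finset.sum_mul]
    _ ≤ ∑ i, (∫ ω, X i ω ^ 2 ∂μ) * ∫ ω, H' (∑ j, X j ω) ∂μ := Finset.sum_le_sum fun i _ => hstep i
    _ = _ := by rw [← Finset.sum_mul, hvar, one_mul]

/-- The function `w ↦ w f_z(w) + 1{w ≤ z'} - N(z) + s (4|w| + 14)`, where `f_z` solves Stein's
equation for the level `z`. -/
def steinUpper (z z' s w : ℝ) : ℝ :=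
  w * steinSol z w + (if w ≤ z' then 1 else 0) - gaussCdf z + s * (4 * |w| + 14)

lemma measurable_steinUpper (z z' s : ℝ) : Measurable (steinUpper z z' s) := by
  unfold steinUpper
  refine Measurable.add (Measurable.sub (Measurable.add ?_ ?_) measurable_const) ?_
  · exact measurable_id.mul (continuous_steinSol z).measurable
  · exact Measurable.ite measurableSet_Iic measurable_const measurable_const
  · exact Continuous.measurable (by fun_prop)

lemma integrable_steinUpper {μ : Measure Ω} [IsProbabilityMeasure μ] (z z' s : ℝ) {g : Ω → ℝ}
    (hg : Integrable g μ) : Integrable (fun ω => steinUpper z z' s (g ω)) μ := by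
  have h1 : Integrable (fun ω => (3 + |s| * 14) + |s| * 4 * |g ω|) μ :=
    (integrable_const _).add (hg.abs.const_mul _)
  refine h1.mono' ((measurable_steinUpper z z' s).comp_aemeasurable
    hg.aemeasurable).aestronglyMeasurable (.of_forall fun ω => ?_)
  rw [Real.norm_eq_abs]
  unfold steinUpper
  have e1 := abs_mul_steinSol_le z (g ω)
  have e2 : |(if g ω ≤ z' then (1 : ℝ) else 0)| ≤ 1 := by split_ifs <;> simp
  have e3 : |gaussCdf z| ≤ 1 := by
    rw [abs_of_nonneg (gaussCdf_nonneg z)]; exact gaussCdf_le_one z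
  have e4 : |s * (4 * |g ω| + 14)| = |s| * 14 + |s| * 4 * |g ω| := by
    rw [abs_mul, abs_of_nonneg (a := 4 * |g ω| + 14) (by positivity)]; ring
  have t1 := abs_add_le (g ω * steinSol z (g ω) + (if g ω ≤ z' then 1 else 0) - gaussCdf z)
    (s * (4 * |g ω| + 14))
  have t2 := abs_sub (g ω * steinSol z (g ω) + (if g ω ≤ z' then 1 else 0)) (gaussCdf z)
  have t3 := abs_add_le (g ω * steinSol z (g ω)) (if g ω ≤ z' then 1 else 0)
  linarith

/-- Within distance β of a, the right side of Stein's equation moves by at most the Lipschitz error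
of w f_z, provided the jump is moved by β in the favourable direction. Integration over the segment
from a to a + x, times x, gives both bounds for either sign of x. -/
lemma mul_steinSol_sub_mem {z β a x : ℝ} (hx : |x| ≤ β) :
    x ^ 2 * (a * steinSol z a + (if a ≤ z - β then 1 else 0) - gaussCdf z - β * (2 * |a| + 5))
      ≤ x * (steinSol z (a + x) - steinSol z a) ∧
    x * (steinSol z (a + x) - steinSol z a) ≤
      x ^ 2 * (a * steinSol z a + (if a ≤ z + β then 1 else 0) - gaussCdf z + β * (2 * |a| + 5)) := by
  set l := a * steinSol z a + (if a ≤ z - β then 1 else 0) - gaussCdf z - β * (2 * |a| + 5) with hl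
  set u := a * steinSol z a + (if a ≤ z + β then 1 else 0) - gaussCdf z + β * (2 * |a| + 5) with hu
  have key : ∀ w, |w - a| ≤ β → l ≤ w * steinSol z w + (if w ≤ z then 1 else 0) - gaussCdf z ∧
      w * steinSol z w + (if w ≤ z then 1 else 0) - gaussCdf z ≤ u := by
    intro w hw
    have h1 := (mul_steinSol_lipschitz z a w).trans
      (mul_le_mul_of_nonneg_left hw (by positivity : 0 ≤ 2 * |a| + 5))
    rw [abs_le] at h1 hw
    have i1 : (if w ≤ z then (1 : ℝ) else 0) ≤ if a ≤ z + β then 1 else 0 := by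
      split_ifs <;> linarith
    have i2 : (if a ≤ z - β then (1 : ℝ) else 0) ≤ if w ≤ z then 1 else 0 := by
      split_ifs <;> linarith
    constructor <;> linarith
  rw [abs_le] at hx
  rcases le_total 0 x with h0 | h0
  · obtain ⟨h1, h2⟩ := steinSol_sub_mem (z := z) (a := a) (b := a + x) (l := l) (u := u)
      (by linarith)
      (fun w hw => (key w (by rw [abs_le]; constructor <;> linarith [hw.1, hw.2])).1)
      (fun w hw => (key w (by rw [abs_le]; constructor <;> linarith [hw.1, hw.2])).2)
    constructor <;> nlinarith
  · obtain ⟨h1, h2⟩ := steinSol_sub_mem (z := z) (a := a + x) (b := a) (l := l) (u := u)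
      (by linarith)
      (fun w hw => (key w (by rw [abs_le]; constructor <;> linarith [hw.1, hw.2])).1)
      (fun w hw => (key w (by rw [abs_le]; constructor <;> linarith [hw.1, hw.2])).2)
    constructor <;> nlinarith

/-- Going back from a to a + x costs the Lipschitz error a second time, in total β(4|a| + 10);
replacing |a| by |a + x| + 1 turns 10 into 14. The jump moves by a second β. -/
lemma steinUpper_compare {z β a x : ℝ} (hβ1 : β ≤ 1) (hx : |x| ≤ β) :
    a * steinSol z a + (if a ≤ z + β then 1 else 0) - gaussCdf z + β * (2 * |a| + 5)
      ≤ steinUpper z (z + 2 * β) β (a + x) ∧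
    steinUpper z (z - 2 * β) (-β) (a + x) ≤
      a * steinSol z a + (if a ≤ z - β then 1 else 0) - gaussCdf z - β * (2 * |a| + 5) := by
  have hβ : 0 ≤ β := (abs_nonneg x).trans hx
  have h1 := (mul_steinSol_lipschitz z a (a + x)).trans
      (mul_le_mul_of_nonneg_left (show |a + x - a| ≤ β by simpa using hx)
        (by positivity : 0 ≤ 2 * |a| + 5))
  have h2 : |a| ≤ |a + x| + 1 := by
    have := abs_sub (a + x) x
    simp at this; linarith
  have h3 := mul_le_mul_of_nonneg_left h2 hβ
  rw [abs_le] at h1 hx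
  have i1 : (if a ≤ z + β then (1 : ℝ) else 0) ≤ if a + x ≤ z + 2 * β then 1 else 0 := by
    split_ifs <;> linarith
  have i2 : (if a + x ≤ z - 2 * β then (1 : ℝ) else 0) ≤ if a ≤ z - β then 1 else 0 := by
    split_ifs <;> linarith
  unfold steinUpper
  constructor <;> nlinarith

lemma integral_sq_sum {μ : Measure Ω} [IsProbabilityMeasure μ] {X : ι → Ω → ℝ}
    (hm : ∀ i, Measurable (X i)) (hind : iIndepFun X μ) {β : ℝ} (hb : ∀ i ω, |X i ω| ≤ β)
    (hmean : ∀ i, ∫ ω, X i ω ∂μ = 0) :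
    MemLp (fun ω => ∑ i, X i ω) 2 μ ∧
      ∫ ω, (∑ i, X i ω) ^ 2 ∂μ = ∑ i, ∫ ω, X i ω ^ 2 ∂μ := by
  set W : Ω → ℝ := fun ω => ∑ i, X i ω with hW
  have hWm : Measurable W := Finset.measurable_sum _ fun j _ => hm j
  have hXi : ∀ i, Integrable (X i) μ := fun i =>
    Integrable.of_bound (hm i).aestronglyMeasurable β (.of_forall fun ω => hb i ω)
  have hL : ∀ i, MemLp (X i) 2 μ := fun i =>
    MemLp.of_bound (hm i).aestronglyMeasurable β (.of_forall fun ω => hb i ω)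
  have hmW : ∫ ω, W ω ∂μ = 0 := by
    rw [hW, integral_finsetSum _ fun i _ => hXi i]; simp [hmean]
  refine ⟨memLp_finsetSum _ fun i _ => hL i, ?_⟩
  have hW2 : W = ∑ i, X i := by funext ω; simp [hW]
  have hv : variance W μ = ∑ i, ∫ ω, X i ω ^ 2 ∂μ := by
    rw [hW2, IndepFun.variance_sum (fun i _ => hL i) fun i _ j _ hij => hind.indepFun hij]
    refine Finset.sum_congr rfl fun i _ => ?_
    rw [variance_of_integral_eq_zero (hm i).aemeasurable (hmean i)]
  rwa [variance_of_integral_eq_zero hWm.aemeasurable hmW] at hv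

/-- Berry–Esseen theorem for normalized sums of bounded independent random variables. -/
lemma berryEsseen_normalized {μ : Measure Ω} [IsProbabilityMeasure μ] {X : ι → Ω → ℝ}
    (hm : ∀ i, Measurable (X i)) (hind : iIndepFun X μ) {β : ℝ} (hβ1 : β ≤ 1)
    (hb : ∀ i ω, |X i ω| ≤ β)
    (hmean : ∀ i, ∫ ω, X i ω ∂μ = 0) (hvar : ∑ i, ∫ ω, X i ω ^ 2 ∂μ = 1) (z : ℝ) :
    gaussCdf z - 18 * β ≤ μ.real {ω | ∑ i, X i ω ≤ z + 2 * β} ∧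
    μ.real {ω | ∑ i, X i ω ≤ z - 2 * β} ≤ gaussCdf z + 18 * β := by
  have hβ : 0 ≤ β := by
    rcases isEmpty_or_nonempty ι with h | ⟨⟨i⟩⟩
    · simp at hvar
    · obtain ⟨ω⟩ : Nonempty Ω := nonempty_of_isProbabilityMeasure μ
      exact (abs_nonneg _).trans (hb i ω)
  set W : Ω → ℝ := fun ω => ∑ i, X i ω with hW
  have hWm : Measurable W := Finset.measurable_sum _ fun j _ => hm j
  have hXi : ∀ i, Integrable (X i) μ := fun i =>
    Integrable.of_bound (hm i).aestronglyMeasurable β (.of_forall fun ω => hb i ω)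
  have hWi : Integrable W μ := integrable_finsetSum _ fun j _ => hXi j
  have hWabs : ∫ ω, |W ω| ∂μ ≤ 1 := by
    obtain ⟨hWL, hv⟩ := integral_sq_sum hm hind hb hmean
    change MemLp W 2 μ at hWL
    change ∫ ω, W ω ^ 2 ∂μ = _ at hv
    rw [hvar] at hv
    have h2 : ∫ ω, |W ω| ∂μ ≤ ∫ ω, (1 / 2 + W ω ^ 2 / 2) ∂μ := by
      refine integral_mono hWi.abs ((integrable_const _).add (hWL.integrable_sq.div_const 2)) ?_
      intro ω
      show |W ω| ≤ 1 / 2 + W ω ^ 2 / 2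
      nlinarith [sq_nonneg (|W ω| - 1), sq_abs (W ω)]
    rw [integral_add (integrable_const _) (hWL.integrable_sq.div_const 2), integral_div 2 (fun ω => W ω ^ 2), hv] at h2
    simp at h2
    linarith
  have hgi : Integrable (fun ω => W ω * steinSol z (W ω)) μ :=
    Integrable.of_bound (hWm.mul ((continuous_steinSol z).measurable.comp hWm)).aestronglyMeasurable
      1 (.of_forall fun ω => abs_mul_steinSol_le z _)
  have hU : ∀ z' s, ∫ ω, steinUpper z z' s (W ω) ∂μ = (∫ ω, W ω * steinSol z (W ω) ∂μ)
      + μ.real {ω | W ω ≤ z'} - gaussCdf z + s * (4 * ∫ ω, |W ω| ∂μ + 14) := by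
    intro z' s
    have hset : MeasurableSet {ω | W ω ≤ z'} := measurableSet_le hWm measurable_const
    have hii : Integrable (fun ω => if W ω ≤ z' then (1 : ℝ) else 0) μ :=
      Integrable.of_bound (Measurable.ite hset measurable_const
        measurable_const).aestronglyMeasurable 1 (.of_forall fun ω => by split_ifs <;> simp)
    have hi1 : ∫ ω, (if W ω ≤ z' then (1 : ℝ) else 0) ∂μ = μ.real {ω | W ω ≤ z'} := by
      rw [← integral_indicator_one hset]
      refine integral_congr_ae (.of_forall fun ω => ?_)
      simp [Set.indicator]
    have hsi : Integrable (fun ω => s * (4 * |W ω| + 14)) μ :=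
      ((hWi.abs.const_mul 4).add (integrable_const _)).const_mul s
    unfold steinUpper
    have h1i : Integrable (fun ω => W ω * steinSol z (W ω) + if W ω ≤ z' then (1 : ℝ) else 0) μ :=
      hgi.add hii
    have h2i : Integrable (fun ω => W ω * steinSol z (W ω) + (if W ω ≤ z' then (1 : ℝ) else 0)
        - gaussCdf z) μ := h1i.sub (integrable_const _)
    rw [integral_add h2i hsi, integral_sub h1i (integrable_const _), integral_add hgi hii, hi1,
      integral_const_mul, integral_add (hWi.abs.const_mul 4) (integrable_const _),
      integral_const_mul]
    simp
  have habs0 : 0 ≤ ∫ ω, |W ω| ∂μ := integral_nonneg fun _ => abs_nonneg _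
  constructor
  -- The term E[W f_z(W)] occurs on both sides and cancels, leaving P(W ≤ z + 2β) - N(z) plus an
  -- error β(4 E|W| + 14) ≤ 18β. Since the level is shifted, no concentration inequality for W is
  -- needed.
  · have h := integral_sum_mul_le_of_exchange hm hind hb hmean hvar (continuous_steinSol z)
      (abs_steinSol_le z)
      (H := fun a => a * steinSol z a + (if a ≤ z + β then 1 else 0) - gaussCdf z
        + β * (2 * |a| + 5)) (H' := steinUpper z (z + 2 * β) β)
      ?_ ?_ (fun g hg => integrable_steinUpper _ _ _ hg)
      (fun a x hx => (mul_steinSol_sub_mem hx).2) (fun a x hx => (steinUpper_compare hβ1 hx).1)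
    · change ∫ ω, W ω * steinSol z (W ω) ∂μ ≤ ∫ ω, steinUpper z (z + 2 * β) β (W ω) ∂μ at h
      rw [hU] at h
      nlinarith
    -- The majorant is itself of the form `steinUpper` up to a constant: (β/2)(4|a| + 14) - 2β =
    -- β(2|a| + 5).
    · have := measurable_steinUpper z (z + β) (β / 2)
      have h3 : Measurable fun a : ℝ => - 2 * β := measurable_const
      convert this.add h3 using 1
      funext a
      simp only [steinUpper, Pi.add_apply]
      ring
    · intro g hg
      have := (integrable_steinUpper z (z + β) (β / 2) hg).add (integrable_const (-2 * β))
      refine this.congr (.of_forall fun ω => ?_)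
      simp only [steinUpper, Pi.add_apply]
      ring
  · have h := integral_sum_mul_le_of_exchange hm hind hb hmean hvar
      (f := fun w => - steinSol z w) (continuous_steinSol z).neg
      (M := 5) (fun w => by rw [abs_neg]; exact abs_steinSol_le z w)
      (H := fun a => -(a * steinSol z a + (if a ≤ z - β then 1 else 0) - gaussCdf z
        - β * (2 * |a| + 5))) (H' := fun w => - steinUpper z (z - 2 * β) (-β) w)
      ?_ ?_ (fun g hg => (integrable_steinUpper _ _ _ hg).neg)
      (fun a x hx => by linarith [(mul_steinSol_sub_mem (z := z) (a := a) hx).1])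
      (fun a x hx => neg_le_neg (steinUpper_compare hβ1 hx).2)
    · simp_rw [mul_neg] at h
      change ∫ ω, - (W ω * steinSol z (W ω)) ∂μ ≤ ∫ ω, - steinUpper z (z - 2 * β) (-β) (W ω) ∂μ at h
      rw [integral_neg, integral_neg, hU] at h
      nlinarith
    · have := measurable_steinUpper z (z - β) (-β / 2)
      have h3 : Measurable fun a : ℝ => 2 * β := measurable_const
      convert (this.add h3).neg using 1
      funext a
      simp only [steinUpper, Pi.add_apply, Pi.neg_apply]
      ring
    · intro g hg
      have := ((integrable_steinUpper z (z - β) (-β / 2) hg).add (integrable_const (2 * β))).neg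
      refine this.congr (.of_forall fun ω => ?_)
      simp only [steinUpper, Pi.add_apply, Pi.neg_apply]
      ring

/-- Berry–Esseen theorem for sums of bounded independent random variables. -/
theorem berryEsseen {μ : Measure Ω} [IsProbabilityMeasure μ] {X : ι → Ω → ℝ}
    (hm : ∀ i, Measurable (X i)) (hind : iIndepFun X μ) {B v : ℝ} (hv : 0 < v)
    (hb : ∀ i ω, |X i ω| ≤ B)
    (hmean : ∀ i, ∫ ω, X i ω ∂μ = 0) (hvar : ∑ i, ∫ ω, X i ω ^ 2 ∂μ = v) (z : ℝ) :
    |μ.real {ω | ∑ i, X i ω ≤ z} - gaussCdf (z / √v)| ≤ 20 * (B / √v) := by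
  have hs : 0 < √v := Real.sqrt_pos.2 hv
  set β := B / √v with hβ
  set a := z / √v with ha
  -- For β > 1 the bound is trivial. Otherwise the shift of the level by 2β is undone by the
  -- Lipschitz constant 1 of N, and 18 + 2 = 20.
  rcases le_or_gt β 1 with h1 | h1
  · have hset : ∀ c, {ω | ∑ i, X i ω / √v ≤ c} = {ω | ∑ i, X i ω ≤ c * √v} := by
      intro c; ext ω; simp only [Set.mem_ofPred_eq]
      rw [← Finset.sum_div, div_le_iff₀ hs]
    have key := fun c => berryEsseen_normalized (μ := μ) (X := fun i ω => X i ω / √v) (β := β)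
      (fun i => (hm i).div_const _)
      (hind.comp (fun _ x => x / √v) fun _ => measurable_id.div_const _) h1
      (fun i ω => by
        rw [abs_div, abs_of_pos hs]; exact div_le_div_of_nonneg_right (hb i ω) hs.le)
      (fun i => by rw [integral_div, hmean, zero_div])
      (by
        simp_rw [div_pow, integral_div]
        rw [← Finset.sum_div, hvar, Real.sq_sqrt hv.le, div_self hv.ne']) c
    have k1 := (key (a - 2 * β)).1
    have k2 := (key (a + 2 * β)).2
    rw [hset] at k1 k2
    have e1 : (a - 2 * β + 2 * β) * √v = z := by rw [ha]; field_simp; ring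
    have e2 : (a + 2 * β - 2 * β) * √v = z := by rw [ha]; field_simp; ring
    rw [e1] at k1
    rw [e2] at k2
    have hβ0 : 0 ≤ β := by
      by_contra hneg
      push Not at hneg
      have hB : B < 0 := by
        by_contra hB; push Not at hB
        have : 0 ≤ β := by positivity
        linarith
      rcases isEmpty_or_nonempty ι with h | ⟨⟨i⟩⟩
      · simp at hvar; linarith
      · obtain ⟨ω⟩ : Nonempty Ω := nonempty_of_isProbabilityMeasure μ
        linarith [(abs_nonneg _).trans (hb i ω)]
    have l1 := gaussCdf_lipschitz (a := a - 2 * β) (b := a) (by linarith)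
    have l2 := gaussCdf_lipschitz (a := a) (b := a + 2 * β) (by linarith)
    rw [abs_le]
    constructor <;> linarith
  · have p1 : 0 ≤ μ.real {ω | ∑ i, X i ω ≤ z} := measureReal_nonneg
    have p2 : μ.real {ω | ∑ i, X i ω ≤ z} ≤ 1 := measureReal_le_one
    rw [abs_le]
    constructor <;> linarith [gaussCdf_nonneg a, gaussCdf_le_one a]

end BerryEsseen

/-! ### Probabilities under finite weights, and their link to measures. -/

section FiniteProbability

variable {Ω A B ι κ : Type*} [Fintype Ω] [Fintype A] [Fintype B] [Fintype ι] [Fintype κ]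

open Classical in
/-- Probability of the event `E` under the weights `w`. -/
def prob (w : Ω → ℝ) (E : Ω → Prop) : ℝ := ∑ ω, if E ω then w ω else 0

/-- Implication is required only where the weight is positive; in this way outputs impossible under
the channel are discarded. -/
lemma prob_mono {w : Ω → ℝ} (hw : ∀ ω, 0 ≤ w ω) {E F : Ω → Prop}
    (h : ∀ ω, 0 < w ω → E ω → F ω) : prob w E ≤ prob w F := by
  classical
  refine Finset.sum_le_sum fun ω _ => ?_
  rcases (hw ω).eq_or_lt with h0 | h0
  · simp [← h0]
  · by_cases hE : E ω
    · simp [hE, h ω h0 hE]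
    · simp only [hE, if_false]; split_ifs <;> simp [h0.le]

lemma prob_or_le {w : Ω → ℝ} (hw : ∀ ω, 0 ≤ w ω) (E F : Ω → Prop) :
    prob w (fun ω => E ω ∨ F ω) ≤ prob w E + prob w F := by
  classical
  unfold prob
  rw [← Finset.sum_add_distrib]
  refine Finset.sum_le_sum fun ω _ => ?_
  have := hw ω
  by_cases hE : E ω <;> by_cases hF : F ω <;> simp [hE, hF, this]

lemma prob_le_add {w : Ω → ℝ} (hw : ∀ ω, 0 ≤ w ω) {E F G : Ω → Prop}
    (h : ∀ ω, 0 < w ω → E ω → F ω ∨ G ω) : prob w E ≤ prob w F + prob w G :=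
  (prob_mono hw h).trans (prob_or_le hw F G)

lemma prob_add_prob_not (w : Ω → ℝ) (E : Ω → Prop) :
    prob w E + prob w (fun ω => ¬ E ω) = ∑ ω, w ω := by
  classical
  unfold prob
  rw [← Finset.sum_add_distrib]
  refine Finset.sum_congr rfl fun ω _ => ?_
  by_cases hE : E ω <;> simp [hE]

lemma prob_not {w : Ω → ℝ} (hw : w ∈ stdSimplex ℝ Ω) (E : Ω → Prop) :
    prob w (fun ω => ¬ E ω) = 1 - prob w E := by
  have := prob_add_prob_not w E
  rw [hw.2] at this
  linarith

lemma prob_nonneg {w : Ω → ℝ} (hw : ∀ ω, 0 ≤ w ω) (E : Ω → Prop) : 0 ≤ prob w E := by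
  classical
  refine Finset.sum_nonneg fun ω _ => ?_
  split_ifs <;> simp [hw ω]

lemma prob_le_one {w : Ω → ℝ} (hw : w ∈ stdSimplex ℝ Ω) (E : Ω → Prop) : prob w E ≤ 1 := by
  have := prob_not hw E
  linarith [prob_nonneg hw.1 fun ω => ¬ E ω]

lemma prob_congr {w : Ω → ℝ} {E F : Ω → Prop} (h : ∀ ω, E ω ↔ F ω) : prob w E = prob w F := by
  have : E = F := funext fun ω => propext (h ω)
  rw [this]

/-- Product weights on sequences. -/
def prodWeight (p : ι → A → ℝ) (s : ι → A) : ℝ := ∏ i, p i (s i)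

lemma prodWeight_mem {p : ι → A → ℝ} [DecidableEq ι] (hp : ∀ i, p i ∈ stdSimplex ℝ A) :
    prodWeight p ∈ stdSimplex ℝ (ι → A) := by
  refine ⟨fun s => Finset.prod_nonneg fun i _ => (hp i).1 _, ?_⟩
  unfold prodWeight
  rw [← Fintype.prod_sum]
  exact Finset.prod_eq_one fun i _ => (hp i).2

/-- Weights of the pair of a random element and the output of a channel with this input. -/
def pairWeight (w : A → ℝ) (v : A → B → ℝ) (ω : A × B) : ℝ := w ω.1 * v ω.1 ω.2

lemma pairWeight_mem {w : A → ℝ} {v : A → B → ℝ} (hw : w ∈ stdSimplex ℝ A)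
    (hv : ∀ a, v a ∈ stdSimplex ℝ B) : pairWeight w v ∈ stdSimplex ℝ (A × B) := by
  refine ⟨fun ω => mul_nonneg (hw.1 _) ((hv _).1 _), ?_⟩
  rw [Fintype.sum_prod_type]
  simp_rw [pairWeight, ← Finset.mul_sum]
  simp [(hv _).2, hw.2]

lemma prob_pairWeight (w : A → ℝ) (v : A → B → ℝ) (E : A × B → Prop) :
    prob (pairWeight w v) E = ∑ a, w a * prob (v a) (fun b => E (a, b)) := by
  classical
  unfold prob pairWeight
  rw [Fintype.sum_prod_type]
  refine Finset.sum_congr rfl fun a _ => ?_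
  rw [Finset.mul_sum]
  refine Finset.sum_congr rfl fun b _ => ?_
  split_ifs <;> simp

lemma prob_pairWeight_fst (w : A → ℝ) {v : A → B → ℝ} (hv : ∀ a, v a ∈ stdSimplex ℝ B)
    (E : A → Prop) : prob (pairWeight w v) (fun ω => E ω.1) = prob w E := by
  classical
  rw [prob_pairWeight]
  refine Finset.sum_congr rfl fun a _ => ?_
  by_cases h : E a
  · simp [prob, h, (hv a).2]
  · simp [prob, h]

open MeasureTheory ProbabilityTheory

/-- The discrete measure with weights `w`. -/
def finMeasure [MeasurableSpace Ω] (w : Ω → ℝ) : Measure Ω :=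
  ∑ ω, ENNReal.ofReal (w ω) • Measure.dirac ω

section
variable [MeasurableSpace Ω] [MeasurableSingletonClass Ω]

lemma finMeasure_singleton (w : Ω → ℝ) (ω : Ω) :
    finMeasure w {ω} = ENNReal.ofReal (w ω) := by
  classical
  simp [finMeasure, Measure.finsetSum_apply, Set.indicator, eq_comm]

lemma isProbabilityMeasure_finMeasure {w : Ω → ℝ} (hw : w ∈ stdSimplex ℝ Ω) :
    IsProbabilityMeasure (finMeasure w) := by
  constructor
  have : ∑ ω, ENNReal.ofReal (w ω) = 1 := by
    rw [← ENNReal.ofReal_sum_of_nonneg fun ω _ => hw.1 ω, hw.2, ENNReal.ofReal_one]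
  simpa [finMeasure, Measure.finsetSum_apply] using this

lemma integral_finMeasure {w : Ω → ℝ} (hw : ∀ ω, 0 ≤ w ω) (f : Ω → ℝ) :
    ∫ ω, f ω ∂(finMeasure w) = ∑ ω, w ω * f ω := by
  unfold finMeasure
  rw [integral_finsetSum_measure]
  · refine Finset.sum_congr rfl fun ω _ => ?_
    rw [integral_smul_measure, integral_dirac, ENNReal.toReal_ofReal (hw ω), smul_eq_mul]
  · intro ω _
    exact (integrable_dirac (by simp)).smul_measure (by simp)

lemma measureReal_eq_prob {μ : Measure Ω} [IsFiniteMeasure μ] {w : Ω → ℝ}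
    (h : ∀ ω, μ.real {ω} = w ω) (E : Ω → Prop) : μ.real {ω | E ω} = prob w E := by
  classical
  have : {ω | E ω} = ((Finset.univ.filter E : Finset Ω) : Set Ω) := by ext; simp
  rw [this, ← sum_measureReal_singleton, prob, Finset.sum_filter]
  exact Finset.sum_congr rfl fun ω _ => by rw [h]

end

section
variable [MeasurableSpace A] [MeasurableSingletonClass A] [MeasurableSpace B]
  [MeasurableSingletonClass B]

lemma pi_finMeasure_singleton {p : ι → A → ℝ} (hp : ∀ i, p i ∈ stdSimplex ℝ A) (s : ι → A) :
    (Measure.pi fun i => finMeasure (p i)).real {s} = prodWeight p s := by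
  have := fun i => isProbabilityMeasure_finMeasure (hp i)
  rw [measureReal_def, Measure.pi_singleton, ENNReal.toReal_prod]
  refine Finset.prod_congr rfl fun i _ => ?_
  rw [finMeasure_singleton, ENNReal.toReal_ofReal ((hp i).1 _)]

/-- The joint law is identified with the product of the marginals on boxes, where the product
measure factors over both groups. -/
lemma iIndepFun_prod_pi {μ : ι → Measure A} {ν : κ → Measure B}
    [∀ i, IsProbabilityMeasure (μ i)] [∀ i, IsProbabilityMeasure (ν i)]
    {r : ι → A → ℝ} {u : κ → B → ℝ} (hr : ∀ i, Measurable (r i)) (hu : ∀ j, Measurable (u j)) :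
    iIndepFun (Sum.elim (fun i (ω : (ι → A) × (κ → B)) => r i (ω.1 i)) (fun j ω => u j (ω.2 j)))
      ((Measure.pi μ).prod (Measure.pi ν)) := by
  have hm : ∀ i, Measurable (Sum.elim (fun i (ω : (ι → A) × (κ → B)) => r i (ω.1 i))
      (fun j ω => u j (ω.2 j)) i) := by
    rintro (i | j)
    · exact (hr i).comp ((measurable_pi_apply i).comp measurable_fst)
    · exact (hu j).comp ((measurable_pi_apply j).comp measurable_snd)
  rw [iIndepFun_iff_map_fun_eq_pi_map fun i => (hm i).aemeasurable]
  symm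
  have := fun i => Measure.isProbabilityMeasure_map (μ := (Measure.pi μ).prod (Measure.pi ν))
    (hm i).aemeasurable
  refine Measure.pi_eq fun s hs => ?_
  rw [Measure.map_apply (measurable_pi_lambda _ hm) (MeasurableSet.univ_pi hs)]
  have hset : (fun (ω : (ι → A) × (κ → B)) i => Sum.elim (fun i (ω : (ι → A) × (κ → B)) =>
      r i (ω.1 i)) (fun j ω => u j (ω.2 j)) i ω) ⁻¹' Set.univ.pi s
      = (Set.univ.pi fun i => r i ⁻¹' s (Sum.inl i)) ×ˢ
        (Set.univ.pi fun j => u j ⁻¹' s (Sum.inr j)) := by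
    ext ω; simp
  rw [hset, Measure.prod_prod, Measure.pi_pi, Measure.pi_pi, Fintype.prod_sum_type]
  congr 1
  · refine Finset.prod_congr rfl fun i _ => ?_
    rw [Measure.map_apply (hm _) (hs _)]
    have h1 := (measurePreserving_eval μ i).comp
      (measurePreserving_fst (μ := Measure.pi μ) (ν := Measure.pi ν))
    rw [← h1.measure_preimage ((hr i) (hs _)).nullMeasurableSet]
    rfl
  · refine Finset.prod_congr rfl fun j _ => ?_
    rw [Measure.map_apply (hm _) (hs _)]
    have h1 := (measurePreserving_eval ν j).comp
      (measurePreserving_snd (μ := Measure.pi μ) (ν := Measure.pi ν))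
    rw [← h1.measure_preimage ((hu j) (hs _)).nullMeasurableSet]
    rfl

end

/-- The two groups of independent variables as one family on a probability space. -/
lemma exists_measure_sum_elim {p : ι → A → ℝ} {q : κ → B → ℝ}
    [DecidableEq ι] [DecidableEq κ]
    (hp : ∀ i, p i ∈ stdSimplex ℝ A) (hq : ∀ j, q j ∈ stdSimplex ℝ B)
    (r : ι → A → ℝ) (u : κ → B → ℝ) :
    ∃ (_ : MeasurableSpace ((ι → A) × (κ → B))) (M : Measure ((ι → A) × (κ → B)))
      (X : ι ⊕ κ → (ι → A) × (κ → B) → ℝ), IsProbabilityMeasure M ∧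
      X = Sum.elim (fun i ω => r i (ω.1 i)) (fun j ω => u j (ω.2 j)) ∧
      (∀ i, Measurable (X i)) ∧ iIndepFun X M ∧
      (∀ (f : ℝ → ℝ) i, ∫ ω, f (X (Sum.inl i) ω) ∂M = ∑ a, p i a * f (r i a)) ∧
      (∀ (f : ℝ → ℝ) j, ∫ ω, f (X (Sum.inr j) ω) ∂M = ∑ a, q j a * f (u j a)) ∧
      ∀ E : (ι → A) × (κ → B) → Prop,
        M.real {ω | E ω} = prob (pairWeight (prodWeight p) fun _ => prodWeight q) E := by
  -- The discrete σ-algebras make every function measurable; they stay local, so that the later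
  -- statements are purely finite sums.
  let _ : MeasurableSpace A := ⊤
  let _ : MeasurableSpace B := ⊤
  have hP := fun i => isProbabilityMeasure_finMeasure (hp i)
  have hQ := fun j => isProbabilityMeasure_finMeasure (hq j)
  have hrm : ∀ i, Measurable (r i) := fun i => measurable_from_top
  have hum : ∀ i, Measurable (u i) := fun i => measurable_from_top
  refine ⟨inferInstance,
    (Measure.pi fun i => finMeasure (p i)).prod (Measure.pi fun j => finMeasure (q j)),
    _, inferInstance, rfl, ?_, iIndepFun_prod_pi hrm hum, ?_, ?_, ?_⟩
  · rintro (i | j)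
    · exact (hrm i).comp ((measurable_pi_apply i).comp measurable_fst)
    · exact (hum j).comp ((measurable_pi_apply j).comp measurable_snd)
  · intro f i
    have h1 := (measurePreserving_eval (fun i => finMeasure (p i)) i).comp
      (measurePreserving_fst (μ := Measure.pi fun i => finMeasure (p i))
        (ν := Measure.pi fun j => finMeasure (q j)))
    rw [← integral_finMeasure (hp i).1, ← h1.map_eq, integral_map h1.measurable.aemeasurable
      (measurable_from_top (f := fun a => f (r i a))).aestronglyMeasurable]
    rfl
  · intro f j
    have h1 := (measurePreserving_eval (fun i => finMeasure (q i)) j).comp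
      (measurePreserving_snd (μ := Measure.pi fun i => finMeasure (p i))
        (ν := Measure.pi fun j => finMeasure (q j)))
    rw [← integral_finMeasure (hq j).1, ← h1.map_eq, integral_map h1.measurable.aemeasurable
      (measurable_from_top (f := fun a => f (u j a))).aestronglyMeasurable]
    rfl
  · intro E
    refine measureReal_eq_prob ?_ E
    rintro ⟨s, y⟩
    rw [← Set.singleton_prod_singleton, measureReal_prod_prod, pi_finMeasure_singleton hp,
      pi_finMeasure_singleton hq]
    rfl

/-- Berry–Esseen theorem for two independent groups of independent, finitely valued variables,
and Chebyshev's inequality for their sum. -/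
theorem berryEsseen_prob {p : ι → A → ℝ} {q : κ → B → ℝ}
    [DecidableEq ι] [DecidableEq κ]
    (hp : ∀ i, p i ∈ stdSimplex ℝ A) (hq : ∀ j, q j ∈ stdSimplex ℝ B)
    {r : ι → A → ℝ} {u : κ → B → ℝ} {b v : ℝ}
    (hr : ∀ i a, |r i a| ≤ b) (hu : ∀ j a, |u j a| ≤ b)
    (hr0 : ∀ i, ∑ a, p i a * r i a = 0) (hu0 : ∀ j, ∑ a, q j a * u j a = 0)
    (hvar : ∑ i, ∑ a, p i a * r i a ^ 2 + ∑ j, ∑ a, q j a * u j a ^ 2 = v) :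
    (0 < v → ∀ z, |prob (pairWeight (prodWeight p) fun _ => prodWeight q)
        (fun ω => ∑ i, r i (ω.1 i) + ∑ j, u j (ω.2 j) ≤ z) - gaussCdf (z / √v)|
      ≤ 20 * (b / √v)) ∧
    ∀ t, 0 < t → prob (pairWeight (prodWeight p) fun _ => prodWeight q)
        (fun ω => t ≤ |∑ i, r i (ω.1 i) + ∑ j, u j (ω.2 j)|) ≤ v / t ^ 2 := by
  obtain ⟨mΩ, M, X, hM, hX, hm, hind, hI1, hI2, hprob⟩ := exists_measure_sum_elim hp hq r u
  have hb : ∀ i ω, |X i ω| ≤ b := by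
    rw [hX]; rintro (i | j) ω; exacts [hr i _, hu j _]
  have hmean : ∀ i, ∫ ω, X i ω ∂M = 0 := by
    rintro (i | j)
    · exact (hI1 id i).trans (hr0 i)
    · exact (hI2 id j).trans (hu0 j)
  have hv : ∑ i, ∫ ω, X i ω ^ 2 ∂M = v := by
    rw [Fintype.sum_sum_type, ← hvar]
    congr 1
    · exact Finset.sum_congr rfl fun i _ => hI1 (fun x => x ^ 2) i
    · exact Finset.sum_congr rfl fun j _ => hI2 (fun x => x ^ 2) j
  have hS : ∀ ω, ∑ i, X i ω = ∑ i, r i (ω.1 i) + ∑ j, u j (ω.2 j) := by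
    intro ω; rw [Fintype.sum_sum_type, hX]; rfl
  constructor
  · intro hv0 z
    have key := berryEsseen hm hind hv0 hb hmean hv z
    rw [hprob] at key
    simpa only [hS] using key
  · intro t ht
    obtain ⟨hL, h2⟩ := integral_sq_sum hm hind hb hmean
    rw [← hprob]
    have := mul_meas_ge_le_integral_of_nonneg (μ := M) (.of_forall fun ω => sq_nonneg _)
      hL.integrable_sq (t ^ 2)
    rw [h2, hv] at this
    rw [le_div_iff₀ (by positivity), mul_comm]
    refine le_trans (le_of_eq ?_) this
    congr 2
    ext ω
    simp only [Set.mem_ofPred_eq, hS]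
    rw [← sq_le_sq₀ ht.le (abs_nonneg _), sq_abs]

end FiniteProbability

/-! ### Inversion of the Gaussian approximation. -/

section Quantile

open MeasureTheory ProbabilityTheory

lemma mul_gaussPdf_le_gaussCdf_sub {a b M : ℝ} (hab : a ≤ b) (ha : -M ≤ a) (hb : b ≤ M) :
    (b - a) * gaussPdf M ≤ gaussCdf b - gaussCdf a := by
  rw [gaussCdf_sub]
  have h := intervalIntegral.integral_mono_on hab (μ := volume) (f := fun _ => gaussPdf M)
    (by simp) (continuous_gaussPdf.intervalIntegrable _ _) (fun x hx => by
      rw [gaussPdf_eq, gaussPdf_eq]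
      refine mul_le_mul_of_nonneg_left (Real.exp_le_exp.2 ?_) (by positivity)
      nlinarith [hx.1, hx.2])
  simpa using h

lemma gaussCdf_strictMono : StrictMono gaussCdf := by
  intro a b hab
  have h := mul_gaussPdf_le_gaussCdf_sub hab.le (M := max (-a) b)
    (by linarith [le_max_left (-a) b]) (le_max_right _ _)
  nlinarith [gaussPdf_pos (max (-a) b)]

/-- The intermediate value theorem gives a solution x, and strict monotonicity turns the set in the
definition of `gaussQInv` into the half-line [x, ∞). -/
lemma gaussCdf_gaussQInv {ε : ℝ} (h0 : 0 < ε) (h1 : ε < 1) : gaussCdf (gaussQInv ε) = 1 - ε := by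
  have hcdf : gaussCdf = cdf (gaussianReal 0 1) := by
    funext x; rw [cdf_eq_real]; rfl
  have ht : Tendsto gaussCdf atTop (𝓝 1) := hcdf ▸ tendsto_cdf_atTop _
  have hb : Tendsto gaussCdf atBot (𝓝 0) := hcdf ▸ tendsto_cdf_atBot _
  obtain ⟨x, hx⟩ : ∃ x, gaussCdf x = 1 - ε :=
    mem_range_of_exists_le_of_exists_ge continuous_gaussCdf
      ((hb.eventually (ge_mem_nhds (show 0 < 1 - ε by linarith))).exists)
      ((ht.eventually (le_mem_nhds (show 1 - ε < 1 by linarith))).exists)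
  have hset : {t | gaussQ t ≤ ε} = Set.Ici x := by
    ext t
    simp only [Set.mem_ofPred_eq, Set.mem_Ici, gaussQ_eq]
    rw [← gaussCdf_strictMono.le_iff_le (a := x) (b := t), hx]
    constructor <;> intro h <;> linarith
  rw [gaussQInv, hset, csInf_Ici, hx]

lemma tendsto_log_nat : Tendsto (fun n : ℕ => Real.log n) atTop atTop :=
  Real.tendsto_log_atTop.comp tendsto_natCast_atTop_atTop

lemma tendsto_log_div_sqrt : Tendsto (fun n : ℕ => Real.log n / √n) atTop (𝓝 0) := by
  have h := (isLittleO_log_rpow_atTop (r := 1 / 2) (by norm_num)).tendsto_div_nhds_zero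
  have h2 := h.comp tendsto_natCast_atTop_atTop
  refine h2.congr fun n => ?_
  simp [Real.sqrt_eq_rpow]

/-- Quantiles of a distribution function `G` that is close to a Gaussian one with a variance close
to `n V`, up to `O(log n)`. -/
theorem exists_quantile_bound {V b K₁ K₂ ε : ℝ} (hV : 0 ≤ V) (hb : 0 ≤ b) (hK₁ : 0 ≤ K₁)
    (hK₂ : 0 ≤ K₂) (hε0 : 0 < ε) (hε1 : ε < 1) :
    ∃ K' : ℝ, 0 ≤ K' ∧ ∀ᶠ n : ℕ in atTop, ∀ (v : ℝ) (G : ℝ → ℝ), |v - n * V| ≤ K₁ →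
      (0 < v → ∀ z, |G z - gaussCdf (z / √v)| ≤ 20 * (b / √v)) →
      (∀ t, 0 < t → G (-t) ≤ v / t ^ 2 ∧ 1 - G t ≤ v / t ^ 2) →
      ∀ C, K' ≤ C → Monotone G →
      1 - G (√(n * V) * gaussQInv ε + C * Real.log n) ≤ ε - K₂ * (Real.log n / √n) ∧
      ε + K₂ * (Real.log n / √n) ≤ 1 - G (√(n * V) * gaussQInv ε - C * Real.log n) := by
  set q := gaussQInv ε with hq
  have hqε := gaussCdf_gaussQInv hε0 hε1
  rw [← hq] at hqε
  rcases hV.eq_or_lt with h0 | hVpos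
  -- If V = 0 the variance v stays below K₁, and Chebyshev's inequality at distance log n gives
  -- K₁/(log n)² → 0; no Gaussian limit is involved.
  · refine ⟨1, zero_le_one, ?_⟩
    have hlim1 : Tendsto (fun n : ℕ => ε - K₂ * (Real.log n / √n) - K₁ / Real.log n ^ 2) atTop
        (𝓝 (ε - K₂ * 0 - 0)) :=
      (tendsto_const_nhds.sub (tendsto_log_div_sqrt.const_mul K₂)).sub
        (Tendsto.const_div_atTop ((tendsto_pow_atTop two_ne_zero).comp tendsto_log_nat) K₁)
    have hlim2 : Tendsto (fun n : ℕ => ε + K₂ * (Real.log n / √n) + K₁ / Real.log n ^ 2) atTop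
        (𝓝 (ε + K₂ * 0 + 0)) :=
      (tendsto_const_nhds.add (tendsto_log_div_sqrt.const_mul K₂)).add
        (Tendsto.const_div_atTop ((tendsto_pow_atTop two_ne_zero).comp tendsto_log_nat) K₁)
    filter_upwards [hlim1.eventually (lt_mem_nhds (show 0 < _ by simpa using hε0)),
      hlim2.eventually (gt_mem_nhds (show _ < (1 : ℝ) by simpa using hε1)),
      tendsto_log_nat.eventually_gt_atTop 0] with n h1 h2 hL v G hv _ hT C hC hG
    rw [← h0] at hv ⊢
    simp only [mul_zero, Real.sqrt_zero, zero_mul, zero_add, zero_sub, sub_zero] at hv ⊢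
    obtain ⟨t1, t2⟩ := hT _ hL
    have hvle : v / Real.log n ^ 2 ≤ K₁ / Real.log n ^ 2 :=
      div_le_div_of_nonneg_right ((le_abs_self v).trans hv) (by positivity)
    have g1 := hG (show Real.log n ≤ C * Real.log n by nlinarith)
    have g2 := hG (show -(C * Real.log n) ≤ -Real.log n by nlinarith)
    constructor <;> linarith
  · set c := gaussPdf (|q| + 1) with hc
    have hcpos : 0 < c := gaussPdf_pos _
    -- Half of K' log n absorbs the change of q√v into q√(nV). The other half moves the argument of
    -- N by δ ≤ 1, which changes N by at least cδ, since c is the minimum of the density on [-|q|-1,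
    -- |q|+1]; this pays for the Berry–Esseen error and for K₂ log n/√n.
    obtain ⟨K', hK'⟩ : ∃ K', K' = 2 / c * (20 * b + K₂ * √(2 * V)) + 2 * (|q| * K₁) := ⟨_, rfl⟩
    have hK0 : 0 ≤ K' := by rw [hK']; positivity
    refine ⟨K', hK0, ?_⟩
    have e1 : ∀ᶠ n : ℕ in atTop, max 1 (2 * K₁) ≤ n * V :=
      (tendsto_natCast_atTop_atTop.atTop_mul_const hVpos).eventually_ge_atTop _
    have e2 : ∀ᶠ n : ℕ in atTop, K' / 2 * (Real.log n / √n) * (1 / √(V / 2)) < 1 := by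
      have := ((tendsto_log_div_sqrt.const_mul (K' / 2)).mul_const (1 / √(V / 2)))
      simp only [mul_zero, zero_mul] at this
      exact this.eventually (gt_mem_nhds one_pos)
    filter_upwards [e1, e2, tendsto_log_nat.eventually_ge_atTop 1, eventually_gt_atTop 0]
      with n hn1 hn2 hL hn v G hv hBE _ C hC hG
    have hnV1 : 1 ≤ n * V := (le_max_left _ _).trans hn1
    have hnV2 : 2 * K₁ ≤ n * V := (le_max_right _ _).trans hn1
    rw [abs_le] at hv
    have hvlo : n * (V / 2) ≤ v := by linarith
    have hvhi : v ≤ n * (2 * V) := by linarith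
    have hvpos : 0 < v := by linarith
    have hn' : (0 : ℝ) < n := by exact_mod_cast hn
    generalize hs : √v = s at *
    generalize hs0 : √(n * V) = s0 at *
    generalize hsn : √(n : ℝ) = sn at *
    have hspos : 0 < s := hs ▸ Real.sqrt_pos.2 hvpos
    have hs01 : 1 ≤ s0 := hs0 ▸ Real.one_le_sqrt.2 hnV1
    have hsnpos : 0 < sn := hsn ▸ Real.sqrt_pos.2 hn'
    have hslo : sn * √(V / 2) ≤ s := by
      rw [← hsn, ← Real.sqrt_mul hn'.le, ← hs]; exact Real.sqrt_le_sqrt hvlo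
    have hshi : s ≤ sn * √(2 * V) := by
      rw [← hsn, ← Real.sqrt_mul hn'.le, ← hs]; exact Real.sqrt_le_sqrt hvhi
    generalize hLdef : Real.log n = L at *
    obtain ⟨δ, hδ⟩ : ∃ δ, δ = K' / 2 * L / s := ⟨_, rfl⟩
    have hδ0 : 0 ≤ δ := by rw [hδ]; positivity
    have hδ1 : δ ≤ 1 := by
      have hV2 : 0 < √(V / 2) := Real.sqrt_pos.2 (by positivity)
      refine le_trans ?_ hn2.le
      rw [hδ]
      have : K' / 2 * (L / sn) * (1 / √(V / 2)) = K' / 2 * L / (sn * √(V / 2)) := by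
        field_simp
      rw [this]
      exact div_le_div_of_nonneg_left (by positivity) (by positivity) hslo
    -- The difference of the roots is (nV - v)/(√(nV) + √v), with denominator at least 1.
    have hss0 : |s0 - s| ≤ K₁ := by
      have e : (s0 - s) * (s0 + s) = n * V - v := by
        have h1 := Real.sq_sqrt (show 0 ≤ n * V by linarith)
        have h2 := Real.sq_sqrt hvpos.le
        rw [hs0] at h1; rw [hs] at h2
        linear_combination h1 - h2
      have e' : |s0 - s| * (s0 + s) = |n * V - v| := by
        rw [← e, abs_mul, abs_of_pos (a := s0 + s) (by linarith)]
      have e3 : |n * V - v| ≤ K₁ := by rw [abs_le]; constructor <;> linarith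
      linarith [le_mul_of_one_le_right (abs_nonneg (s0 - s)) (show 1 ≤ s0 + s by linarith)]
    have hss : |(s0 - s) * q| ≤ K' / 2 * L := by
      rw [abs_mul]
      have h1 : |s0 - s| * |q| ≤ K₁ * |q| := mul_le_mul_of_nonneg_right hss0 (abs_nonneg _)
      have h2 : |q| * K₁ ≤ K' / 2 := by
        have : 0 ≤ 2 / c * (20 * b + K₂ * √(2 * V)) := by positivity
        rw [hK']; linarith
      have h3 := le_mul_of_one_le_right (show 0 ≤ K' / 2 by positivity) hL
      linarith
    rw [abs_le] at hss
    have hsδ : s * δ = K' / 2 * L := by rw [hδ]; field_simp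
    have hCL : K' * L ≤ C * L := mul_le_mul_of_nonneg_right hC (by linarith)
    have key : 20 * (b / s) + K₂ * (L / sn) ≤ δ * c := by
      have h1 : 20 * (b / s) ≤ 20 * b * L / s := by
        rw [← mul_div_assoc]; exact div_le_div_of_nonneg_right (le_mul_of_one_le_right (by positivity) hL) hspos.le
      have h2 : K₂ * (L / sn) ≤ K₂ * √(2 * V) * L / s := by
        rw [← mul_div_assoc, div_le_div_iff₀ hsnpos hspos]
        linarith [mul_le_mul_of_nonneg_left hshi (show 0 ≤ K₂ * L by positivity)]
      have h3 : δ * c = (20 * b + K₂ * √(2 * V)) * L / s + |q| * K₁ * L * c / s := by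
        have : K' * c = 2 * (20 * b + K₂ * √(2 * V)) + 2 * (|q| * K₁) * c := by
          rw [hK', add_mul, mul_assoc, mul_comm _ c, ← mul_assoc, div_mul_cancel₀ _ hcpos.ne']
        calc δ * c = K' * c * L / 2 / s := by rw [hδ]; ring
          _ = _ := by rw [this]; ring
      have h4 : 0 ≤ |q| * K₁ * L * c / s := by positivity
      have h5 : (20 * b + K₂ * √(2 * V)) * L / s = 20 * b * L / s + K₂ * √(2 * V) * L / s := by
        ring
      linarith
    have q1 := le_abs_self q
    have q2 := neg_abs_le q
    constructor
    · have ha : q + δ ≤ (s0 * q + C * L) / s := by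
        rw [le_div_iff₀ hspos]; linarith
      have g1 := gaussCdf_mono ha
      have g2 := (abs_le.1 (hBE hvpos (s0 * q + C * L))).1
      have g3 := mul_gaussPdf_le_gaussCdf_sub (a := q) (b := q + δ) (M := |q| + 1)
        (by linarith) (by linarith) (by linarith)
      rw [← hc] at g3
      have : (q + δ - q) * c = δ * c := by ring
      linarith
    · have ha : (s0 * q - C * L) / s ≤ q - δ := by
        rw [div_le_iff₀ hspos]; linarith
      have g1 := gaussCdf_mono ha
      have g2 := (abs_le.1 (hBE hvpos (s0 * q - C * L))).2
      have g3 := mul_gaussPdf_le_gaussCdf_sub (a := q - δ) (b := q) (M := |q| + 1)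
        (by linarith) (by linarith) (by linarith)
      rw [← hc] at g3
      have : (q - (q - δ)) * c = δ * c := by ring
      linarith

end Quantile

/-! ### Relative entropy and decompositions of mutual information. -/

section Divergence

variable {A B : Type*} [Fintype A] [Fintype B]

/-- Relative entropy of two distributions on a finite alphabet. -/
def relEnt (p q : B → ℝ) : ℝ := ∑ b, p b * Real.log (p b / q b)

lemma le_one_of_mem_stdSimplex {p : B → ℝ} (hp : p ∈ stdSimplex ℝ B) (b : B) : p b ≤ 1 := by
  rw [← hp.2]
  exact Finset.single_le_sum (fun b _ => hp.1 b) (Finset.mem_univ b)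

/-- The inequality log t ≤ t - 1 at t = √(q/p). Domination has to be assumed because p / 0 and log 0
are 0 by convention. -/
lemma two_mul_sub_sqrt_le {p q : ℝ} (hp : 0 ≤ p) (hq : 0 ≤ q) (h : 0 < p → 0 < q) :
    2 * (p - √p * √q) ≤ p * Real.log (p / q) := by
  rcases hp.eq_or_lt with h0 | h0
  · simp [← h0]
  have hq' := h h0
  have e : Real.log (p / q) = -2 * Real.log (√q / √p) := by
    rw [← Real.sqrt_div hq, Real.log_sqrt (by positivity), ← inv_div q p, Real.log_inv]; ring
  have l := Real.log_le_sub_one_of_pos (show 0 < √q / √p by positivity)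
  have e2 : p * (√q / √p) = √p * √q := by
    have hs : 0 < √p := Real.sqrt_pos.2 h0
    field_simp
    nlinarith [Real.sq_sqrt hp]
  rw [e]
  nlinarith

/-- Relative entropy dominates the squared Hellinger distance Σ(√p - √q)², and |p - q| ≤ 2|√p - √q|
on [0,1]. It replaces Pinsker's inequality throughout. -/
lemma sum_sq_sub_le_relEnt {p q : B → ℝ} (hp : p ∈ stdSimplex ℝ B) (hq : q ∈ stdSimplex ℝ B)
    (h : ∀ b, 0 < p b → 0 < q b) : ∑ b, (p b - q b) ^ 2 ≤ 4 * relEnt p q := by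
  have h1 : ∑ b, 2 * (p b - √(p b) * √(q b)) ≤ relEnt p q :=
    Finset.sum_le_sum fun b _ => two_mul_sub_sqrt_le (hp.1 b) (hq.1 b) (h b)
  have h2 : ∑ b, (√(p b) - √(q b)) ^ 2 = ∑ b, 2 * (p b - √(p b) * √(q b)) := by
    have : ∀ b, (√(p b) - √(q b)) ^ 2 = 2 * (p b - √(p b) * √(q b)) + (q b - p b) := fun b => by
      have a1 := Real.sq_sqrt (hp.1 b)
      have a2 := Real.sq_sqrt (hq.1 b)
      nlinarith
    simp_rw [this]
    rw [Finset.sum_add_distrib, Finset.sum_sub_distrib, hp.2, hq.2]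
    ring
  have h3 : ∀ b, (p b - q b) ^ 2 ≤ 4 * (√(p b) - √(q b)) ^ 2 := fun b => by
    have a1 := Real.sq_sqrt (hp.1 b)
    have a2 := Real.sq_sqrt (hq.1 b)
    have b1 : √(p b) ≤ 1 := Real.sqrt_le_one.2 (le_one_of_mem_stdSimplex hp b)
    have b2 : √(q b) ≤ 1 := Real.sqrt_le_one.2 (le_one_of_mem_stdSimplex hq b)
    have e : p b - q b = (√(p b) - √(q b)) * (√(p b) + √(q b)) := by nlinarith
    have c : (√(p b) + √(q b)) ^ 2 ≤ 4 := by
      nlinarith [Real.sqrt_nonneg (p b), Real.sqrt_nonneg (q b)]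
    rw [e, mul_pow, mul_comm]
    exact mul_le_mul_of_nonneg_right c (sq_nonneg _)
  calc ∑ b, (p b - q b) ^ 2 ≤ ∑ b, 4 * (√(p b) - √(q b)) ^ 2 := Finset.sum_le_sum fun b _ => h3 b
    _ = 4 * ∑ b, (√(p b) - √(q b)) ^ 2 := by rw [Finset.mul_sum]
    _ ≤ _ := by rw [h2]; linarith

lemma relEnt_nonneg {p q : B → ℝ} (hp : p ∈ stdSimplex ℝ B) (hq : q ∈ stdSimplex ℝ B)
    (h : ∀ b, 0 < p b → 0 < q b) : 0 ≤ relEnt p q := by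
  have := sum_sq_sub_le_relEnt hp hq h
  have h2 : 0 ≤ ∑ b, (p b - q b) ^ 2 := Finset.sum_nonneg fun b _ => sq_nonneg _
  linarith

lemma eq_of_relEnt_le_zero {p q : B → ℝ} (hp : p ∈ stdSimplex ℝ B) (hq : q ∈ stdSimplex ℝ B)
    (h : ∀ b, 0 < p b → 0 < q b) (h0 : relEnt p q ≤ 0) : p = q := by
  have h1 := sum_sq_sub_le_relEnt hp hq h
  funext b
  have h2 := Finset.single_le_sum (f := fun b => (p b - q b) ^ 2) (fun b _ => sq_nonneg _)
    (Finset.mem_univ b)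
  have h3 : (p b - q b) ^ 2 ≤ 0 := by linarith
  nlinarith [pow_eq_zero_iff (two_ne_zero) |>.1 (le_antisymm h3 (sq_nonneg _))]

lemma outDist_mem {Φ : A → ℝ} {W : A → B → ℝ} (hΦ : Φ ∈ stdSimplex ℝ A)
    (hW : ∀ a, 0 < Φ a → W a ∈ stdSimplex ℝ B) : outDist Φ W ∈ stdSimplex ℝ B := by
  constructor
  · intro b
    refine Finset.sum_nonneg fun a _ => ?_
    rcases (hΦ.1 a).eq_or_lt with h | h
    · simp [← h]
    · exact mul_nonneg h.le ((hW a h).1 b)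
  · unfold outDist
    rw [Finset.sum_comm, ← hΦ.2]
    refine Finset.sum_congr rfl fun a _ => ?_
    rw [← Finset.mul_sum]
    rcases (hΦ.1 a).eq_or_lt with h | h
    · simp [← h]
    · rw [(hW a h).2, mul_one]

lemma mul_le_outDist {Φ : A → ℝ} {W : A → B → ℝ} (hΦ : ∀ a, 0 ≤ Φ a)
    (hW : ∀ a, 0 < Φ a → ∀ b, 0 ≤ W a b) (a : A) (b : B) : Φ a * W a b ≤ outDist Φ W b := by
  refine Finset.single_le_sum (f := fun a => Φ a * W a b) (fun a _ => ?_) (Finset.mem_univ a)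
  rcases (hΦ a).eq_or_lt with h | h
  · simp [← h]
  · exact mul_nonneg h.le (hW a h b)

/-- Decomposition of the mutual information with respect to an output distribution `q`. -/
lemma mutualInfo_eq {Φ : A → ℝ} {V : A → B → ℝ} {q : B → ℝ} (hΦ : ∀ a, 0 ≤ Φ a)
    (hV : ∀ a, 0 < Φ a → ∀ b, 0 ≤ V a b) (hq : ∀ a b, 0 < Φ a → 0 < V a b → 0 < q b) :
    mutualInfo Φ V = ∑ a, ∑ b, Φ a * V a b * Real.log (V a b / q b)
      - relEnt (outDist Φ V) q := by
  have h1 : relEnt (outDist Φ V) q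
      = ∑ a, ∑ b, Φ a * V a b * Real.log (outDist Φ V b / q b) := by
    rw [Finset.sum_comm]
    refine Finset.sum_congr rfl fun b _ => ?_
    rw [← Finset.sum_mul]; rfl
  rw [h1, mutualInfo, ← Finset.sum_sub_distrib]
  refine Finset.sum_congr rfl fun a _ => ?_
  rw [← Finset.sum_sub_distrib]
  refine Finset.sum_congr rfl fun b _ => ?_
  rcases (hΦ a).eq_or_lt with h | h
  · simp [← h]
  rcases (hV a h b).eq_or_lt with h' | h'
  · simp [← h']
  have ho : 0 < outDist Φ V b := (mul_pos h h').trans_le (mul_le_outDist hΦ hV a b)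
  have hq' := hq a b h h'
  rw [infoDensity, ← mul_sub, ← Real.log_div (by positivity) (by positivity)]
  congr 2
  field_simp

lemma mutualInfo_nonneg {Φ : A → ℝ} {W : A → B → ℝ} (hΦ : Φ ∈ stdSimplex ℝ A)
    (hW : ∀ a, 0 < Φ a → W a ∈ stdSimplex ℝ B) : 0 ≤ mutualInfo Φ W := by
  unfold mutualInfo
  refine Finset.sum_nonneg fun a _ => ?_
  rcases (hΦ.1 a).eq_or_lt with h | h
  · simp [← h]
  have : 0 ≤ relEnt (W a) (outDist Φ W) := by
    refine relEnt_nonneg (hW a h) (outDist_mem hΦ hW) fun b hb => ?_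
    exact (mul_pos h hb).trans_le (mul_le_outDist hΦ.1 (fun a ha => (hW a ha).1) a b)
  simp_rw [mul_assoc]
  rw [← Finset.mul_sum]
  exact mul_nonneg h.le this

/-- The divergence `D(V ‖ W | Φ)`. -/
def condDiv (Φ : A → ℝ) (V W : A → B → ℝ) : ℝ :=
  ∑ a, ∑ b, Φ a * V a b * Real.log (V a b / W a b)

/-- Data processing: log t ≤ t - 1 is applied, for each pair of letters, to the ratio of the two
likelihood ratios; the resulting lower bound sums to a nonnegative number. -/
lemma relEnt_outDist_le_condDiv {Φ : A → ℝ} {V W : A → B → ℝ} (hΦ : Φ ∈ stdSimplex ℝ A)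
    (hV : ∀ a, 0 < Φ a → V a ∈ stdSimplex ℝ B) (hW : ∀ a, W a ∈ stdSimplex ℝ B)
    (hVW : ∀ a b, 0 < Φ a → 0 < V a b → 0 < W a b) :
    relEnt (outDist Φ V) (outDist Φ W) ≤ condDiv Φ V W := by
  have hoV := outDist_mem hΦ hV
  have hoW := outDist_mem hΦ fun a _ => hW a
  have h1 : relEnt (outDist Φ V) (outDist Φ W)
      = ∑ a, ∑ b, Φ a * V a b * Real.log (outDist Φ V b / outDist Φ W b) := by
    rw [Finset.sum_comm]
    refine Finset.sum_congr rfl fun b _ => ?_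
    rw [← Finset.sum_mul]; rfl
  have h2 : ∀ a b, Φ a * V a b - Φ a * W a b * (outDist Φ V b / outDist Φ W b)
      ≤ Φ a * V a b * Real.log (V a b / W a b)
        - Φ a * V a b * Real.log (outDist Φ V b / outDist Φ W b) := by
    intro a b
    rcases (hΦ.1 a).eq_or_lt with h | h
    · simp [← h]
    rcases ((hV a h).1 b).eq_or_lt with h' | h'
    · rw [← h']
      have : 0 ≤ Φ a * W a b * (outDist Φ V b / outDist Φ W b) :=
        mul_nonneg (mul_nonneg h.le ((hW a).1 b)) (div_nonneg (hoV.1 b) (hoW.1 b))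
      simpa using this
    have hW' := hVW a b h h'
    have ho : 0 < outDist Φ V b :=
      (mul_pos h h').trans_le (mul_le_outDist hΦ.1 (fun a ha => (hV a ha).1) a b)
    have ho' : 0 < outDist Φ W b :=
      (mul_pos h hW').trans_le (mul_le_outDist hΦ.1 (fun a _ => (hW a).1) a b)
    set t := W a b / V a b * (outDist Φ V b / outDist Φ W b) with ht
    have htpos : 0 < t := by positivity
    have l := Real.log_le_sub_one_of_pos htpos
    have e : Real.log (V a b / W a b) - Real.log (outDist Φ V b / outDist Φ W b)
        = -Real.log t := by
      rw [ht, Real.log_mul (by positivity) (by positivity), ← inv_div (W a b) (V a b), Real.log_inv]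
      ring
    rw [← mul_sub, e]
    have e2 : Φ a * W a b * (outDist Φ V b / outDist Φ W b) = Φ a * V a b * t := by
      rw [ht]; field_simp
    rw [e2]
    nlinarith [mul_pos h h']
  have h3 : ∑ a, ∑ b, (Φ a * V a b - Φ a * W a b * (outDist Φ V b / outDist Φ W b))
      ≤ condDiv Φ V W - relEnt (outDist Φ V) (outDist Φ W) := by
    rw [h1, condDiv, ← Finset.sum_sub_distrib]
    refine Finset.sum_le_sum fun a _ => ?_
    rw [← Finset.sum_sub_distrib]
    exact Finset.sum_le_sum fun b _ => h2 a b
  have h4 : 0 ≤ ∑ a, ∑ b, (Φ a * V a b - Φ a * W a b * (outDist Φ V b / outDist Φ W b)) := by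
    rw [Finset.sum_comm]
    refine Finset.sum_nonneg fun b _ => ?_
    rw [Finset.sum_sub_distrib, ← Finset.sum_mul]
    change 0 ≤ outDist Φ V b - outDist Φ W b * (outDist Φ V b / outDist Φ W b)
    by_cases h0 : outDist Φ W b = 0
    · rw [h0, zero_mul, sub_zero]; exact hoV.1 b
    · rw [mul_div_cancel₀ _ h0, sub_self]
  linarith

/-- From log(V/q) = log(V/W) + log(W/q). For types, the middle term is linear in the joint type and
so an empirical mean; the two divergences have to be estimated. -/
lemma mutualInfo_eq_condDiv_add {Φ : A → ℝ} {V W : A → B → ℝ} {q : B → ℝ} (hΦ : ∀ a, 0 ≤ Φ a)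
    (hV : ∀ a, 0 < Φ a → ∀ b, 0 ≤ V a b) (hVW : ∀ a b, 0 < Φ a → 0 < V a b → 0 < W a b)
    (hq : ∀ a b, 0 < Φ a → 0 < V a b → 0 < q b) :
    mutualInfo Φ V = condDiv Φ V W + ∑ a, ∑ b, Φ a * V a b * Real.log (W a b / q b)
      - relEnt (outDist Φ V) q := by
  rw [mutualInfo_eq hΦ hV hq, condDiv, ← Finset.sum_add_distrib]
  congr 1
  refine Finset.sum_congr rfl fun a _ => ?_
  rw [← Finset.sum_add_distrib]
  refine Finset.sum_congr rfl fun b _ => ?_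
  rcases (hΦ a).eq_or_lt with h | h
  · simp [← h]
  rcases (hV a h b).eq_or_lt with h' | h'
  · simp [← h']
  have h1 := hVW a b h h'
  have h2 := hq a b h h'
  rw [← mul_add, ← Real.log_mul (by positivity) (by positivity)]
  congr 2
  field_simp

end Divergence

/-! ### The method of types. -/

section TypeMethod

variable {A B : Type*} [Fintype A] [Fintype B] [DecidableEq A] [DecidableEq B] {k : ℕ}

lemma sum_seqType_mul (x : Fin k → A) (g : A → ℝ) :
    ∑ a, seqType x a * g a = (∑ i, g (x i)) / k := by
  unfold seqType
  simp_rw [div_mul_eq_mul_div]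
  rw [← Finset.sum_div]
  congr 1
  simp_rw [Finset.card_filter, Nat.cast_sum, Finset.sum_mul]
  rw [Finset.sum_comm]
  refine Finset.sum_congr rfl fun i _ => ?_
  simp

lemma seqType_nonneg (x : Fin k → A) (a : A) : 0 ≤ seqType x a := by unfold seqType; positivity

lemma seqType_mem (hk : 0 < k) (x : Fin k → A) : seqType x ∈ stdSimplex ℝ A := by
  refine ⟨seqType_nonneg x, ?_⟩
  have := sum_seqType_mul x fun _ => 1
  have hk' : (k : ℝ) ≠ 0 := by positivity
  simpa [hk'] using this

lemma exists_of_seqType_pos {x : Fin k → A} {a : A} (h : 0 < seqType x a) : ∃ i, x i = a := by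
  by_contra hne
  push Not at hne
  have : Finset.univ.filter (fun i => x i = a) = ∅ := by simpa using hne
  simp [seqType, this] at h

/-- The product is the joint type also when the letter a does not occur: both counts are then 0 and
the value of 0 / 0 is irrelevant. -/
lemma seqType_mul_condType (x : Fin k → A) (y : Fin k → B) (a : A) (b : B) :
    seqType x a * condType x y a b
      = ((Finset.univ.filter fun i => x i = a ∧ y i = b).card : ℝ) / k := by
  unfold seqType condType
  rcases Nat.eq_zero_or_pos (Finset.univ.filter fun i => x i = a).card with h | h
  · have h2 : (Finset.univ.filter fun i => x i = a ∧ y i = b).card = 0 := by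
      refine Nat.le_zero.1 (h ▸ Finset.card_le_card fun i hi => ?_)
      simp only [Finset.mem_filter, Finset.mem_univ, true_and] at hi ⊢
      exact hi.1
    simp [h, h2]
  · have : ((Finset.univ.filter fun i => x i = a).card : ℝ) ≠ 0 := by positivity
    field_simp

lemma sum_seqType_mul_condType (x : Fin k → A) (y : Fin k → B) (g : A → B → ℝ) :
    ∑ a, ∑ b, seqType x a * condType x y a b * g a b = (∑ i, g (x i) (y i)) / k := by
  simp_rw [seqType_mul_condType, div_mul_eq_mul_div, ← Finset.sum_div]
  congr 1
  simp_rw [Finset.card_filter, Nat.cast_sum, Finset.sum_mul]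
  have : ∀ a, ∑ b, ∑ i, ((if x i = a ∧ y i = b then 1 else 0 : ℕ) : ℝ) * g a b
      = ∑ i, if x i = a then g a (y i) else 0 := by
    intro a
    rw [Finset.sum_comm]
    refine Finset.sum_congr rfl fun i _ => ?_
    by_cases h : x i = a <;> simp [h]
  simp_rw [this]
  rw [Finset.sum_comm]
  simp

lemma condType_nonneg (x : Fin k → A) (y : Fin k → B) (a : A) (b : B) : 0 ≤ condType x y a b := by
  unfold condType; positivity

lemma condType_mem (x : Fin k → A) (y : Fin k → B) {a : A} (ha : ∃ i, x i = a) :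
    condType x y a ∈ stdSimplex ℝ B := by
  refine ⟨condType_nonneg x y a, ?_⟩
  obtain ⟨i, hi⟩ := ha
  have hpos : 0 < (Finset.univ.filter fun j => x j = a).card := Finset.card_pos.2 ⟨i, by simp [hi]⟩
  unfold condType
  rw [← Finset.sum_div, div_eq_one_iff_eq (by positivity)]
  simp_rw [Finset.card_filter, Nat.cast_sum]
  rw [Finset.sum_comm]
  refine Finset.sum_congr rfl fun i _ => ?_
  by_cases h : x i = a <;> simp [h]

lemma condType_pos (x : Fin k → A) (y : Fin k → B) (i : Fin k) :
    0 < condType x y (x i) (y i) := by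
  unfold condType
  have h1 : 0 < (Finset.univ.filter fun j => x j = x i ∧ y j = y i).card :=
    Finset.card_pos.2 ⟨i, by simp⟩
  have h2 : 0 < (Finset.univ.filter fun j => x j = x i).card := Finset.card_pos.2 ⟨i, by simp⟩
  positivity

lemma exists_of_condType_pos {x : Fin k → A} {y : Fin k → B} {a : A} {b : B}
    (h : 0 < condType x y a b) : ∃ i, x i = a ∧ y i = b := by
  by_contra hne
  push Not at hne
  have : Finset.univ.filter (fun i => x i = a ∧ y i = b) = ∅ := by simpa using hne
  simp [condType, this] at h

/-- For fixed x a conditional type is determined by |A||B| joint counts, each between 0 and k. -/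
lemma card_image_condType_le (x : Fin k → A) :
    ((Finset.univ : Finset (Fin k → B)).image (condType x)).card
      ≤ (k + 1) ^ (Fintype.card A * Fintype.card B) := by
  classical
  let c : (Fin k → B) → (A → B → Fin (k + 1)) := fun y a b =>
    ⟨(Finset.univ.filter fun i => x i = a ∧ y i = b).card,
      Nat.lt_succ_of_le ((Finset.card_le_univ _).trans (by simp))⟩
  let g : (A → B → Fin (k + 1)) → A → B → ℝ := fun N a b =>
    ((N a b : ℕ) : ℝ) / ((Finset.univ.filter fun i => x i = a).card : ℝ)
  have h : (Finset.univ : Finset (Fin k → B)).image (condType x)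
      ⊆ (Finset.univ : Finset (A → B → Fin (k + 1))).image g := by
    intro V hV
    obtain ⟨y, _, rfl⟩ := Finset.mem_image.1 hV
    exact Finset.mem_image.2 ⟨c y, Finset.mem_univ _, rfl⟩
  refine (Finset.card_le_card h).trans (Finset.card_image_le.trans ?_)
  rw [Finset.card_univ, Fintype.card_fun, Fintype.card_fun, Fintype.card_fin, ← pow_mul, mul_comm]

/-- The divergence between the conditional type and the channel is small with high probability. -/
lemma prob_condDiv_gt_le {W : A → B → ℝ} (hW : ∀ a, W a ∈ stdSimplex ℝ B) (x : Fin k → A)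
    (δ : ℝ) :
    prob (prodWeight fun i => W (x i)) (fun y => δ < k * condDiv (seqType x) (condType x y) W)
      ≤ (k + 1) ^ (Fintype.card A * Fintype.card B) * Real.exp (-δ) := by
  classical
  have hdiv : ∀ y : Fin k → B, (k : ℝ) * condDiv (seqType x) (condType x y) W
      = ∑ i, Real.log (condType x y (x i) (y i) / W (x i) (y i)) := by
    intro y
    rw [condDiv, sum_seqType_mul_condType x y fun a b => Real.log (condType x y a b / W a b)]
    rcases Nat.eq_zero_or_pos k with rfl | hk
    · simp
    · field_simp
  have hV0 : ∀ y y' : Fin k → B, 0 ≤ ∏ i, condType x y (x i) (y' i) := fun y y' =>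
    Finset.prod_nonneg fun i _ => condType_nonneg x y _ _
  -- The probability of y under W is exp(-k D) times its probability under its own conditional type,
  -- D being the conditional divergence. If y has probability 0 under W there is nothing to show.
  have h1 : ∀ y, (if δ < k * condDiv (seqType x) (condType x y) W then
      prodWeight (fun i => W (x i)) y else 0) ≤ Real.exp (-δ) * ∏ i, condType x y (x i) (y i) := by
    intro y
    split_ifs with h
    · by_cases h0 : ∀ i, 0 < W (x i) (y i)
      · rw [hdiv, ← Real.log_prod fun i _ => (div_pos (condType_pos x y i) (h0 i)).ne',
          Finset.prod_div_distrib] at h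
        have hp : 0 < ∏ i, W (x i) (y i) := Finset.prod_pos fun i _ => h0 i
        have hc : 0 < ∏ i, condType x y (x i) (y i) := Finset.prod_pos fun i _ => condType_pos x y i
        have h3 := (Real.lt_log_iff_exp_lt (div_pos hc hp)).1 h
        rw [lt_div_iff₀ hp] at h3
        unfold prodWeight
        rw [Real.exp_neg, inv_mul_eq_div, le_div_iff₀ (Real.exp_pos _)]
        linarith
      · push Not at h0
        obtain ⟨i, hi⟩ := h0
        have : prodWeight (fun i => W (x i)) y = 0 :=
          Finset.prod_eq_zero (Finset.mem_univ i) (le_antisymm hi ((hW _).1 _))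
        rw [this]
        exact mul_nonneg (Real.exp_pos _).le (hV0 y y)
    · exact mul_nonneg (Real.exp_pos _).le (hV0 y y)
  -- Replacing the type of y by a sum over all conditional types, each of which defines a product
  -- law of total mass 1, leaves the number of types.
  have h2 : ∑ y : Fin k → B, ∏ i, condType x y (x i) (y i)
      ≤ ((k + 1) ^ (Fintype.card A * Fintype.card B) : ℕ) := by
    have e : ∀ y : Fin k → B, ∏ i, condType x y (x i) (y i)
        ≤ ∑ V ∈ (Finset.univ : Finset (Fin k → B)).image (condType x), ∏ i, V (x i) (y i) := by
      intro y
      refine Finset.single_le_sum (f := fun V : A → B → ℝ => ∏ i, V (x i) (y i)) ?_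
        (Finset.mem_image_of_mem _ (Finset.mem_univ y))
      intro V hV
      obtain ⟨y', _, rfl⟩ := Finset.mem_image.1 hV
      exact hV0 y' y
    refine (Finset.sum_le_sum fun y _ => e y).trans ?_
    rw [Finset.sum_comm]
    have e2 : ∀ V ∈ (Finset.univ : Finset (Fin k → B)).image (condType x),
        ∑ y : Fin k → B, ∏ i, V (x i) (y i) = 1 := by
      intro V hV
      obtain ⟨y', _, rfl⟩ := Finset.mem_image.1 hV
      exact (prodWeight_mem (p := fun i => condType x y' (x i))
        fun i => condType_mem x y' ⟨i, rfl⟩).2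
    rw [Finset.sum_congr rfl e2]
    simp only [Finset.sum_const, nsmul_eq_mul, mul_one]
    exact_mod_cast card_image_condType_le x
  calc prob (prodWeight fun i => W (x i))
        (fun y => δ < k * condDiv (seqType x) (condType x y) W)
      ≤ ∑ y : Fin k → B, Real.exp (-δ) * ∏ i, condType x y (x i) (y i) := by
        unfold prob
        refine Finset.sum_le_sum fun y _ => ?_
        convert h1 y using 2
    _ = Real.exp (-δ) * ∑ y : Fin k → B, ∏ i, condType x y (x i) (y i) := by rw [Finset.mul_sum]
    _ ≤ Real.exp (-δ) * ((k + 1) ^ (Fintype.card A * Fintype.card B) : ℕ) :=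
        mul_le_mul_of_nonneg_left h2 (Real.exp_pos _).le
    _ = _ := by push_cast; ring

/-- One more factor k + 1 in the exponential than in the count of types leaves 1/(k + 1). -/
lemma prob_condDiv_gt_log_le {W : A → B → ℝ} (hW : ∀ a, W a ∈ stdSimplex ℝ B) (x : Fin k → A) :
    prob (prodWeight fun i => W (x i)) (fun y =>
      (Fintype.card A * Fintype.card B + 1) * Real.log (k + 1)
        < k * condDiv (seqType x) (condType x y) W) ≤ 1 / (k + 1) := by
  refine (prob_condDiv_gt_le hW x _).trans (le_of_eq ?_)
  have hk : (0 : ℝ) < k + 1 := by positivity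
  rw [Real.exp_neg, mul_comm _ (Real.log _), ← Real.rpow_def_of_pos hk]
  have : ((Fintype.card A : ℝ) * Fintype.card B + 1)
      = ((Fintype.card A * Fintype.card B + 1 : ℕ) : ℝ) := by push_cast; ring
  rw [this, Real.rpow_natCast, pow_succ]
  field_simp

/-- The type of an i.i.d. sequence is close to its distribution with high probability. -/
lemma prob_seqType_sq_gt_le {P : A → ℝ} (hP : P ∈ stdSimplex ℝ A) (hk : 0 < k) :
    prob (prodWeight fun _ : Fin k => P) (fun s =>
      4 * (Fintype.card A + 1) * Real.log (k + 1) < k * ∑ a, (seqType s a - P a) ^ 2)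
      ≤ 1 / (k + 1) := by
  -- An i.i.d. source is a channel with one input letter; the divergence then bounds the squared ℓ²
  -- distance with the factor 4.
  have h := prob_condDiv_gt_log_le (W := fun _ : Unit => P) (fun _ => hP) (fun _ : Fin k => ())
  refine le_trans (prob_mono (prodWeight_mem fun _ => hP).1 fun s hs h1 => ?_) h
  have hpos : ∀ i, 0 < P (s i) := fun i => by
    refine (hP.1 _).lt_of_ne' fun h0 => ?_
    exact hs.ne' (Finset.prod_eq_zero (Finset.mem_univ i) h0)
  have e1 : condType (fun _ : Fin k => ()) s () = seqType s := by
    funext b; simp [condType, seqType]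
  have e2 : seqType (fun _ : Fin k => ()) () = 1 := by
    have hk' : (k : ℝ) ≠ 0 := by positivity
    simp [seqType, hk']
  have e3 : condDiv (seqType fun _ : Fin k => ()) (condType (fun _ => ()) s) (fun _ => P)
      = relEnt (seqType s) P := by
    simp [condDiv, relEnt, e1, e2]
  rw [e3]
  have h2 := sum_sq_sub_le_relEnt (seqType_mem hk s) hP fun b hb => by
    obtain ⟨i, rfl⟩ := exists_of_seqType_pos hb
    exact hpos i
  have hk' : (0 : ℝ) < k := by positivity
  simp only [Fintype.card_unit, Nat.cast_one, one_mul]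
  have h3 := mul_le_mul_of_nonneg_left h2 hk'.le
  linarith

end TypeMethod

/-! ### Monotonicity of the rate-distortion function. -/

section RateDistortion

variable {S T : Type*} [Fintype S] [Fintype T] {d : S → T → ℝ} {P Q : S → ℝ}

lemma rdf_set_bddBelow (hQ : Q ∈ stdSimplex ℝ S) (d : S → T → ℝ) (D : ℝ) :
    BddBelow {r | ∃ Λ : S → T → ℝ, (∀ a, Λ a ∈ stdSimplex ℝ T) ∧
      ∑ a, ∑ b, Q a * Λ a b * d a b ≤ D ∧ r = mutualInfo Q Λ} := by
  refine ⟨0, ?_⟩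
  rintro r ⟨Λ, hΛ, _, rfl⟩
  exact mutualInfo_nonneg hQ fun a _ => hΛ a

/-- The deterministic channel to a zero-distortion letter is admissible, so the infimum in `rdf` is
not the default value for D ≥ 0. -/
lemma rdf_set_nonempty (hd0 : ∀ s, ∃ t, d s t = 0) (Q : S → ℝ) {D : ℝ} (hD : 0 ≤ D) :
    {r | ∃ Λ : S → T → ℝ, (∀ a, Λ a ∈ stdSimplex ℝ T) ∧
      ∑ a, ∑ b, Q a * Λ a b * d a b ≤ D ∧ r = mutualInfo Q Λ}.Nonempty := by
  classical
  choose t ht using hd0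
  refine ⟨_, fun s => Pi.single (t s) 1, fun s => single_mem_stdSimplex ℝ (t s), ?_, rfl⟩
  refine le_trans (le_of_eq ?_) hD
  refine Finset.sum_eq_zero fun a _ => Finset.sum_eq_zero fun b _ => ?_
  rcases eq_or_ne b (t a) with rfl | h
  · simp [ht]
  · simp [h]

lemma rdf_anti (hd0 : ∀ s, ∃ t, d s t = 0) (hQ : Q ∈ stdSimplex ℝ S) {D D' : ℝ} (hD : 0 ≤ D)
    (h : D ≤ D') : rdf d Q D' ≤ rdf d Q D := by
  refine csInf_le_csInf (rdf_set_bddBelow hQ d D') (rdf_set_nonempty hd0 Q hD) ?_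
  rintro r ⟨Λ, hΛ, h1, rfl⟩
  exact ⟨Λ, hΛ, h1.trans h, rfl⟩

/-- Mixing a channel with its own output law does not change the output law; convexity of t log t
then applies, and the constant component carries no information. -/
lemma mutualInfo_mix_le (hQ : Q ∈ stdSimplex ℝ S) {Λ : S → T → ℝ} (hΛ : ∀ a, Λ a ∈ stdSimplex ℝ T)
    {l : ℝ} (hl0 : 0 ≤ l) (hl1 : l ≤ 1) :
    mutualInfo Q (fun a b => (1 - l) * Λ a b + l * outDist Q Λ b) ≤ (1 - l) * mutualInfo Q Λ := by
  have hout : ∀ b, outDist Q (fun a b => (1 - l) * Λ a b + l * outDist Q Λ b) b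
      = outDist Q Λ b := by
    intro b
    have : ∀ a, Q a * ((1 - l) * Λ a b + l * outDist Q Λ b)
        = (1 - l) * (Q a * Λ a b) + Q a * (l * outDist Q Λ b) := fun a => by ring
    unfold outDist at this ⊢
    simp_rw [this]
    rw [Finset.sum_add_distrib, ← Finset.mul_sum, ← Finset.sum_mul, hQ.2]
    ring
  unfold mutualInfo infoDensity
  rw [Finset.mul_sum]
  refine Finset.sum_le_sum fun a _ => ?_
  rw [Finset.mul_sum]
  refine Finset.sum_le_sum fun b _ => ?_
  rw [hout]
  rcases (hQ.1 a).eq_or_lt with h | h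
  · simp [← h]
  have ho := (outDist_mem hQ fun a _ => hΛ a).1 b
  rcases ho.eq_or_lt with h' | h'
  · simp [← h']
  set q := outDist Q Λ b
  have hΛ0 := (hΛ a).1 b
  have hconv := Real.convexOn_mul_log.2 (show Λ a b / q ∈ Set.Ici 0 by simp; positivity)
    (show (1 : ℝ) ∈ Set.Ici 0 by simp) (show 0 ≤ 1 - l by linarith) hl0 (by ring)
  simp only [smul_eq_mul, mul_one, Real.log_one, mul_zero, add_zero] at hconv
  have e1 : ((1 - l) * Λ a b + l * q) / q = (1 - l) * (Λ a b / q) + l := by field_simp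
  have e2 : Q a * ((1 - l) * Λ a b + l * q) * Real.log ((1 - l) * (Λ a b / q) + l)
      = Q a * q * (((1 - l) * (Λ a b / q) + l) * Real.log ((1 - l) * (Λ a b / q) + l)) := by
    field_simp
  have e3 : (1 - l) * (Q a * Λ a b * Real.log (Λ a b / q))
      = Q a * q * ((1 - l) * (Λ a b / q * Real.log (Λ a b / q))) := by field_simp
  beta_reduce
  rw [e1, e2, e3]
  exact mul_le_mul_of_nonneg_left hconv (by positivity)

/-- The mixed channel has distortion at most (1 - l)D + lM, since the constant component costs at
most M. This substitute for convexity in D suffices. -/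
lemma rdf_mix_le (hd0 : ∀ s, ∃ t, d s t = 0) (hQ : Q ∈ stdSimplex ℝ S) {D M l : ℝ} (hD : 0 ≤ D)
    (hM : ∀ s t, d s t ≤ M) (hl0 : 0 ≤ l) (hl1 : l ≤ 1) :
    rdf d Q ((1 - l) * D + l * M) ≤ (1 - l) * rdf d Q D := by
  have key : ∀ r ∈ {r | ∃ Λ : S → T → ℝ, (∀ a, Λ a ∈ stdSimplex ℝ T) ∧
      ∑ a, ∑ b, Q a * Λ a b * d a b ≤ D ∧ r = mutualInfo Q Λ},
      rdf d Q ((1 - l) * D + l * M) ≤ (1 - l) * r := by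
    rintro r ⟨Λ, hΛ, h1, rfl⟩
    have hq := outDist_mem hQ fun a _ => hΛ a
    refine le_trans (csInf_le (rdf_set_bddBelow hQ d _) ?_) (mutualInfo_mix_le hQ hΛ hl0 hl1)
    refine ⟨_, fun a => ⟨fun b => ?_, ?_⟩, ?_, rfl⟩
    · have := (hΛ a).1 b
      have := hq.1 b
      have : 0 ≤ 1 - l := by linarith
      positivity
    · rw [Finset.sum_add_distrib, ← Finset.mul_sum, ← Finset.mul_sum, (hΛ a).2, hq.2]; ring
    · have e : ∀ a b, Q a * ((1 - l) * Λ a b + l * outDist Q Λ b) * d a b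
          = (1 - l) * (Q a * Λ a b * d a b) + l * (Q a * (outDist Q Λ b * d a b)) := by
        intro a b; ring
      simp_rw [e, Finset.sum_add_distrib, ← Finset.mul_sum]
      have h2 : ∑ a, Q a * ∑ b, outDist Q Λ b * d a b ≤ M := by
        calc ∑ a, Q a * ∑ b, outDist Q Λ b * d a b ≤ ∑ a, Q a * ∑ b, outDist Q Λ b * M := by
              gcongr with a _ b _
              · exact hQ.1 a
              · exact hq.1 b
              · exact hM a b
          _ = M := by rw [← Finset.sum_mul, ← Finset.sum_mul, hq.2, hQ.2]; ring
      exact add_le_add (mul_le_mul_of_nonneg_left h1 (by linarith))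
        (mul_le_mul_of_nonneg_left h2 hl0)
  rcases hl1.eq_or_lt with rfl | hl
  · obtain ⟨r, hr⟩ := rdf_set_nonempty hd0 Q hD
    simpa using key r hr
  · have hpos : 0 < 1 - l := by linarith
    rw [← div_le_iff₀' hpos]
    refine le_csInf (rdf_set_nonempty hd0 Q hD) fun r hr => ?_
    rw [div_le_iff₀' hpos]
    exact key r hr

/-- The mixing inequality is an equality at l = 0; differentiating it there gives c(N - D) ≤ -R(Q,D)
< 0 for a bound N > D of the distortion. -/
lemma rdf_deriv_neg (hd0 : ∀ s, ∃ t, d s t = 0) (hQ : Q ∈ stdSimplex ℝ S) {D c : ℝ} (hD : 0 ≤ D)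
    (hpos : 0 < rdf d Q D) (hc : HasDerivAt (fun D => rdf d Q D) c D) : c < 0 := by
  obtain ⟨M, hM⟩ : ∃ M, ∀ z : S × T, d z.1 z.2 ≤ M := by
    obtain ⟨M, hM⟩ := (Set.finite_range fun z : S × T => d z.1 z.2).bddAbove
    exact ⟨M, fun z => hM ⟨z, rfl⟩⟩
  set N := max M (D + 1)
  have hN : 0 < N - D := by linarith [le_max_right M (D + 1)]
  set h : ℝ → ℝ := fun l => rdf d Q (D + l * (N - D)) + l * rdf d Q D with hh
  have hd1 : HasDerivAt (fun l : ℝ => D + l * (N - D)) (N - D) 0 := by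
    simpa using ((hasDerivAt_id (0 : ℝ)).mul_const (N - D)).const_add D
  have hd2 : HasDerivAt h (c * (N - D) + rdf d Q D) 0 := by
    refine HasDerivAt.add ?_ ?_
    · refine HasDerivAt.comp (0 : ℝ) (h₂ := fun D => rdf d Q D) ?_ hd1
      simpa using hc
    · simpa using (hasDerivAt_id (0 : ℝ)).mul_const (rdf d Q D)
  have ht := (hasDerivAt_iff_tendsto_slope.1 hd2).mono_left
    (nhdsWithin_mono 0 (fun x (hx : x ∈ Set.Ioi 0) => ne_of_gt hx))
  have hle : c * (N - D) + rdf d Q D ≤ 0 := by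
    refine le_of_tendsto ht ?_
    filter_upwards [Ioo_mem_nhdsGT (show (0 : ℝ) < 1 by norm_num)] with l hl
    have := rdf_mix_le hd0 hQ hD (M := N) (l := l)
      (fun s t => (hM (s, t)).trans (le_max_left _ _)) hl.1.le hl.2.le
    rw [slope_def_field]
    refine div_nonpos_of_nonpos_of_nonneg ?_ (by linarith [hl.1])
    have e : D + l * (N - D) = (1 - l) * D + l * N := by ring
    simp only [hh, e, zero_mul, add_zero]
    linarith
  nlinarith

end RateDistortion

/-! ### Second-order Taylor bound. -/

section Taylor

variable {E : Type*} [NormedAddCommGroup E] [NormedSpace ℝ E]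

/-- Differentiability of the derivative at z₀ makes F' - F'(z₀) of order ‖z - z₀‖; the mean value
inequality on a closed ball does the rest. No continuity of the second derivative is needed. -/
lemma exists_taylor_bound {F : E → ℝ} {U : Set E} {z₀ : E} (hU : IsOpen U) (hz : z₀ ∈ U)
    (hF : DifferentiableOn ℝ F U) (hF' : DifferentiableOn ℝ (fderiv ℝ F) U) :
    ∃ K η : ℝ, 0 ≤ K ∧ 0 < η ∧ Metric.ball z₀ η ⊆ U ∧ ∀ z ∈ Metric.ball z₀ η,
      |F z - F z₀ - fderiv ℝ F z₀ (z - z₀)| ≤ K * ‖z - z₀‖ ^ 2 := by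
  have hd : DifferentiableAt ℝ (fderiv ℝ F) z₀ := (hF' z₀ hz).differentiableAt (hU.mem_nhds hz)
  obtain ⟨K, hK⟩ := hd.isBigO_sub.bound
  obtain ⟨η, hη, hball⟩ := Metric.eventually_nhds_iff_ball.1
    (hK.and (hU.eventually_mem hz))
  refine ⟨|K|, η, abs_nonneg _, hη, fun z h => (hball z h).2, fun z h => ?_⟩
  have hsub : Metric.closedBall z₀ ‖z - z₀‖ ⊆ Metric.ball z₀ η :=
    Metric.closedBall_subset_ball (by rwa [← dist_eq_norm])
  have := (convex_closedBall z₀ ‖z - z₀‖).norm_image_sub_le_of_norm_hasFDerivWithin_le'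
    (f := F) (f' := fderiv ℝ F) (φ := fderiv ℝ F z₀) (C := |K| * ‖z - z₀‖)
    (fun x hx => ((hF x (hball x (hsub hx)).2).differentiableAt
      (hU.mem_nhds (hball x (hsub hx)).2)).hasFDerivAt.hasFDerivWithinAt)
    (fun x hx => by
      refine ((hball x (hsub hx)).1).trans ?_
      rw [Metric.mem_closedBall, dist_eq_norm] at hx
      exact mul_le_mul (le_abs_self K) hx (norm_nonneg _) (abs_nonneg _))
    (Metric.mem_closedBall_self (norm_nonneg _))
    (show z ∈ _ by rw [Metric.mem_closedBall, dist_eq_norm])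
  rw [← Real.norm_eq_abs]
  calc _ ≤ _ := this
    _ = _ := by ring

end Taylor

/-! ### Expansion of the rate-distortion function. -/

section SourceExpansion

variable {S T : Type*} [Fintype S] [Fintype T] [DecidableEq S] {d : S → T → ℝ} {P : S → ℝ}

/-- The normalized curve (P + t e_s)/(1 + t) has velocity e_s - P at 0. Since P(s) > 0 it stays in
the simplex for small t of both signs, so F may replace the rate-distortion function near t = 0. -/
lemma rdfPartial_eq {F : (S → ℝ) × ℝ → ℝ} {U : Set ((S → ℝ) × ℝ)} {D : ℝ}
    (hP : P ∈ stdSimplex ℝ S) (hU : IsOpen U)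
    (hz : (P, D) ∈ U) (hFR : ∀ z ∈ U, z.1 ∈ stdSimplex ℝ S → F z = rdf d z.1 z.2)
    (hF : DifferentiableOn ℝ F U) {s : S} (hs : 0 < P s) :
    rdfPartial d P D s = fderiv ℝ F (P, D) (Pi.single s 1 - P, 0) := by
  set γ : ℝ → S → ℝ := fun t =>
    (∑ c, (P c + Pi.single (M := fun _ => ℝ) s t c))⁻¹ • (P + Pi.single s t) with hγ
  have hsum : ∀ t : ℝ, ∑ c, (P c + Pi.single (M := fun _ => ℝ) s t c) = 1 + t := fun t => by
    rw [Finset.sum_add_distrib, hP.2]; simp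
  have hγ2 : γ = fun t => (1 + t)⁻¹ • (P + t • Pi.single s 1) := by
    funext t
    rw [hγ]; simp only [hsum]
    congr 2
    rw [← Pi.single_smul]; simp
  have hγ0 : γ 0 = P := by rw [hγ2]; simp
  have hγd : HasDerivAt γ (Pi.single s 1 - P) 0 := by
    rw [hγ2]
    have h1 : HasDerivAt (fun t : ℝ => (1 + t)⁻¹) (-1) 0 := by
      have := ((hasDerivAt_id (0 : ℝ)).const_add 1).inv (by simp)
      refine this.congr_deriv (by simp)
    have h2 : HasDerivAt (fun t : ℝ => P + t • (Pi.single s 1 : S → ℝ)) (Pi.single s 1) 0 := by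
      simpa using ((hasDerivAt_id (0 : ℝ)).smul_const (Pi.single s 1 : S → ℝ)).const_add P
    refine (h1.smul h2).congr_deriv ?_
    simp [sub_eq_add_neg]
  have hcurve : HasDerivAt (fun t => (γ t, D)) (Pi.single s 1 - P, 0) 0 :=
    hγd.prodMk (hasDerivAt_const _ _)
  have hFd : HasFDerivAt F (fderiv ℝ F (P, D)) (γ 0, D) := by
    rw [hγ0]
    exact ((hF _ hz).differentiableAt (hU.mem_nhds hz)).hasFDerivAt
  have hcomp := hFd.comp_hasDerivAt (0 : ℝ) hcurve
  have hev : (fun t => rdf d (γ t) D) =ᶠ[𝓝 0] fun t => F (γ t, D) := by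
    have hmem : ∀ᶠ t in 𝓝 (0 : ℝ), (γ t, D) ∈ U := by
      refine hcurve.continuousAt.eventually_mem (hU.mem_nhds ?_)
      rw [hγ0]; exact hz
    filter_upwards [hmem, lt_mem_nhds (show -P s < 0 by linarith),
      lt_mem_nhds (show (-1 : ℝ) < 0 by norm_num)] with t h1 h2 h3
    refine (hFR _ h1 ?_).symm
    have hpos : 0 < 1 + t := by linarith
    constructor
    · intro c
      simp only [hγ, hsum, Pi.smul_apply, Pi.add_apply, smul_eq_mul]
      refine mul_nonneg (by positivity) ?_
      rcases eq_or_ne c s with rfl | hc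
      · simp; linarith
      · simp [hc, hP.1 c]
    · simp only [hγ, Pi.smul_apply, Pi.add_apply, smul_eq_mul]
      rw [← Finset.mul_sum, hsum, inv_mul_cancel₀ hpos.ne']
  exact (hcomp.congr_of_eventuallyEq hev).deriv

/-- Second-order expansion of the rate-distortion function around `(P, D₀)`, along distortion
levels parametrized by the rate. -/
theorem exists_rdf_expansion (hd0 : ∀ s, ∃ t, d s t = 0) (hP : P ∈ stdSimplex ℝ S) {D₀ : ℝ}
    (hD₀ : 0 < D₀) (hpos : 0 < rdf d P D₀) (hdiff : RdfTwiceDifferentiableNear d P D₀) :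
    ∃ (r : S → ℝ) (K η : ℝ), 0 ≤ K ∧ 0 < η ∧ ∑ s, P s * r s = 0 ∧
      ∑ s, P s * r s ^ 2 = sourceDispersion d P D₀ ∧
      ∀ τ, |τ| ≤ η → ∃ D, 0 < D ∧ rdf d P D = rdf d P D₀ + τ ∧
        ∀ Q ∈ stdSimplex ℝ S, ∑ s, (Q s - P s) ^ 2 ≤ η →
          |rdf d Q D - rdf d P D - ∑ s, Q s * r s| ≤ K * (∑ s, (Q s - P s) ^ 2 + τ ^ 2) := by
  obtain ⟨F, U, hU, hz, hFR, hF, hF'⟩ := hdiff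
  obtain ⟨K, η, hK, hη, hball, hT⟩ := exists_taylor_bound hU hz hF hF'
  set L := fderiv ℝ F (P, D₀) with hL
  set c := L (0, 1) with hcdef
  -- This choice makes Σ Q r = L(Q - P, 0) for every distribution Q, and in particular centres r
  -- under P.
  set r : S → ℝ := fun s => L (Pi.single s 1 - P, 0) with hr
  have hsplit : ∀ (v : S → ℝ) (t : ℝ), L (v, t) = L (v, 0) + t * c := by
    intro v t
    have : (v, t) = (v, (0 : ℝ)) + t • ((0 : S → ℝ), (1 : ℝ)) := by simp
    rw [this, map_add, map_smul, smul_eq_mul]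
  have hlin : ∀ Q ∈ stdSimplex ℝ S, ∑ s, Q s * r s = L (Q - P, 0) := by
    intro Q hQ
    have e : (Q - P, (0 : ℝ)) = ∑ s, Q s • ((Pi.single s 1 - P : S → ℝ), (0 : ℝ)) := by
      refine Prod.ext ?_ ?_
      · rw [Prod.fst_sum]
        simp only [Prod.smul_mk]
        funext a
        simp only [Pi.sub_apply, Finset.sum_apply, Pi.smul_apply, smul_eq_mul, mul_sub,
          Finset.sum_sub_distrib, ← Finset.sum_mul, hQ.2]
        simp [Pi.single_apply]
      · rw [Prod.snd_sum]; simp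
    rw [e, map_sum]
    exact Finset.sum_congr rfl fun s _ => by rw [map_smul, smul_eq_mul]
  have hFP : ∀ Q ∈ stdSimplex ℝ S, ∀ D, (Q, D) ∈ U → F (Q, D) = rdf d Q D := fun Q hQ D h =>
    hFR _ h hQ
  have hz₀ : F (P, D₀) = rdf d P D₀ := hFP P hP D₀ hz
  have hmemP : ∀ D, |D - D₀| < η → (P, D) ∈ Metric.ball (P, D₀) η := by
    intro D hD
    rw [Metric.mem_ball, Prod.dist_eq, max_lt_iff, dist_self, Real.dist_eq]
    exact ⟨hη, hD⟩
  have hcneg : c < 0 := by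
    refine rdf_deriv_neg hd0 hP hD₀.le hpos ?_
    have hcurve : HasDerivAt (fun D : ℝ => (P, D)) ((0 : S → ℝ), (1 : ℝ)) D₀ :=
      (hasDerivAt_const _ _).prodMk (hasDerivAt_id _)
    have hFd : HasFDerivAt F L (P, D₀) := ((hF _ hz).differentiableAt (hU.mem_nhds hz)).hasFDerivAt
    refine (hFd.comp_hasDerivAt D₀ hcurve).congr_of_eventuallyEq ?_
    filter_upwards [Metric.ball_mem_nhds D₀ hη] with D hD
    exact (hFP P hP D (hball (hmemP D hD))).symm
  have hTP : ∀ D, |D - D₀| < η → |rdf d P D - rdf d P D₀ - (D - D₀) * c| ≤ K * (D - D₀) ^ 2 := by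
    intro D hD
    have h1 := hT _ (hmemP D hD)
    rw [hFP P hP D (hball (hmemP D hD)), hz₀] at h1
    have e : (P, D) - (P, D₀) = ((0 : S → ℝ), D - D₀) := by simp
    rw [e, hsplit] at h1
    have e0 : L ((0 : S → ℝ), (0 : ℝ)) = 0 := map_zero L
    rw [e0, zero_add] at h1
    have en : ‖((0 : S → ℝ), D - D₀)‖ = |D - D₀| := by simp [Prod.norm_def]
    rwa [en, sq_abs] at h1
  have hsumPr : ∑ s, P s * r s = 0 := by
    rw [hlin P hP, sub_self]; exact map_zero L
  -- The four bounds give, in order: ‖Q - P‖ ≤ η/2; |D - D₀| ≤ η/2; D ≥ D₀/2; and a quadratic error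
  -- in D of at most half the linear term. The factor 4/c² comes from (D - D₀)² ≤ 4τ²/c², and the
  -- Taylor bound is used at (Q,D) and at (P,D), whose D-terms cancel.
  refine ⟨r, K * (2 + 2 * (4 / c ^ 2)),
    min (η ^ 2 / 4) (min (-c * η / 4) (min (-c * D₀ / 4) (c ^ 2 / (4 * (K + 1))))),
    by positivity, ?_, hsumPr, ?_, ?_⟩
  · have : 0 < -c := by linarith
    have : 0 < c ^ 2 := by nlinarith
    refine lt_min (by positivity) (lt_min (by positivity) (lt_min (by positivity) (by positivity)))
  · have hpart : ∀ s, P s * rdfPartial d P D₀ s = P s * r s := by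
      intro s
      rcases (hP.1 s).eq_or_lt with h | h
      · simp [← h]
      · rw [rdfPartial_eq hP hU hz hFR hF h]
    unfold sourceDispersion distVar
    simp_rw [hpart, hsumPr, sub_zero]
    refine Finset.sum_congr rfl fun s _ => ?_
    have h1 := hpart s
    rcases (hP.1 s).eq_or_lt with h | h
    · simp [← h]
    · rw [mul_left_cancel₀ h.ne' h1]
  · intro τ hτ
    obtain ⟨hτ1, hτ⟩ := le_min_iff.1 hτ
    obtain ⟨hτ2, hτ⟩ := le_min_iff.1 hτ
    obtain ⟨hτ3, hτ4⟩ := le_min_iff.1 hτ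
    have hc' : 0 < -c := by linarith
    -- The linear change of the rate over a distance h is 2|τ|; at least |τ| survives the quadratic
    -- error, so the intermediate value theorem reaches the rate R(P,D₀) + τ.
    obtain ⟨h, hh⟩ : ∃ h, h = 2 / (-c) * |τ| := ⟨_, rfl⟩
    have hch : -c * h = 2 * |τ| := by
      rw [hh, ← mul_assoc, mul_div_cancel₀ _ hc'.ne']
    have hh0 : 0 ≤ h := by rw [hh]; positivity
    have hhη : h ≤ η / 2 := le_of_mul_le_mul_left (by linarith) hc'
    have hhD : h ≤ D₀ / 2 := le_of_mul_le_mul_left (by linarith) hc'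
    have hKh : K * h ≤ -c / 2 := by
      rw [le_div_iff₀ (by positivity)] at hτ4
      have h1 : (K + 1) * (2 * |τ|) ≤ c ^ 2 / 2 := by linarith
      rw [← hch] at h1
      have h2 : (K + 1) * h ≤ -c / 2 := le_of_mul_le_mul_left (by linarith) hc'
      linarith
    have hmem : ∀ D, D ∈ Set.Icc (D₀ - h) (D₀ + h) → |D - D₀| ≤ h := fun D hD => by
      rw [abs_le]; constructor <;> linarith [hD.1, hD.2]
    have hcont : ContinuousOn (fun D => rdf d P D) (Set.Icc (D₀ - h) (D₀ + h)) := by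
      have h1 : ContinuousOn (fun D : ℝ => F (P, D)) (Set.Icc (D₀ - h) (D₀ + h)) :=
        hF.continuousOn.comp (by fun_prop) fun D hD => hball (hmemP D (by linarith [hmem D hD]))
      refine h1.congr fun D hD => ?_
      exact (hFP P hP D (hball (hmemP D (by linarith [hmem D hD])))).symm
    have hup := hTP (D₀ + h) (by rw [add_sub_cancel_left, abs_of_nonneg hh0]; linarith)
    have hlo := hTP (D₀ - h) (by rw [sub_sub_cancel_left, abs_neg, abs_of_nonneg hh0]; linarith)
    rw [abs_le] at hup hlo
    have hK2 : K * h ^ 2 ≤ -c / 2 * h := by linarith [mul_le_mul_of_nonneg_right hKh hh0]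
    obtain ⟨D, hDm, hDv⟩ := intermediate_value_Icc' (by linarith) hcont
      (show rdf d P D₀ + τ ∈ Set.Icc (rdf d P (D₀ + h)) (rdf d P (D₀ - h)) by
        constructor
        · linarith [hup.2, neg_abs_le τ]
        · linarith [hlo.1, le_abs_self τ])
    refine ⟨D, by linarith [hDm.1], hDv, fun Q hQ hQP => ?_⟩
    have hDh := hmem D hDm
    have hsq : ∀ s, |Q s - P s| ≤ η / 2 := fun s => by
      refine abs_le_of_sq_le_sq ?_ (by positivity)
      have h1 := Finset.single_le_sum (f := fun s => (Q s - P s) ^ 2) (fun s _ => sq_nonneg _)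
        (Finset.mem_univ s)
      have h2 := hQP.trans (min_le_left _ _)
      have h3 : (η / 2) ^ 2 = η ^ 2 / 4 := by ring
      linarith
    set N := ∑ s, (Q s - P s) ^ 2 with hN
    have hN0 : 0 ≤ N := Finset.sum_nonneg fun s _ => sq_nonneg _
    have hnorm1 : ‖Q - P‖ ≤ η / 2 := (pi_norm_le_iff_of_nonneg (by positivity)).2 fun s => hsq s
    have hnorm2 : ‖Q - P‖ ^ 2 ≤ N := by
      have : ‖Q - P‖ ≤ √N := (pi_norm_le_iff_of_nonneg (by positivity)).2 fun s => by
        rw [Real.norm_eq_abs]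
        refine Real.le_sqrt_of_sq_le ?_
        rw [sq_abs]
        exact Finset.single_le_sum (f := fun s => (Q s - P s) ^ 2) (fun s _ => sq_nonneg _)
          (Finset.mem_univ s)
      calc ‖Q - P‖ ^ 2 ≤ √N ^ 2 := by gcongr
        _ = N := Real.sq_sqrt hN0
    have hzmem : (Q, D) ∈ Metric.ball (P, D₀) η := by
      rw [Metric.mem_ball, Prod.dist_eq, max_lt_iff, Real.dist_eq, dist_eq_norm]
      exact ⟨by linarith, by linarith⟩
    have h1 := hT _ hzmem
    rw [hFP Q hQ D (hball hzmem), hz₀, Prod.mk_sub_mk, hsplit, ← hlin Q hQ] at h1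
    have h2 := hTP D (by linarith)
    have hDsq : (D - D₀) ^ 2 ≤ 4 / c ^ 2 * τ ^ 2 := by
      have : (D - D₀) ^ 2 ≤ h ^ 2 := by rw [← sq_abs]; gcongr
      refine this.trans (le_of_eq ?_)
      rw [hh, mul_pow, div_pow, neg_sq, sq_abs]; norm_num
    have hn : ‖(Q - P, D - D₀)‖ ^ 2 ≤ N + (D - D₀) ^ 2 := by
      change max ‖Q - P‖ ‖D - D₀‖ ^ 2 ≤ _
      rcases max_choice ‖Q - P‖ ‖D - D₀‖ with h | h
      · rw [h]; linarith [sq_nonneg (D - D₀)]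
      · rw [h, Real.norm_eq_abs, sq_abs]; linarith
    have h3 : K * ‖(Q - P, D - D₀)‖ ^ 2 + K * (D - D₀) ^ 2
        ≤ K * (N + 2 * (4 / c ^ 2 * τ ^ 2)) := by
      rw [← mul_add]; exact mul_le_mul_of_nonneg_left (by linarith) hK
    have h4 : K * (N + 2 * (4 / c ^ 2 * τ ^ 2)) ≤ K * (2 + 2 * (4 / c ^ 2)) * (N + τ ^ 2) := by
      rw [mul_assoc]
      refine mul_le_mul_of_nonneg_left ?_ hK
      have h5 : 0 ≤ 4 / c ^ 2 := by positivity
      linarith [sq_nonneg τ, mul_nonneg h5 hN0]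
    rw [abs_le] at h1 h2 ⊢
    constructor <;> linarith

end SourceExpansion

/-! ### A Hoffman-type error bound on the nonnegative orthant. -/

section Hoffman

variable {A E : Type*} [Fintype A] [NormedAddCommGroup E] [NormedSpace ℝ E]

/-- On the compact face of the simplex supported on F the norm of l has a positive minimum;
homogeneity extends the bound to the cone. -/
lemma exists_sum_le_mul_norm (l : (A → ℝ) →L[ℝ] E) (F : Finset A)
    (hF : ∀ ν : A → ℝ, (∀ a, 0 ≤ ν a) → (∀ a ∉ F, ν a = 0) → l ν = 0 → ν = 0) :
    ∃ K : ℝ, 0 ≤ K ∧ ∀ ν : A → ℝ, (∀ a, 0 ≤ ν a) → (∀ a ∉ F, ν a = 0) →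
      ∑ a, ν a ≤ K * ‖l ν‖ := by
  set Z : Set (A → ℝ) := stdSimplex ℝ A ∩ {ν | ∀ a ∉ F, ν a = 0} with hZ
  have hcomp : IsCompact Z := by
    refine (isCompact_stdSimplex ℝ A).inter_right ?_
    simp only [Set.ofPred_forall]
    refine isClosed_iInter fun a => isClosed_iInter fun _ => ?_
    exact isClosed_eq (continuous_apply a) continuous_const
  obtain ⟨c, hc, hcZ⟩ : ∃ c : ℝ, 0 < c ∧ ∀ ν ∈ Z, c ≤ ‖l ν‖ := by
    rcases Z.eq_empty_or_nonempty with h | h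
    · exact ⟨1, one_pos, fun ν hν => by rw [h] at hν; exact hν.elim⟩
    · obtain ⟨ν, hν, hmin⟩ := hcomp.exists_isMinOn h (f := fun ν => ‖l ν‖)
        (l.continuous.norm.continuousOn)
      refine ⟨‖l ν‖, ?_, fun ν' hν' => hmin hν'⟩
      refine norm_pos_iff.2 fun h0 => ?_
      have := hF ν hν.1.1 hν.2 h0
      have h1 := hν.1.2
      rw [this] at h1
      simp at h1
  refine ⟨c⁻¹, by positivity, fun ν h0 hsupp => ?_⟩
  rcases (Finset.sum_nonneg fun a (_ : a ∈ Finset.univ) => h0 a).eq_or_lt with h | h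
  · rw [← h]; positivity
  · have hmem : (∑ a, ν a)⁻¹ • ν ∈ Z := by
      refine ⟨⟨fun a => ?_, ?_⟩, fun a ha => ?_⟩
      · exact mul_nonneg (by positivity) (h0 a)
      · simp only [Pi.smul_apply, smul_eq_mul]
        rw [← Finset.mul_sum, inv_mul_cancel₀ h.ne']
      · simp [hsupp a ha]
    have h1 := hcZ _ hmem
    rw [map_smul, norm_smul, norm_inv, Real.norm_of_nonneg h.le] at h1
    rw [inv_mul_eq_div, le_div_iff₀ hc]
    rw [inv_mul_eq_div, le_div_iff₀ h] at h1
    linarith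

/-- A Hoffman-type error bound: a functional that vanishes on the kernel of `l` in the nonnegative
orthant is dominated by `l` on the orthant. -/
lemma exists_abs_le_mul_norm (l : (A → ℝ) →L[ℝ] E) (f : A → ℝ)
    (hf : ∀ ν : A → ℝ, (∀ a, 0 ≤ ν a) → l ν = 0 → ∑ a, ν a * f a = 0) :
    ∃ K : ℝ, 0 ≤ K ∧ ∀ ν : A → ℝ, (∀ a, 0 ≤ ν a) → |∑ a, ν a * f a| ≤ K * ‖l ν‖ := by
  classical
  have hex : ∀ F : Finset A, ∃ K : ℝ, 0 ≤ K ∧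
      ((∀ ν : A → ℝ, (∀ a, 0 ≤ ν a) → (∀ a ∉ F, ν a = 0) → l ν = 0 → ν = 0) →
      ∀ ν : A → ℝ, (∀ a, 0 ≤ ν a) → (∀ a ∉ F, ν a = 0) → ∑ a, ν a ≤ K * ‖l ν‖) := by
    intro F
    by_cases h : ∀ ν : A → ℝ, (∀ a, 0 ≤ ν a) → (∀ a ∉ F, ν a = 0) → l ν = 0 → ν = 0
    · obtain ⟨K, h0, hK⟩ := exists_sum_le_mul_norm l F h
      exact ⟨K, h0, fun _ => hK⟩
    · exact ⟨0, le_rfl, fun h' => absurd h' h⟩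
  choose K hK0 hK using hex
  set M := ∑ a, |f a| with hM
  have hM0 : 0 ≤ M := Finset.sum_nonneg fun a _ => abs_nonneg _
  refine ⟨M * ∑ F, K F, mul_nonneg hM0 (Finset.sum_nonneg fun F _ => hK0 F), fun Φ hΦ => ?_⟩
  -- A kernel element μ ≤ Φ of maximal mass is removed. Neither l nor the functional f sees it.
  have hcomp : IsCompact (Set.Icc 0 Φ ∩ {μ | l μ = 0}) :=
    isCompact_Icc.inter_right (isClosed_eq l.continuous continuous_const)
  obtain ⟨μ, ⟨⟨hμ0, hμΦ⟩, hμl⟩, hmax⟩ := hcomp.exists_isMaxOn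
    ⟨0, ⟨le_rfl, fun a => hΦ a⟩, map_zero l⟩ (f := fun μ : A → ℝ => ∑ a, μ a)
    (by fun_prop)
  set Ψ : A → ℝ := Φ - μ with hΨ
  have hΨ0 : ∀ a, 0 ≤ Ψ a := fun a => sub_nonneg.2 (hμΦ a)
  have hlΨ : l Ψ = l Φ := by
    have : l μ = 0 := hμl
    rw [hΨ, map_sub, this, sub_zero]
  have hfΨ : ∑ a, Φ a * f a = ∑ a, Ψ a * f a := by
    have := hf μ hμ0 hμl
    simp only [hΨ, Pi.sub_apply, sub_mul, Finset.sum_sub_distrib, this, sub_zero]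
  set F := Finset.univ.filter fun a => Ψ a ≠ 0 with hF
  -- A nonzero kernel element on the support of the remainder could be added to μ in a small
  -- multiple, against maximality. Only finitely many supports occur, so their constants can be
  -- summed.
  have hgood : ∀ ν : A → ℝ, (∀ a, 0 ≤ ν a) → (∀ a ∉ F, ν a = 0) → l ν = 0 → ν = 0 := by
    intro ν hν hsupp hlν
    by_contra hne
    have hpos : 0 < ∑ a, ν a := by
      refine (Finset.sum_nonneg fun a _ => hν a).lt_of_ne' fun h => hne ?_
      funext a
      exact (Finset.sum_eq_zero_iff_of_nonneg fun a _ => hν a).1 h a (Finset.mem_univ a)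
    obtain ⟨e, he, hle⟩ : ∃ e : ℝ, 0 < e ∧ ∀ a, e * ν a ≤ Ψ a := by
      have : ∀ a, ∀ᶠ e in 𝓝[>] (0 : ℝ), e * ν a ≤ Ψ a := by
        intro a
        by_cases ha : Ψ a = 0
        · have : ν a = 0 := hsupp a (by simp [hF, ha])
          simp [this, ha]
        · have hpa : 0 < Ψ a := (hΨ0 a).lt_of_ne' ha
          have ht : Tendsto (fun e : ℝ => e * ν a) (𝓝[>] 0) (𝓝 (0 * ν a)) :=
            (tendsto_id.mul_const _).mono_left nhdsWithin_le_nhds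
          rw [zero_mul] at ht
          exact ht.eventually (ge_mem_nhds hpa)
      obtain ⟨e, h1, h2⟩ := ((eventually_all.2 this).and self_mem_nhdsWithin).exists
      exact ⟨e, h2, h1⟩
    have hmem : μ + e • ν ∈ Set.Icc 0 Φ ∩ {μ | l μ = 0} := by
      have hμl' : l μ = 0 := hμl
      refine ⟨⟨fun a => ?_, fun a => ?_⟩, ?_⟩
      · exact add_nonneg (hμ0 a) (mul_nonneg he.le (hν a))
      · have := hle a
        simp only [hΨ, Pi.sub_apply] at this
        simp only [Pi.add_apply, Pi.smul_apply, smul_eq_mul]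
        linarith
      · simp [hlν, hμl']
    have h1 : ∑ a, (μ + e • ν) a ≤ ∑ a, μ a := hmax hmem
    simp only [Pi.add_apply, Pi.smul_apply, smul_eq_mul, Finset.sum_add_distrib,
      ← Finset.mul_sum] at h1
    nlinarith
  have h1 := hK F hgood Ψ hΨ0 (fun a ha => by simpa [hF] using ha)
  have h2 : K F ≤ ∑ F, K F := Finset.single_le_sum (f := K) (fun F _ => hK0 F) (Finset.mem_univ F)
  rw [hfΨ]
  calc |∑ a, Ψ a * f a| ≤ ∑ a, |Ψ a * f a| := Finset.abs_sum_le_sum_abs _ _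
    _ ≤ ∑ a, Ψ a * M := by
        refine Finset.sum_le_sum fun a _ => ?_
        rw [abs_mul, abs_of_nonneg (hΨ0 a)]
        refine mul_le_mul_of_nonneg_left ?_ (hΨ0 a)
        exact Finset.single_le_sum (f := fun a => |f a|) (fun a _ => abs_nonneg _)
          (Finset.mem_univ a)
    _ = M * ∑ a, Ψ a := by rw [← Finset.sum_mul, mul_comm]
    _ ≤ M * (K F * ‖l Ψ‖) := mul_le_mul_of_nonneg_left h1 hM0
    _ ≤ M * ((∑ F, K F) * ‖l Ψ‖) := by gcongr
    _ = _ := by rw [hlΨ, mul_assoc]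

end Hoffman

/-! ### Optimality conditions for the capacity. -/

section Capacity

variable {X Y : Type*} [Fintype X] [Fintype Y] {W : X → Y → ℝ}

lemma mutualInfo_eq_sum_relEnt (Φ : X → ℝ) (W : X → Y → ℝ) :
    mutualInfo Φ W = ∑ a, Φ a * relEnt (W a) (outDist Φ W) := by
  unfold mutualInfo relEnt infoDensity
  simp_rw [Finset.mul_sum, mul_assoc]

lemma mutualInfo_eq_sum_relEnt_sub {Φ : X → ℝ} {q : Y → ℝ} (hΦ : ∀ a, 0 ≤ Φ a)
    (hW : ∀ a, W a ∈ stdSimplex ℝ Y) (hq : ∀ a b, 0 < Φ a → 0 < W a b → 0 < q b) :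
    mutualInfo Φ W = ∑ a, Φ a * relEnt (W a) q - relEnt (outDist Φ W) q := by
  rw [mutualInfo_eq hΦ (fun a _ => (hW a).1) hq]
  unfold relEnt
  simp_rw [Finset.mul_sum, mul_assoc]

/-- With q ≡ 1 the decomposition `mutualInfo_eq` is a linear function minus Σ t log t at the output
probabilities, which is continuous up to the boundary. -/
lemma continuousOn_mutualInfo (hW : ∀ a, W a ∈ stdSimplex ℝ Y) :
    ContinuousOn (fun Φ : X → ℝ => mutualInfo Φ W) (stdSimplex ℝ X) := by
  have h : ContinuousOn (fun Φ : X → ℝ => ∑ a, ∑ b, Φ a * W a b * Real.log (W a b / 1)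
      - ∑ b, outDist Φ W b * Real.log (outDist Φ W b)) (stdSimplex ℝ X) := by
    refine Continuous.continuousOn ?_
    refine Continuous.sub (by fun_prop) (continuous_finsetSum _ fun b _ => ?_)
    refine Real.continuous_mul_log.comp ?_
    unfold outDist
    fun_prop
  refine h.congr fun Φ hΦ => ?_
  rw [mutualInfo_eq (q := fun _ => 1) hΦ.1 (fun a _ => (hW a).1) (fun _ _ _ _ => one_pos)]
  simp [relEnt]

lemma exists_mem_capAchieving [Nonempty X] (hW : ∀ a, W a ∈ stdSimplex ℝ Y) :
    (capAchieving W).Nonempty ∧ ∀ Φ ∈ stdSimplex ℝ X, mutualInfo Φ W ≤ capacity W := by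
  classical
  obtain ⟨Φ, hΦ, hmax⟩ := (isCompact_stdSimplex ℝ X).exists_isMaxOn
    ⟨_, single_mem_stdSimplex ℝ (Classical.arbitrary X)⟩ (continuousOn_mutualInfo hW)
  have hg : IsGreatest ((fun Φ : X → ℝ => mutualInfo Φ W) '' stdSimplex ℝ X) (mutualInfo Φ W) := by
    refine ⟨⟨Φ, hΦ, rfl⟩, ?_⟩
    rintro _ ⟨Φ', h, rfl⟩
    exact hmax h
  have hcap : capacity W = mutualInfo Φ W := hg.csSup_eq
  exact ⟨⟨Φ, hΦ, hcap.symm⟩, fun Φ' h => hcap ▸ hmax h⟩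

/-- The input law is moved by l towards the point mass at a, with output law q_l. Then C ≥ (1 - l) Σ
Φ D(W‖q_l) + l D(W_a‖q_l), and the first sum is at least C because I(Φ,W) = Σ Φ D(W‖q_l) - D(q‖q_l).
No derivative at the boundary is taken. -/
lemma relEnt_mix_le_capacity [Nonempty X] (hW : ∀ a, W a ∈ stdSimplex ℝ Y) {Φ : X → ℝ}
    (hΦ : Φ ∈ capAchieving W) (a : X) {l : ℝ} (hl0 : 0 < l) (hl1 : l < 1) :
    relEnt (W a) (fun b => (1 - l) * outDist Φ W b + l * W a b) ≤ capacity W := by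
  classical
  obtain ⟨hΦs, hΦC⟩ := hΦ
  set Φl : X → ℝ := (1 - l) • Φ + l • Pi.single a 1 with hΦl
  have hmem : Φl ∈ stdSimplex ℝ X := convex_stdSimplex ℝ X hΦs (single_mem_stdSimplex ℝ a)
    (by linarith) hl0.le (by ring)
  have hout : outDist Φl W = fun b => (1 - l) * outDist Φ W b + l * W a b := by
    funext b
    unfold outDist
    simp only [hΦl, Pi.add_apply, Pi.smul_apply, smul_eq_mul, add_mul, Finset.sum_add_distrib,
      mul_assoc, ← Finset.mul_sum]
    simp [Pi.single_apply]
  have hdom : ∀ a' b, 0 < Φ a' → 0 < W a' b →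
      0 < (1 - l) * outDist Φ W b + l * W a b := by
    intro a' b h1 h2
    have h3 : 0 < outDist Φ W b :=
      (mul_pos h1 h2).trans_le (mul_le_outDist hΦs.1 (fun a _ => (hW a).1) a' b)
    have h4 := (hW a).1 b
    have h5 : 0 < 1 - l := by linarith
    positivity
  have hqmem := outDist_mem hmem fun a _ => hW a
  rw [hout] at hqmem
  have h1 := mutualInfo_eq_sum_relEnt_sub hΦs.1 hW hdom
  have h2 : 0 ≤ relEnt (outDist Φ W) (fun b => (1 - l) * outDist Φ W b + l * W a b) := by
    refine relEnt_nonneg (outDist_mem hΦs fun a _ => hW a) hqmem fun b hb => ?_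
    have h4 := (hW a).1 b
    have h5 : 0 < 1 - l := by linarith
    positivity
  have h3 := (exists_mem_capAchieving hW).2 Φl hmem
  rw [mutualInfo_eq_sum_relEnt, hout] at h3
  simp only [hΦl, Pi.add_apply, Pi.smul_apply, smul_eq_mul, add_mul, Finset.sum_add_distrib,
      mul_assoc, ← Finset.mul_sum] at h3
  simp only [Pi.single_apply, ite_mul, one_mul, zero_mul, Finset.sum_ite_eq', Finset.mem_univ,
    if_true] at h3
  rw [hΦC] at h1
  have h5 : 0 < 1 - l := by linarith
  have h6 : (1 - l) * capacity W
      ≤ (1 - l) * ∑ a', Φ a' * relEnt (W a') (fun b => (1 - l) * outDist Φ W b + l * W a b) :=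
    mul_le_mul_of_nonneg_left (by linarith) h5.le
  refine le_of_mul_le_mul_left ?_ hl0
  linarith

/-- If q(b) = 0, the preceding divergence contains the term W(b|a) log(1/l), unbounded as l → 0; in
the proof l = exp(-M). -/
lemma outDist_pos_of_capAchieving [Nonempty X] (hW : ∀ a, W a ∈ stdSimplex ℝ Y) {Φ : X → ℝ}
    (hΦ : Φ ∈ capAchieving W) {a : X} {b : Y} (hab : 0 < W a b) : 0 < outDist Φ W b := by
  classical
  have hq := outDist_mem hΦ.1 fun a _ => hW a
  refine (hq.1 b).lt_of_ne' fun h0 => ?_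
  set c := ∑ b' ∈ Finset.univ.erase b, W a b' * Real.log (W a b') with hc
  have key : ∀ M : ℝ, 0 < M → c + W a b * M ≤ capacity W := by
    intro M hM
    have hl1 : Real.exp (-M) < 1 := by rw [Real.exp_lt_one_iff]; linarith
    have hl0 := Real.exp_pos (-M)
    refine le_trans ?_ (relEnt_mix_le_capacity hW hΦ a hl0 hl1)
    unfold relEnt
    rw [← Finset.sum_erase_add _ _ (Finset.mem_univ b), hc]
    refine add_le_add (Finset.sum_le_sum fun b' _ => ?_) (le_of_eq ?_)
    · rcases ((hW a).1 b').eq_or_lt with h | h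
      · simp [← h]
      have h1 := hq.1 b'
      have h2 : 0 < 1 - Real.exp (-M) := by linarith
      have hpos : 0 < (1 - Real.exp (-M)) * outDist Φ W b' + Real.exp (-M) * W a b' := by positivity
      refine mul_le_mul_of_nonneg_left (Real.log_le_log h ?_) h.le
      rw [le_div_iff₀ hpos]
      have h3 := le_one_of_mem_stdSimplex hq b'
      have h4 := le_one_of_mem_stdSimplex (hW a) b'
      have : (1 - Real.exp (-M)) * outDist Φ W b' + Real.exp (-M) * W a b' ≤ 1 := by nlinarith
      nlinarith
    · beta_reduce
      rw [h0, mul_zero, zero_add]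
      have : W a b / (Real.exp (-M) * W a b) = Real.exp M := by
        rw [Real.exp_neg]; field_simp
      rw [this, Real.log_exp]
  have h1 := key ((|capacity W - c| + 1) / W a b) (by positivity)
  rw [mul_div_cancel₀ _ hab.ne'] at h1
  linarith [le_abs_self (capacity W - c)]

/-- The Kuhn–Tucker condition, as the limit l → 0; positivity of the output law makes the divergence
continuous there. -/
lemma relEnt_le_capacity [Nonempty X] (hW : ∀ a, W a ∈ stdSimplex ℝ Y) {Φ : X → ℝ}
    (hΦ : Φ ∈ capAchieving W) (a : X) : relEnt (W a) (outDist Φ W) ≤ capacity W := by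
  have ht : Tendsto (fun l : ℝ => relEnt (W a) (fun b => (1 - l) * outDist Φ W b + l * W a b))
      (𝓝[>] 0) (𝓝 (relEnt (W a) (outDist Φ W))) := by
    unfold relEnt
    refine tendsto_finsetSum _ fun b _ => ?_
    rcases ((hW a).1 b).eq_or_lt with h | h
    · simp [← h]
    have hq := outDist_pos_of_capAchieving hW hΦ h
    refine Tendsto.const_mul _ ?_
    have h1 : Tendsto (fun l : ℝ => (1 - l) * outDist Φ W b + l * W a b) (𝓝 0)
        (𝓝 ((1 - 0) * outDist Φ W b + 0 * W a b)) :=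
      Continuous.tendsto (by fun_prop) 0
    simp only [sub_zero, one_mul, zero_mul, add_zero] at h1
    have h2 := (tendsto_const_nhds (x := W a b)).div h1 hq.ne'
    exact ((Real.continuousAt_log (by positivity)).tendsto.comp h2).mono_left nhdsWithin_le_nhds
  refine le_of_tendsto ht ?_
  filter_upwards [Ioo_mem_nhdsGT (show (0 : ℝ) < 1 by norm_num)] with l hl
  exact relEnt_mix_le_capacity hW hΦ a hl.1 hl.2

/-- The capacity-achieving output distribution is unique. -/
lemma outDist_eq_of_capAchieving [Nonempty X] (hW : ∀ a, W a ∈ stdSimplex ℝ Y) {Φ Φ' : X → ℝ}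
    (hΦ : Φ ∈ capAchieving W) (hΦ' : Φ' ∈ capAchieving W) : outDist Φ' W = outDist Φ W := by
  have h1 := mutualInfo_eq_sum_relEnt_sub (W := W) (q := outDist Φ W) hΦ'.1.1 hW fun a b _ h =>
    outDist_pos_of_capAchieving hW hΦ h
  have h2 : ∑ a, Φ' a * relEnt (W a) (outDist Φ W) ≤ ∑ a, Φ' a * capacity W :=
    Finset.sum_le_sum fun a _ =>
      mul_le_mul_of_nonneg_left (relEnt_le_capacity hW hΦ a) (hΦ'.1.1 a)
  rw [← Finset.sum_mul, hΦ'.1.2, one_mul] at h2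
  rw [hΦ'.2] at h1
  refine eq_of_relEnt_le_zero (outDist_mem hΦ'.1 fun a _ => hW a)
    (outDist_mem hΦ.1 fun a _ => hW a) (fun b hb => ?_) (by linarith)
  obtain ⟨a, _, ha⟩ := Finset.exists_ne_zero_of_sum_ne_zero hb.ne'
  refine outDist_pos_of_capAchieving hW hΦ (a := a) (((hW a).1 b).lt_of_ne' fun h => ha ?_)
  rw [h, mul_zero]

/-- Consequences of the optimality conditions for the capacity when the conditional information
variance is constant on the capacity-achieving input distributions. -/
theorem exists_capacity_output (hW : ∀ a, W a ∈ stdSimplex ℝ Y) (hVV : vMin W = vMax W)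
    (hV : 0 < vMin W) :
    0 < capacity W ∧ ∃ (Φ : X → ℝ) (q : Y → ℝ) (K : ℝ),
      Φ ∈ stdSimplex ℝ X ∧ q ∈ stdSimplex ℝ Y ∧ 0 ≤ K ∧ (∀ a b, 0 < W a b → 0 < q b) ∧
      (∀ a, relEnt (W a) q ≤ capacity W) ∧
      (∀ a, 0 < Φ a → relEnt (W a) q = capacity W) ∧
      ∑ a, Φ a * distVar (W a) (fun b => Real.log (W a b / q b)) = vMin W ∧
      ∀ Ψ ∈ stdSimplex ℝ X,
        |∑ a, Ψ a * distVar (W a) (fun b => Real.log (W a b / q b)) - vMin W|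
          ≤ K * (∑ a, Ψ a * (capacity W - relEnt (W a) q) + ‖outDist Ψ W - q‖) := by
  -- For an empty input alphabet `vMin` is the infimum of the empty set, which is 0 by convention.
  have hX : Nonempty X := by
    by_contra hne
    rw [not_nonempty_iff] at hne
    have : capAchieving W = ∅ := by
      ext Φ
      simp only [capAchieving, Set.mem_ofPred_eq, Set.mem_empty_iff_false, iff_false]
      rintro ⟨h, -⟩
      have := h.2
      simp at this
    simp [vMin, this] at hV
  obtain ⟨⟨Φ, hΦ⟩, -⟩ := exists_mem_capAchieving hW
  set q := outDist Φ W with hq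
  set v : X → ℝ := fun a => distVar (W a) (fun b => Real.log (W a b / q b)) with hv
  have hpos : ∀ a b, 0 < W a b → 0 < q b := fun a b h => outDist_pos_of_capAchieving hW hΦ h
  have hle : ∀ a, relEnt (W a) q ≤ capacity W := fun a => relEnt_le_capacity hW hΦ a
  have hqmem : q ∈ stdSimplex ℝ Y := outDist_mem hΦ.1 fun a _ => hW a
  have hcond : ∀ Ψ ∈ capAchieving W, condInfoVar Ψ W = ∑ a, Ψ a * v a := by
    intro Ψ hΨ
    unfold condInfoVar infoDensity
    rw [outDist_eq_of_capAchieving hW hΦ hΨ]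
  have hvabs : ∀ Ψ ∈ stdSimplex ℝ X, |∑ a, Ψ a * v a| ≤ ∑ a, |v a| := fun Ψ hΨ => by
    refine (Finset.abs_sum_le_sum_abs _ _).trans (Finset.sum_le_sum fun a _ => ?_)
    rw [abs_mul, abs_of_nonneg (hΨ.1 a)]
    exact mul_le_of_le_one_left (abs_nonneg _) (le_one_of_mem_stdSimplex hΨ a)
  have hconst : ∀ Ψ ∈ capAchieving W, ∑ a, Ψ a * v a = vMin W := by
    intro Ψ hΨ
    refine le_antisymm ?_ ?_
    · rw [hVV, ← hcond Ψ hΨ]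
      refine le_csSup ⟨∑ a, |v a|, ?_⟩ ⟨Ψ, hΨ, rfl⟩
      rintro _ ⟨Ψ', h, rfl⟩
      simp only [hcond Ψ' h]
      exact (le_abs_self _).trans (hvabs Ψ' h.1)
    · rw [← hcond Ψ hΨ]
      refine csInf_le ⟨-∑ a, |v a|, ?_⟩ ⟨Ψ, hΨ, rfl⟩
      rintro _ ⟨Ψ', h, rfl⟩
      simp only [hcond Ψ' h]
      exact (abs_le.1 (hvabs Ψ' h.1)).1
  have hcapeq : ∑ a, Φ a * relEnt (W a) q = capacity W := by
    rw [← hΦ.2, mutualInfo_eq_sum_relEnt]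
  have htight : ∀ a, 0 < Φ a → relEnt (W a) q = capacity W := by
    intro a ha
    have h1 : ∑ a, Φ a * (capacity W - relEnt (W a) q) = 0 := by
      simp_rw [mul_sub]
      rw [Finset.sum_sub_distrib, ← Finset.sum_mul, hΦ.1.2, hcapeq]; ring
    have h2 := (Finset.sum_eq_zero_iff_of_nonneg fun a _ =>
      mul_nonneg (hΦ.1.1 a) (sub_nonneg.2 (hle a))).1 h1 a (Finset.mem_univ a)
    have := (mul_eq_zero.1 h2).resolve_left ha.ne'
    linarith
  -- At zero capacity all used rows equal q, so the information density, and with it the variance,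
  -- would vanish.
  have hCpos : 0 < capacity W := by
    refine (hΦ.2 ▸ mutualInfo_nonneg hΦ.1 fun a _ => hW a : 0 ≤ capacity W).lt_of_ne' fun h0 => ?_
    have : ∑ a, Φ a * v a = 0 := by
      refine Finset.sum_eq_zero fun a _ => ?_
      rcases (hΦ.1.1 a).eq_or_lt with h | h
      · simp [← h]
      have hWq : W a = q :=
        eq_of_relEnt_le_zero (hW a) hqmem (hpos a) ((htight a h).trans h0).le
      have : ∀ b, Real.log (W a b / q b) = 0 := fun b => by
        rw [hWq]
        by_cases hb : q b = 0
        · simp [hb]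
        · simp [div_self hb]
      simp [hv, distVar, this]
    rw [hconst Φ hΦ] at this
    exact hV.ne' this
  refine ⟨hCpos, Φ, q, ?_⟩
  -- In the nonnegative orthant the kernel of this homogeneous map is the cone over the
  -- capacity-achieving inputs, on which the functional with weights v - V_min vanishes; the error
  -- bound therefore applies.
  let l : (X → ℝ) →ₗ[ℝ] ℝ × (Y → ℝ) :=
    { toFun := fun Ψ => (∑ a, Ψ a * (capacity W - relEnt (W a) q),
        fun b => ∑ a, Ψ a * (W a b - q b))
      map_add' := fun Ψ Ψ' => by
        refine Prod.ext ?_ (funext fun b => ?_) <;>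
          simp [add_mul, Finset.sum_add_distrib]
      map_smul' := fun c Ψ => by
        refine Prod.ext ?_ (funext fun b => ?_) <;>
          simp [mul_assoc, Finset.mul_sum] }
  have hl : ∀ Ψ, l.toContinuousLinearMap Ψ = (∑ a, Ψ a * (capacity W - relEnt (W a) q),
        fun b => ∑ a, Ψ a * (W a b - q b)) := fun Ψ => rfl
  have hout : ∀ Ψ : X → ℝ, ∑ a, Ψ a = 1 →
      (fun b => ∑ a, Ψ a * (W a b - q b)) = outDist Ψ W - q := by
    intro Ψ h1
    funext b
    simp only [mul_sub, Finset.sum_sub_distrib, ← Finset.sum_mul, h1, one_mul]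
    rfl
  obtain ⟨K, hK0, hK⟩ := exists_abs_le_mul_norm l.toContinuousLinearMap (fun a => v a - vMin W) (by
    intro ν hν hlν
    rcases (Finset.sum_nonneg fun a (_ : a ∈ Finset.univ) => hν a).eq_or_lt with h | h
    · refine Finset.sum_eq_zero fun a _ => ?_
      rw [(Finset.sum_eq_zero_iff_of_nonneg fun a _ => hν a).1 h.symm a (Finset.mem_univ a),
        zero_mul]
    set Ψ := (∑ a, ν a)⁻¹ • ν with hΨ
    have hΨs : Ψ ∈ stdSimplex ℝ X := by
      refine ⟨fun a => mul_nonneg (by positivity) (hν a), ?_⟩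
      simp only [hΨ, Pi.smul_apply, smul_eq_mul]
      rw [← Finset.mul_sum, inv_mul_cancel₀ h.ne']
    have hlΨ : l.toContinuousLinearMap Ψ = 0 := by rw [hΨ, map_smul, hlν, smul_zero]
    rw [hl, hout Ψ hΨs.2, Prod.mk_eq_zero] at hlΨ
    have hoΨ : outDist Ψ W = q := sub_eq_zero.1 hlΨ.2
    have hmem : Ψ ∈ capAchieving W := by
      refine ⟨hΨs, ?_⟩
      rw [mutualInfo_eq_sum_relEnt, hoΨ]
      have := hlΨ.1
      simp only [mul_sub, Finset.sum_sub_distrib, ← Finset.sum_mul, hΨs.2] at this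
      linarith
    have h3 := hconst Ψ hmem
    have h4 : ∑ a, ν a * (v a - vMin W) = (∑ a, ν a) * (∑ a, Ψ a * v a - vMin W) := by
      simp only [hΨ, Pi.smul_apply, smul_eq_mul, mul_assoc, ← Finset.mul_sum]
      rw [mul_sub, mul_inv_cancel_left₀ h.ne']
      simp only [mul_sub, Finset.sum_sub_distrib, ← Finset.sum_mul]
    rw [h4, h3, sub_self, mul_zero])
  refine ⟨K, hΦ.1, hqmem, hK0, hpos, hle, htight, hconst Φ hΦ, fun Ψ hΨ => ?_⟩
  have h1 := hK Ψ hΨ.1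
  rw [hl, hout Ψ hΨ.2] at h1
  have h2 : ∑ a, Ψ a * (v a - vMin W) = ∑ a, Ψ a * v a - vMin W := by
    simp only [mul_sub, Finset.sum_sub_distrib, ← Finset.sum_mul, hΨ.2, one_mul]
  rw [h2] at h1
  refine h1.trans (mul_le_mul_of_nonneg_left ?_ hK0)
  have h3 : 0 ≤ ∑ a, Ψ a * (capacity W - relEnt (W a) q) :=
    Finset.sum_nonneg fun a _ => mul_nonneg (hΨ.1 a) (sub_nonneg.2 (hle a))
  change max ‖∑ a, Ψ a * (capacity W - relEnt (W a) q)‖ ‖outDist Ψ W - q‖ ≤ _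
  rw [Real.norm_of_nonneg h3]
  exact max_le (by linarith [norm_nonneg (outDist Ψ W - q)]) (by linarith)

end Capacity

/-! ### Elementary asymptotic estimates. -/

section Asymptotics

lemma eventually_log_succ_le : ∀ᶠ n : ℕ in atTop, Real.log (n + 1) ≤ 2 * Real.log n := by
  filter_upwards [eventually_ge_atTop 2] with n hn
  have hn' : (2 : ℝ) ≤ n := by exact_mod_cast hn
  have : 2 * Real.log n = Real.log ((n : ℝ) ^ 2) := by rw [Real.log_pow]; norm_num
  rw [this]
  exact Real.log_le_log (by positivity) (by nlinarith)

lemma exists_bound_of_isBigO_log_div {ξ : ℕ → ℝ} (hξ : ξ =O[atTop] fun n : ℕ => Real.log n / n) :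
    ∃ K : ℝ, 0 ≤ K ∧ ∀ᶠ n : ℕ in atTop, |n * ξ n| ≤ K * Real.log n := by
  obtain ⟨K, hK, hb⟩ := hξ.exists_nonneg
  refine ⟨K, hK, ?_⟩
  filter_upwards [hb.bound, eventually_gt_atTop 0, tendsto_log_nat.eventually_ge_atTop 0]
    with n h1 hn hL
  have hn' : (0 : ℝ) < n := by exact_mod_cast hn
  rw [Real.norm_eq_abs, Real.norm_eq_abs, abs_of_nonneg (a := Real.log n / n) (by positivity)] at h1
  rw [abs_mul, abs_of_pos hn']
  calc n * |ξ n| ≤ n * (K * (Real.log n / n)) := by gcongr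
    _ = K * Real.log n := by field_simp

lemma exists_bound_of_isBigO_log_div_sqrt {ζ : ℕ → ℝ}
    (hζ : ζ =O[atTop] fun n : ℕ => Real.log n / Real.sqrt n) :
    ∃ K : ℝ, 0 ≤ K ∧ ∀ᶠ n : ℕ in atTop, |ζ n| ≤ K * (Real.log n / √n) := by
  obtain ⟨K, hK, hb⟩ := hζ.exists_nonneg
  refine ⟨K, hK, ?_⟩
  filter_upwards [hb.bound, tendsto_log_nat.eventually_ge_atTop 0] with n h1 hL
  rwa [Real.norm_eq_abs, Real.norm_eq_abs, abs_of_nonneg (a := Real.log n / √n) (by positivity)]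
    at h1

lemma sqrt_mul_log_div {n : ℕ} (hn : 0 < n) (L : ℝ) : √(n : ℝ) * (L / n) = L / √n := by
  have hn' : (0 : ℝ) < n := by exact_mod_cast hn
  rw [eq_div_iff (Real.sqrt_pos.2 hn').ne']
  calc √(n : ℝ) * (L / n) * √n = L / n * (√n * √n) := by ring
    _ = L := by rw [Real.mul_self_sqrt hn'.le]; field_simp

/-- The log n/n correction is negligible against 1/√n; this keeps the rate offset in the range of
`exists_source_expansion`. -/
lemma eventually_sqrt_mul_le (a C : ℝ) : ∀ᶠ n : ℕ in atTop, ∀ τ : ℝ,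
    |τ| ≤ a / √n + C * (Real.log n / n) → √n * |τ| ≤ a + 1 := by
  have h := (tendsto_log_div_sqrt.const_mul C)
  rw [mul_zero] at h
  filter_upwards [h.eventually (gt_mem_nhds (show (0 : ℝ) < 1 by norm_num)),
    eventually_gt_atTop 0] with n h1 hn τ hτ
  have hn' : (0 : ℝ) < n := by exact_mod_cast hn
  have hs : 0 < √(n : ℝ) := Real.sqrt_pos.2 hn'
  have h2 := mul_le_mul_of_nonneg_left hτ hs.le
  rw [mul_add, mul_div_cancel₀ _ hs.ne', mul_left_comm, sqrt_mul_log_div hn] at h2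
  linarith

/-- Eventual bounds for the number `⌊ρ n⌋` of channel uses. -/
lemma eventually_floor_bounds {ρ : ℝ} (hρ : 0 < ρ) : ∀ᶠ n : ℕ in atTop,
    0 < ⌊ρ * n⌋₊ ∧ |n * ρ - (⌊ρ * n⌋₊ : ℝ)| ≤ 1 ∧ n * ρ ≤ 2 * (⌊ρ * n⌋₊ : ℝ) ∧
      (⌊ρ * n⌋₊ : ℝ) ≤ n * ρ ∧ Real.log ((⌊ρ * n⌋₊ : ℝ) + 1) ≤ 2 * Real.log n := by
  have h1 : Tendsto (fun n : ℕ => (n : ℝ) * ρ) atTop atTop :=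
    tendsto_natCast_atTop_atTop.atTop_mul_const hρ
  filter_upwards [h1.eventually_ge_atTop 2,
    (tendsto_natCast_atTop_atTop (R := ℝ)).eventually_ge_atTop (ρ + 1)] with n h2 h3
  have hle : (⌊ρ * n⌋₊ : ℝ) ≤ n * ρ := by
    rw [mul_comm (n : ℝ)]; exact Nat.floor_le (by rw [mul_comm]; linarith)
  have hlt : n * ρ < (⌊ρ * n⌋₊ : ℝ) + 1 := by rw [mul_comm (n : ℝ)]; exact Nat.lt_floor_add_one _
  have hpos : (0 : ℝ) < (⌊ρ * n⌋₊ : ℝ) := by linarith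
  refine ⟨by exact_mod_cast hpos, ?_, by linarith, hle, ?_⟩
  · rw [abs_le]; constructor <;> linarith
  · have : 2 * Real.log n = Real.log ((n : ℝ) ^ 2) := by rw [Real.log_pow]; norm_num
    rw [this]
    refine Real.log_le_log (by positivity) ?_
    nlinarith

lemma inv_succ_floor_le {ρ : ℝ} (hρ : 0 < ρ) {n : ℕ} (hn : 0 < n) :
    1 / ((⌊ρ * n⌋₊ : ℝ) + 1) ≤ 1 / ρ * (1 / √n) := by
  have hn' : (1 : ℝ) ≤ n := by exact_mod_cast hn
  have hs : 1 ≤ √(n : ℝ) := Real.one_le_sqrt.2 hn'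
  have hlt : ρ * n < (⌊ρ * n⌋₊ : ℝ) + 1 := Nat.lt_floor_add_one _
  have hsn : √(n : ℝ) ≤ n := by rw [Real.sqrt_le_left (by linarith)]; nlinarith
  calc 1 / ((⌊ρ * n⌋₊ : ℝ) + 1) ≤ 1 / (ρ * √n) := by
        refine one_div_le_one_div_of_le (by positivity) ?_
        nlinarith
    _ = _ := by field_simp

end Asymptotics

/-! ### The excess probability and its source part. -/

section Excess

variable {S T X Y : Type*} [Fintype S] [Fintype T] [Fintype X] [Fintype Y]
  [DecidableEq S] [DecidableEq X] [DecidableEq Y] {d : S → T → ℝ} {P : S → ℝ} {W : X → Y → ℝ}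
  {ρ : ℝ} {n m : ℕ}

lemma excessProb_eq_prob (f : (Fin n → S) → (Fin m → X)) (ξ D : ℝ) :
    excessProb d P W ρ f ξ D
      = prob (pairWeight (prodWeight fun _ => P) fun s => prodWeight fun j => W (f s j))
        (fun ω => rdf d (seqType ω.1) D
          > ρ * mutualInfo (seqType (f ω.1)) (condType (f ω.1) ω.2) + ξ) := by
  classical
  unfold excessProb prob
  rw [Fintype.sum_prod_type]
  refine Finset.sum_congr rfl fun s _ => Finset.sum_congr rfl fun y _ => ?_
  simp only [pairWeight, prodWeight]

lemma excessProb_anti (hd0 : ∀ s, ∃ t, d s t = 0) (hP : P ∈ stdSimplex ℝ S)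
    (hW : ∀ x, W x ∈ stdSimplex ℝ Y) (hn : 0 < n) (f : (Fin n → S) → (Fin m → X)) (ξ : ℝ)
    {D D' : ℝ} (hD : 0 ≤ D) (hDD : D ≤ D') :
    excessProb d P W ρ f ξ D' ≤ excessProb d P W ρ f ξ D := by
  rw [excessProb_eq_prob, excessProb_eq_prob]
  refine prob_mono (pairWeight_mem (prodWeight_mem fun _ => hP)
    fun s => prodWeight_mem fun j => hW _).1 fun ω _ h => ?_
  exact lt_of_lt_of_le h (rdf_anti hd0 (seqType_mem hn ω.1) hD hDD)

/-- The rate-distortion function at the type of the source, for typical source sequences. -/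
theorem exists_source_expansion (hd0 : ∀ s, ∃ t, d s t = 0) (hP : P ∈ stdSimplex ℝ S) {D₀ : ℝ}
    (hD₀ : 0 < D₀) (hpos : 0 < rdf d P D₀) (hdiff : RdfTwiceDifferentiableNear d P D₀) :
    ∃ (r : S → ℝ) (K : ℝ), 0 ≤ K ∧ ∑ s, P s * r s = 0 ∧
      ∑ s, P s * r s ^ 2 = sourceDispersion d P D₀ ∧
      ∀ M : ℝ, ∀ᶠ n : ℕ in atTop, ∀ τ : ℝ, √n * |τ| ≤ M →
        ∃ D, 0 < D ∧ rdf d P D = rdf d P D₀ + τ ∧ ∀ s : Fin n → S,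
          n * ∑ a, (seqType s a - P a) ^ 2 ≤ 4 * (Fintype.card S + 1) * Real.log (n + 1) →
          |n * (rdf d (seqType s) D - rdf d P D) - ∑ i, r (s i)| ≤ K * Real.log n := by
  obtain ⟨r, K, η, hK, hη, hr0, hr2, hexp⟩ := exists_rdf_expansion hd0 hP hD₀ hpos hdiff
  set c : ℝ := 4 * (Fintype.card S + 1) with hc
  refine ⟨r, K * (2 * c + 1), by positivity, hr0, hr2, fun M => ?_⟩
  have e1 : ∀ᶠ n : ℕ in atTop, M < η * √n := by
    have : Tendsto (fun n : ℕ => η * √(n : ℝ)) atTop atTop :=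
      (Real.tendsto_sqrt_atTop.comp tendsto_natCast_atTop_atTop).const_mul_atTop hη
    exact this.eventually_gt_atTop M
  have e2 : ∀ᶠ n : ℕ in atTop, 2 * c * (Real.log n / √n) < η := by
    have := tendsto_log_div_sqrt.const_mul (2 * c)
    rw [mul_zero] at this
    exact this.eventually (gt_mem_nhds hη)
  filter_upwards [e1, e2, eventually_log_succ_le, tendsto_log_nat.eventually_ge_atTop (M ^ 2),
    tendsto_log_nat.eventually_ge_atTop 0, eventually_gt_atTop 0] with n h1 h2 h3 h4 hL hn τ hτ
  have hn' : (0 : ℝ) < n := by exact_mod_cast hn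
  have hn1 : (1 : ℝ) ≤ n := by exact_mod_cast hn
  have hs : 0 < √(n : ℝ) := Real.sqrt_pos.2 hn'
  have hsn : √(n : ℝ) ≤ n := by
    rw [Real.sqrt_le_left hn'.le]; nlinarith
  have hτη : |τ| ≤ η := by
    by_contra hcon
    push Not at hcon
    nlinarith
  -- The quadratic error nτ² is bounded by M², which log n eventually exceeds.
  have hτ2 : n * τ ^ 2 ≤ Real.log n := by
    have : n * τ ^ 2 = (√n * |τ|) ^ 2 := by rw [mul_pow, Real.sq_sqrt hn'.le, sq_abs]
    rw [this]
    refine le_trans ?_ h4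
    exact pow_le_pow_left₀ (by positivity) hτ 2
  obtain ⟨D, hD, hRD, hQ⟩ := hexp τ hτη
  refine ⟨D, hD, hRD, fun s hs2 => ?_⟩
  have hc0 : 0 ≤ c := by positivity
  have hsum : n * ∑ a, (seqType s a - P a) ^ 2 ≤ 2 * c * Real.log n :=
    hs2.trans (by nlinarith)
  have hsum2 : ∑ a, (seqType s a - P a) ^ 2 ≤ η := by
    have : ∑ a, (seqType s a - P a) ^ 2 ≤ 2 * c * Real.log n / n := by
      rw [le_div_iff₀ hn']; linarith
    refine this.trans (le_trans ?_ h2.le)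
    rw [mul_div_assoc]
    gcongr
  have h5 := hQ _ (seqType_mem hn s) hsum2
  rw [sum_seqType_mul] at h5
  have e : n * (rdf d (seqType s) D - rdf d P D) - ∑ i, r (s i)
      = n * (rdf d (seqType s) D - rdf d P D - (∑ i, r (s i)) / n) := by
    field_simp
  rw [e, abs_mul, abs_of_pos hn']
  calc _ ≤ n * (K * (∑ a, (seqType s a - P a) ^ 2 + τ ^ 2)) := by gcongr
    _ = K * (n * ∑ a, (seqType s a - P a) ^ 2 + n * τ ^ 2) := by ring
    _ ≤ K * (2 * c * Real.log n + Real.log n) := by gcongr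
    _ = _ := by ring

end Excess

/-! ### Mutual information of joint types for inputs of a fixed type. -/

section Channel

variable {X Y : Type*} [Fintype X] [Fintype Y] {W : X → Y → ℝ} {ρ : ℝ}

lemma exists_pos_forall_le {ι : Type*} [Fintype ι] (f : ι → ℝ) :
    ∃ c : ℝ, 0 < c ∧ ∀ i, 0 < f i → c ≤ f i := by
  classical
  rcases (Finset.univ.filter fun i => 0 < f i).eq_empty_or_nonempty with h | h
  · refine ⟨1, one_pos, fun i hi => ?_⟩
    have : i ∈ Finset.univ.filter fun i => 0 < f i := by simpa using hi
    rw [h] at this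
    simp at this
  · obtain ⟨i, hi, hmin⟩ := Finset.exists_min_image _ f h
    exact ⟨f i, (Finset.mem_filter.1 hi).2, fun j hj => hmin j (by simpa using hj)⟩

lemma exists_forall_abs_le {ι : Type*} [Fintype ι] (f : ι → ℝ) : ∃ B : ℝ, 0 ≤ B ∧ ∀ i, |f i| ≤ B :=
  ⟨∑ i, |f i|, Finset.sum_nonneg fun _ _ => abs_nonneg _, fun i =>
    Finset.single_le_sum (f := fun i => |f i|) (fun _ _ => abs_nonneg _) (Finset.mem_univ i)⟩

lemma abs_log_sub_log_le {a b c : ℝ} (ha : c ≤ a) (hb : c ≤ b) (hc : 0 < c) :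
    |Real.log a - Real.log b| ≤ |a - b| / c := by
  have key : ∀ a b : ℝ, c ≤ a → c ≤ b → Real.log a - Real.log b ≤ |a - b| / c := by
    intro a b ha hb
    have hb' : 0 < b := hc.trans_le hb
    have ha' : 0 < a := hc.trans_le ha
    rw [← Real.log_div ha'.ne' hb'.ne']
    refine (Real.log_le_sub_one_of_pos (by positivity)).trans ?_
    have : a / b - 1 = (a - b) / b := by field_simp
    rw [this]
    exact (div_le_div_of_nonneg_right (le_abs_self _) hb'.le).trans
      (div_le_div_of_nonneg_left (abs_nonneg _) hc hb)
  rw [abs_le]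
  constructor
  · have := key b a hb ha
    rw [abs_sub_comm] at this
    linarith
  · exact key a b ha hb

lemma abs_outDist_sub_le (hW : ∀ a, W a ∈ stdSimplex ℝ Y) {Φ Ψ : X → ℝ} {e : ℝ}
    (h : ∀ a, |Φ a - Ψ a| ≤ e) (b : Y) :
    |outDist Φ W b - outDist Ψ W b| ≤ Fintype.card X * e := by
  unfold outDist
  rw [← Finset.sum_sub_distrib]
  refine (Finset.abs_sum_le_sum_abs _ _).trans ?_
  rw [← nsmul_eq_mul, ← Finset.card_univ]
  refine Finset.sum_le_card_nsmul _ _ _ fun a _ => ?_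
  rw [← sub_mul, abs_mul, abs_of_nonneg ((hW a).1 b)]
  exact (mul_le_of_le_one_right (abs_nonneg _) (le_one_of_mem_stdSimplex (hW a) b)).trans (h a)

/-- Comparison of the information densities under two nearby input distributions. -/
lemma exists_infoDensity_sub_le (hW : ∀ a, W a ∈ stdSimplex ℝ Y) {Φ : X → ℝ}
    (hΦ : Φ ∈ stdSimplex ℝ X) :
    ∃ K : ℝ, 0 ≤ K ∧ ∀ k : ℕ, K ≤ k → 0 < k → ∀ Ψ ∈ stdSimplex ℝ X,
      (∀ a, |Φ a - Ψ a| ≤ 1 / k) → ∀ a b, 0 < W a b → 1 / k ≤ Ψ a →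
      |infoDensity Ψ W a b - infoDensity Φ W a b|
        ≤ K / k + if Φ a = 0 then Real.log k + K else 0 := by
  obtain ⟨p, hp, hpΦ⟩ := exists_pos_forall_le fun z : X × Y => Φ z.1 * W z.1 z.2
  obtain ⟨w, hw, hwW⟩ := exists_pos_forall_le fun z : X × Y => W z.1 z.2
  obtain ⟨B, hB0, hB⟩ := exists_forall_abs_le fun z : X × Y => infoDensity Φ W z.1 z.2
  refine ⟨2 * Fintype.card X / p + |Real.log w| + B, by positivity, ?_⟩
  intro k hKk hk Ψ hΨ hclose a b hab hka
  have hk' : (0 : ℝ) < k := by exact_mod_cast hk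
  have hk1 : (1 : ℝ) ≤ k := by exact_mod_cast hk
  have hKk2 : 2 * Fintype.card X / p ≤ k := by
    linarith [abs_nonneg (Real.log w)]
  have hΨa : 0 < Ψ a := (by positivity : (0 : ℝ) < 1 / k).trans_le hka
  have hqm : Ψ a * W a b ≤ outDist Ψ W b := mul_le_outDist hΨ.1 (fun a _ => (hW a).1) a b
  have hqm0 : 0 < outDist Ψ W b := (mul_pos hΨa hab).trans_le hqm
  have hq : Φ a * W a b ≤ outDist Φ W b := mul_le_outDist hΦ.1 (fun a _ => (hW a).1) a b
  -- A letter outside the support of Φ can have a density of order log k, since its output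
  -- probabilities under Ψ may be as small as a multiple of 1/k. On the support both output laws are
  -- bounded below and the logarithm is Lipschitz.
  split_ifs with h0
  · have h1 : |infoDensity Ψ W a b| ≤ Real.log k + |Real.log w| := by
      unfold infoDensity
      have hle1 := le_one_of_mem_stdSimplex (outDist_mem hΨ fun a _ => hW a) b
      have hr1 : w ≤ W a b / outDist Ψ W b := by
        rw [le_div_iff₀ hqm0]
        nlinarith [hwW (a, b) hab]
      have hr2 : W a b / outDist Ψ W b ≤ k := by
        rw [div_le_iff₀ hqm0]
        have : 1 / (k : ℝ) * W a b ≤ outDist Ψ W b := (by gcongr : _ ≤ Ψ a * W a b).trans hqm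
        rw [one_div, inv_mul_le_iff₀ hk'] at this
        exact this
      have l1 := Real.log_le_log hw hr1
      have l2 := Real.log_le_log (hw.trans_le hr1) hr2
      have l3 := neg_abs_le (Real.log w)
      have l4 := Real.log_nonneg hk1
      rw [abs_le]
      constructor <;> linarith [abs_nonneg (Real.log w)]
    have h2 := hB (a, b)
    have h3 := abs_sub (infoDensity Ψ W a b) (infoDensity Φ W a b)
    have h4 : 0 ≤ (2 * Fintype.card X / p + |Real.log w| + B) / k := by positivity
    have h5 : 0 ≤ 2 * Fintype.card X / p := by positivity
    linarith
  · have hΦa : 0 < Φ a := (hΦ.1 a).lt_of_ne' h0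
    have hpq : p ≤ outDist Φ W b := (hpΦ (a, b) (mul_pos hΦa hab)).trans hq
    have hdiff := abs_outDist_sub_le hW hclose b
    have hsmall : Fintype.card X * (1 / (k : ℝ)) ≤ p / 2 := by
      rw [mul_one_div, div_le_iff₀ hk']
      rw [div_le_iff₀ hp] at hKk2
      linarith
    have hqm2 : p / 2 ≤ outDist Ψ W b := by
      have := (abs_le.1 hdiff).2
      linarith
    have e : infoDensity Ψ W a b - infoDensity Φ W a b
        = Real.log (outDist Φ W b) - Real.log (outDist Ψ W b) := by
      unfold infoDensity
      rw [Real.log_div hab.ne' hqm0.ne', Real.log_div hab.ne' (hp.trans_le hpq).ne']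
      ring
    rw [e, add_zero]
    refine (abs_log_sub_log_le (c := p / 2) (by linarith) hqm2 (by positivity)).trans ?_
    calc _ ≤ Fintype.card X * (1 / (k : ℝ)) / (p / 2) := by gcongr
      _ = 2 * Fintype.card X / p / k := by field_simp
      _ ≤ _ := by
        gcongr
        linarith [abs_nonneg (Real.log w)]

variable [DecidableEq X] [DecidableEq Y]

/-- The mutual information of the joint type is close to an empirical average of information
densities with respect to the actual input type. -/
lemma abs_mutualInfo_condType_sub_le (hW : ∀ a, W a ∈ stdSimplex ℝ Y) {k : ℕ} (hk : 0 < k)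
    (x : Fin k → X) (y : Fin k → Y) (hy : ∀ j, 0 < W (x j) (y j)) :
    |k * mutualInfo (seqType x) (condType x y) - ∑ j, infoDensity (seqType x) W (x j) (y j)|
      ≤ k * condDiv (seqType x) (condType x y) W := by
  have hk' : (0 : ℝ) < k := by exact_mod_cast hk
  have hx := seqType_mem hk x
  have hV : ∀ a, 0 < seqType x a → condType x y a ∈ stdSimplex ℝ Y := fun a ha =>
    condType_mem x y (exists_of_seqType_pos ha)
  have hVW : ∀ a b, 0 < seqType x a → 0 < condType x y a b → 0 < W a b := by
    intro a b _ h
    obtain ⟨j, rfl, rfl⟩ := exists_of_condType_pos h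
    exact hy j
  have hq : ∀ a b, 0 < seqType x a → 0 < condType x y a b → 0 < outDist (seqType x) W b :=
    fun a b h1 h2 => (mul_pos h1 (hVW a b h1 h2)).trans_le
      (mul_le_outDist hx.1 (fun a _ => (hW a).1) a b)
  -- With q the output law of the actual type, the error is the conditional divergence minus the
  -- output divergence, which lies between 0 and the former by data processing.
  have h1 := mutualInfo_eq_condDiv_add hx.1 (fun a ha => (hV a ha).1) hVW hq
  have h2 := relEnt_outDist_le_condDiv hx hV hW hVW
  have h3 : 0 ≤ relEnt (outDist (seqType x) (condType x y)) (outDist (seqType x) W) := by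
    refine relEnt_nonneg (outDist_mem hx hV) (outDist_mem hx fun a _ => hW a) fun b hb => ?_
    obtain ⟨a, _, ha⟩ := Finset.exists_ne_zero_of_sum_ne_zero hb.ne'
    have ha1 : 0 < seqType x a := (hx.1 a).lt_of_ne' fun h => ha (by rw [h, zero_mul])
    have ha2 : 0 < condType x y a b :=
      (condType_nonneg x y a b).lt_of_ne' fun h => ha (by rw [h, mul_zero])
    exact hq a b ha1 ha2
  have h4 := sum_seqType_mul_condType x y fun a b => Real.log (W a b / outDist (seqType x) W b)
  rw [h4] at h1
  have e : (k : ℝ) * mutualInfo (seqType x) (condType x y)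
      - ∑ j, infoDensity (seqType x) W (x j) (y j)
      = k * (condDiv (seqType x) (condType x y) W
        - relEnt (outDist (seqType x) (condType x y)) (outDist (seqType x) W)) := by
    rw [h1]
    unfold infoDensity
    field_simp
    ring
  rw [e, abs_mul, abs_of_pos hk']
  refine mul_le_mul_of_nonneg_left ?_ hk'.le
  rw [abs_of_nonneg (by linarith)]
  linarith

/-- The function `g` centered under the distribution `p`. -/
def centered (p g : Y → ℝ) (b : Y) : ℝ := g b - ∑ b', p b' * g b'

lemma sum_mul_centered {p : Y → ℝ} (hp : p ∈ stdSimplex ℝ Y) (g : Y → ℝ) :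
    ∑ b, p b * centered p g b = 0 := by
  unfold centered
  simp_rw [mul_sub]
  rw [Finset.sum_sub_distrib, ← Finset.sum_mul, hp.2, one_mul, sub_self]

lemma sum_mul_centered_sq (p g : Y → ℝ) : ∑ b, p b * centered p g b ^ 2 = distVar p g := rfl

lemma abs_sum_comp_sub_le {k : ℕ} (hk : 0 < k) {Φ : X → ℝ} {x : Fin k → X}
    (hclose : ∀ a, |Φ a - seqType x a| ≤ 1 / k) (g : X → ℝ) :
    |∑ j, g (x j) - k * ∑ a, Φ a * g a| ≤ ∑ a, |g a| := by
  have hk' : (0 : ℝ) < k := by exact_mod_cast hk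
  have h := sum_seqType_mul x g
  rw [eq_div_iff hk'.ne'] at h
  rw [← h, mul_comm, ← mul_sub, ← Finset.sum_sub_distrib, abs_mul, abs_of_pos hk']
  have h2 : |∑ a, (seqType x a * g a - Φ a * g a)| ≤ 1 / k * ∑ a, |g a| := by
    rw [Finset.mul_sum]
    refine (Finset.abs_sum_le_sum_abs _ _).trans (Finset.sum_le_sum fun a _ => ?_)
    rw [← sub_mul, abs_mul, abs_sub_comm]
    exact mul_le_mul_of_nonneg_right (hclose a) (abs_nonneg _)
  calc _ ≤ k * (1 / k * ∑ a, |g a|) := by gcongr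
    _ = _ := by field_simp

/-- The scaled mutual information of the joint type is close to a sum of independent variables, for
channel inputs of a type close to `Φ` and typical channel outputs. -/
theorem exists_channel_expansion (hW : ∀ a, W a ∈ stdSimplex ℝ Y) (hρ : 0 < ρ) {Φ : X → ℝ}
    (hΦ : Φ ∈ stdSimplex ℝ X) :
    ∃ K : ℝ, 0 ≤ K ∧ ∀ᶠ n : ℕ in atTop, ∀ x : Fin ⌊ρ * n⌋₊ → X,
      (∀ a, |Φ a - seqType x a| ≤ 1 / (⌊ρ * n⌋₊ : ℝ)) →
      (∀ y, 0 < prodWeight (fun j => W (x j)) y →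
        (⌊ρ * n⌋₊ : ℝ) * condDiv (seqType x) (condType x y) W
          ≤ (Fintype.card X * Fintype.card Y + 1) * Real.log ((⌊ρ * n⌋₊ : ℝ) + 1) →
        |n * (ρ * (mutualInfo (seqType x) (condType x y) - mutualInfo Φ W))
          - ∑ j, centered (W (x j)) (infoDensity Φ W (x j)) (y j)| ≤ K * Real.log n) ∧
      |∑ j, distVar (W (x j)) (infoDensity Φ W (x j)) - n * (ρ * condInfoVar Φ W)| ≤ K := by
  obtain ⟨K₀, hK₀, hdens⟩ := exists_infoDensity_sub_le hW hΦ
  obtain ⟨B, hB0, hB⟩ := exists_forall_abs_le fun z : X × Y =>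
    centered (W z.1) (infoDensity Φ W z.1) z.2
  set A : ℝ := Fintype.card X * Fintype.card Y + 1 with hA
  set N : ℝ := (Fintype.card X : ℝ) with hN
  set m : X → ℝ := fun a => ∑ b, W a b * infoDensity Φ W a b with hm
  set v : X → ℝ := fun a => distVar (W a) (infoDensity Φ W a) with hv
  have hN0 : 0 ≤ N := by positivity
  have hA0 : 0 ≤ A := by positivity
  have hm0 : 0 ≤ ∑ a, |m a| := Finset.sum_nonneg fun _ _ => abs_nonneg _
  have hv0 : 0 ≤ ∑ a, |v a| := Finset.sum_nonneg fun _ _ => abs_nonneg _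
  have hmΦ : ∑ a, Φ a * m a = mutualInfo Φ W := by
    simp only [hm, mutualInfo, Finset.mul_sum, mul_assoc]
  refine ⟨2 * (2 * A + K₀ + N * (2 + K₀) + ∑ a, |m a|) + B + (∑ a, |v a| + |condInfoVar Φ W|),
    by positivity, ?_⟩
  have htend : Tendsto (fun n : ℕ => (⌊ρ * n⌋₊ : ℝ)) atTop atTop :=
    tendsto_natCast_atTop_atTop.comp (tendsto_nat_floor_atTop.comp
      (tendsto_natCast_atTop_atTop.const_mul_atTop hρ))
  filter_upwards [eventually_floor_bounds hρ, tendsto_log_nat.eventually_ge_atTop 1,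
    htend.eventually_ge_atTop K₀] with n hfl hL hkK
  obtain ⟨hk, hk1, hk2, hk3, hk4⟩ := hfl
  generalize ⌊ρ * n⌋₊ = k at *
  intro x hx
  set L := Real.log n with hLdef
  have hk' : (0 : ℝ) < k := by exact_mod_cast hk
  have hk1' : (1 : ℝ) ≤ k := by exact_mod_cast hk
  have hlogk : Real.log k ≤ 2 * L := (Real.log_le_log hk' (by linarith)).trans hk4
  constructor
  · intro y hy hdiv
    have hy0 : ∀ j, 0 < W (x j) (y j) := fun j => ((hW _).1 _).lt_of_ne' fun h0 =>
      hy.ne' (Finset.prod_eq_zero (Finset.mem_univ j) h0)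
    have hseq := seqType_mem hk x
    have h1 := (abs_mutualInfo_condType_sub_le hW hk x y hy0).trans
      (hdiv.trans (mul_le_mul_of_nonneg_left hk4 hA0))
    have h2 : |∑ j, infoDensity (seqType x) W (x j) (y j) - ∑ j, infoDensity Φ W (x j) (y j)|
        ≤ K₀ + N * (2 * L + K₀) := by
      rw [← Finset.sum_sub_distrib]
      refine (Finset.abs_sum_le_sum_abs _ _).trans ?_
      have hterm : ∀ j, |infoDensity (seqType x) W (x j) (y j) - infoDensity Φ W (x j) (y j)|
          ≤ (fun a => K₀ / k + if Φ a = 0 then Real.log k + K₀ else 0) (x j) := by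
        intro j
        refine hdens k hkK hk _ hseq hx _ _ (hy0 j) ?_
        unfold seqType
        have : 0 < (Finset.univ.filter fun i => x i = x j).card :=
          Finset.card_pos.2 ⟨j, by simp⟩
        have h1 : (1 : ℝ) ≤ (Finset.univ.filter fun i => x i = x j).card := by exact_mod_cast this
        gcongr
      refine (Finset.sum_le_sum fun j _ => hterm j).trans ?_
      have h3 := sum_seqType_mul x (fun a => K₀ / k + if Φ a = 0 then Real.log k + K₀ else 0)
      rw [eq_div_iff hk'.ne'] at h3
      rw [← h3]
      simp_rw [mul_add]
      rw [Finset.sum_add_distrib, ← Finset.sum_mul, hseq.2, one_mul, add_mul,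
        div_mul_cancel₀ _ hk'.ne']
      -- Letters outside the support of Φ have frequency at most 1/k, that is, at most one
      -- occurrence each, so their large densities add only O(log n).
      have h4 : ∑ a, seqType x a * (if Φ a = 0 then Real.log k + K₀ else 0)
          ≤ N * (1 / k * (Real.log k + K₀)) := by
        rw [hN, ← nsmul_eq_mul, ← Finset.card_univ]
        refine Finset.sum_le_card_nsmul _ _ _ fun a _ => ?_
        have hlog0 := Real.log_nonneg hk1'
        split_ifs with h0
        · refine mul_le_mul_of_nonneg_right ?_ (by linarith)
          have := hx a
          rw [h0, zero_sub, abs_neg, abs_of_nonneg (hseq.1 a)] at this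
          exact this
        · rw [mul_zero]; positivity
      have h5 := mul_le_mul_of_nonneg_right h4 hk'.le
      have h6 : N * (1 / k * (Real.log k + K₀)) * k = N * (Real.log k + K₀) := by field_simp
      rw [h6] at h5
      have h7 : N * (Real.log k + K₀) ≤ N * (2 * L + K₀) := by gcongr
      linarith
    have h3 : |∑ j, m (x j) - k * mutualInfo Φ W| ≤ ∑ a, |m a| := by
      rw [← hmΦ]; exact abs_sum_comp_sub_le hk hx m
    set U := ∑ j, centered (W (x j)) (infoDensity Φ W (x j)) (y j) with hU
    have hUeq : ∑ j, infoDensity Φ W (x j) (y j) = U + ∑ j, m (x j) := by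
      rw [hU, ← Finset.sum_add_distrib]
      refine Finset.sum_congr rfl fun j _ => ?_
      simp only [centered, hm]; ring
    have hUabs : |U| ≤ k * B := by
      refine (Finset.abs_sum_le_sum_abs _ _).trans ?_
      have := Finset.sum_le_card_nsmul Finset.univ
        (fun j => |centered (W (x j)) (infoDensity Φ W (x j)) (y j)|) B
        fun j _ => hB (x j, y j)
      simpa using this
    set I := mutualInfo (seqType x) (condType x y)
    set I₀ := mutualInfo Φ W
    have h4 : |k * (I - I₀) - U| ≤ (2 * A + K₀ + N * (2 + K₀) + ∑ a, |m a|) * L := by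
      have e : k * (I - I₀) - U = (k * I - ∑ j, infoDensity (seqType x) W (x j) (y j))
          + (∑ j, infoDensity (seqType x) W (x j) (y j) - ∑ j, infoDensity Φ W (x j) (y j))
          + (∑ j, m (x j) - k * I₀) := by rw [hUeq]; ring
      rw [e]
      refine (abs_add_le _ _).trans ((add_le_add (abs_add_le _ _) le_rfl).trans ?_)
      have e1 : K₀ ≤ K₀ * L := le_mul_of_one_le_right hK₀ hL
      have e2 : N * K₀ ≤ N * K₀ * L := le_mul_of_one_le_right (by positivity) hL
      have e3 : ∑ a, |m a| ≤ (∑ a, |m a|) * L := le_mul_of_one_le_right hm0 hL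
      linarith
    -- Replacing k = ⌊ρn⌋ by nρ costs a fraction 1/k of U, and |U| ≤ kB.
    have h5 : n * (ρ * (I - I₀)) - U
        = n * ρ / k * (k * (I - I₀) - U) + (n * ρ - k) / k * U := by field_simp; ring
    rw [h5]
    refine (abs_add_le _ _).trans ?_
    rw [abs_mul, abs_mul]
    have h6 : |n * ρ / k| ≤ 2 := by
      rw [abs_of_nonneg (by positivity), div_le_iff₀ hk']; exact hk2
    have h7 : |(n * ρ - k) / k| * |U| ≤ B := by
      rw [abs_div, abs_of_pos hk', div_mul_eq_mul_div, div_le_iff₀ hk']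
      calc |n * ρ - k| * |U| ≤ 1 * (k * B) := by gcongr
        _ = B * k := by ring
    have h8 := mul_le_mul h6 h4 (abs_nonneg _) (by norm_num)
    have h9 : B ≤ B * L := le_mul_of_one_le_right hB0 hL
    have h10 : 0 ≤ (∑ a, |v a| + |condInfoVar Φ W|) * L := by positivity
    linarith
  · have h1 := abs_sum_comp_sub_le hk hx v
    have h2 : ∑ a, Φ a * v a = condInfoVar Φ W := rfl
    rw [h2] at h1
    have e : ∑ j, v (x j) - n * (ρ * condInfoVar Φ W)
        = (∑ j, v (x j) - k * condInfoVar Φ W) - (n * ρ - k) * condInfoVar Φ W := by ring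
    change |∑ j, v (x j) - n * (ρ * condInfoVar Φ W)| ≤ _
    rw [e]
    refine (abs_sub _ _).trans ?_
    rw [abs_mul]
    have h3 : |n * ρ - k| * |condInfoVar Φ W| ≤ 1 * |condInfoVar Φ W| := by gcongr
    have h4 : 0 ≤ 2 * (2 * A + K₀ + N * (2 + K₀) + ∑ a, |m a|) + B := by positivity
    linarith

end Channel

/-! ### Quantiles of the combined source and channel sum. -/

section Quantile

lemma prob_pairWeight_le {A B : Type*} [Fintype A] [Fintype B] {w : A → ℝ} {v : A → B → ℝ}
    (hw : w ∈ stdSimplex ℝ A) (E : A → B → Prop) {c : ℝ} (h : ∀ a, prob (v a) (E a) ≤ c) :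
    prob (pairWeight w v) (fun ω => E ω.1 ω.2) ≤ c := by
  rw [prob_pairWeight]
  calc _ ≤ ∑ a, w a * c := Finset.sum_le_sum fun a _ => mul_le_mul_of_nonneg_left (h a) (hw.1 a)
    _ = c := by rw [← Finset.sum_mul, hw.2, one_mul]

lemma distVar_nonneg {A : Type*} [Fintype A] {p : A → ℝ} (hp : p ∈ stdSimplex ℝ A) (g : A → ℝ) :
    0 ≤ distVar p g := Finset.sum_nonneg fun a _ => mul_nonneg (hp.1 a) (sq_nonneg _)

/-- Quantiles of a sum of two groups of independent variables, the first one identically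
distributed. -/
theorem exists_quantile_pair {A B : Type*} [Fintype A] [Fintype B] {P r : A → ℝ}
    (hP : P ∈ stdSimplex ℝ A) (hr0 : ∑ a, P a * r a = 0) {V b K₁ K₂ ε : ℝ} (hV : 0 ≤ V)
    (hb : 0 ≤ b) (hK₁ : 0 ≤ K₁) (hK₂ : 0 ≤ K₂) (hε0 : 0 < ε) (hε1 : ε < 1) :
    ∃ K' : ℝ, 0 ≤ K' ∧ ∀ᶠ n : ℕ in atTop, ∀ (k : ℕ) (q u : Fin k → B → ℝ),
      (∀ j, q j ∈ stdSimplex ℝ B) → (∀ j a, |u j a| ≤ b) → (∀ j, ∑ a, q j a * u j a = 0) →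
      |∑ j, ∑ a, q j a * u j a ^ 2 - n * V| ≤ K₁ → ∀ C, K' ≤ C →
      prob (pairWeight (prodWeight fun _ : Fin n => P) fun _ => prodWeight q) (fun ω =>
          √(n * (∑ a, P a * r a ^ 2 + V)) * gaussQInv ε + C * Real.log n
            < ∑ i, r (ω.1 i) + ∑ j, u j (ω.2 j)) ≤ ε - K₂ * (Real.log n / √n) ∧
      ε + K₂ * (Real.log n / √n) ≤
        prob (pairWeight (prodWeight fun _ : Fin n => P) fun _ => prodWeight q) (fun ω =>
          √(n * (∑ a, P a * r a ^ 2 + V)) * gaussQInv ε - C * Real.log n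
            < ∑ i, r (ω.1 i) + ∑ j, u j (ω.2 j)) := by
  obtain ⟨b', hb'0, hb'⟩ := exists_forall_abs_le r
  have hVS : 0 ≤ ∑ a, P a * r a ^ 2 :=
    Finset.sum_nonneg fun a _ => mul_nonneg (hP.1 a) (sq_nonneg _)
  obtain ⟨K', hK', hev⟩ := exists_quantile_bound (b := max b b') (add_nonneg hVS hV)
    (hb.trans (le_max_left _ _)) hK₁ hK₂ hε0 hε1
  refine ⟨K', hK', ?_⟩
  filter_upwards [hev] with n hn k q u hq hu hu0 hvar C hC
  have hmem : pairWeight (prodWeight fun _ : Fin n => P) (fun _ => prodWeight q)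
      ∈ stdSimplex ℝ ((Fin n → A) × (Fin k → B)) :=
    pairWeight_mem (prodWeight_mem fun _ => hP) fun _ => prodWeight_mem hq
  obtain ⟨hBE, hCh⟩ := berryEsseen_prob (p := fun _ : Fin n => P) (q := q)
    (r := fun _ => r) (u := u) (b := max b b') (fun _ => hP) hq
    (fun _ a => (hb' a).trans (le_max_right _ _)) (fun j a => (hu j a).trans (le_max_left _ _))
    (fun _ => hr0) hu0 rfl
  have hnot : ∀ z, prob (pairWeight (prodWeight fun _ : Fin n => P) fun _ => prodWeight q)
      (fun ω => z < ∑ i, r (ω.1 i) + ∑ j, u j (ω.2 j))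
      = 1 - prob (pairWeight (prodWeight fun _ : Fin n => P) fun _ => prodWeight q)
      (fun ω => ∑ i, r (ω.1 i) + ∑ j, u j (ω.2 j) ≤ z) := by
    intro z
    rw [← prob_not hmem]
    exact prob_congr fun ω => not_le.symm
  rw [hnot, hnot]
  refine hn _ (fun z => prob (pairWeight (prodWeight fun _ : Fin n => P) fun _ => prodWeight q)
    (fun ω => ∑ i, r (ω.1 i) + ∑ j, u j (ω.2 j) ≤ z)) ?_ hBE (fun t ht => ?_) C hC ?_
  · refine le_trans (le_of_eq ?_) hvar
    congr 1
    rw [Finset.sum_const, Finset.card_univ, Fintype.card_fin, nsmul_eq_mul]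
    ring
  · constructor
    · refine le_trans (prob_mono hmem.1 fun ω _ h => ?_) (hCh t ht)
      exact (le_neg_of_le_neg h).trans (neg_le_abs _)
    · rw [← prob_not hmem]
      refine le_trans (prob_mono hmem.1 fun ω _ h => ?_) (hCh t ht)
      exact (not_le.1 h).le.trans (le_abs_self _)
  · exact fun z z' hz => prob_mono hmem.1 fun ω _ h => h.trans hz

end Quantile

/-! ### The distortion threshold for inputs of a fixed type. -/

section Threshold

variable {S T X Y : Type*} [Fintype S] [Fintype T] [Fintype X] [Fintype Y]
  [DecidableEq S] [DecidableEq X] [DecidableEq Y] {d : S → T → ℝ} {P : S → ℝ} {W : X → Y → ℝ}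
  {ρ : ℝ} {n m : ℕ}

/-- The excess probability is nonincreasing, so a level where it is above δ is a lower bound of all
admissible levels. -/
lemma le_of_isDistortionThreshold (hd0 : ∀ s, ∃ t, d s t = 0) (hP : P ∈ stdSimplex ℝ S)
    (hW : ∀ x, W x ∈ stdSimplex ℝ Y) (hn : 0 < n) {f : (Fin n → S) → (Fin m → X)}
    {ξ δ D₀ D : ℝ} (hD₀ : IsDistortionThreshold d P W ρ f ξ δ D₀)
    (h : δ < excessProb d P W ρ f ξ D) : D ≤ D₀ := by
  refine hD₀.2 fun D' hD' => ?_
  by_contra hlt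
  have := excessProb_anti (ρ := ρ) hd0 hP hW hn f ξ hD'.1.le (not_le.1 hlt).le
  exact absurd hD'.2 (not_le.2 (h.trans_le this))

lemma exists_isDistortionThreshold {f : (Fin n → S) → (Fin m → X)} {ξ δ D : ℝ} (hD : 0 < D)
    (h : excessProb d P W ρ f ξ D ≤ δ) :
    ∃ D₀, IsDistortionThreshold d P W ρ f ξ δ D₀ ∧ 0 ≤ D₀ ∧ D₀ ≤ D := by
  have hbdd : BddBelow {D : ℝ | 0 < D ∧ excessProb d P W ρ f ξ D ≤ δ} :=
    ⟨0, fun D hD => hD.1.le⟩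
  refine ⟨_, isGLB_csInf ⟨D, hD, h⟩ hbdd, le_csInf ⟨D, hD, h⟩ fun D hD => hD.1.le,
    csInf_le hbdd ⟨hD, h⟩⟩

lemma mul_sqrt_div {V : ℝ} (hn : 0 < n) : n * √(V / n) = √(n * V) := by
  have hn' : (0 : ℝ) < n := by exact_mod_cast hn
  have e : (n : ℝ) * V = n ^ 2 * (V / n) := by field_simp
  rw [e, Real.sqrt_mul (by positivity), Real.sqrt_sq hn'.le]

lemma sqrt_div_eq {V : ℝ} (hV : 0 ≤ V) (q C : ℝ) :
    |(-(√(V / n) * q) + C * (Real.log n / n))|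
      ≤ (√V * |q|) / √n + |C| * (Real.log n / n) := by
  refine (abs_add_le _ _).trans (le_of_eq ?_)
  rw [abs_neg, abs_mul, abs_mul, abs_of_nonneg (Real.sqrt_nonneg _),
    abs_of_nonneg (a := Real.log n / n) (div_nonneg (Real.log_natCast_nonneg n) n.cast_nonneg),
    Real.sqrt_div hV]
  ring

/-- Bounds the total probability of an atypical source type or conditional output type. -/
lemma eventually_one_div_add_le (hρ : 0 < ρ) : ∀ᶠ n : ℕ in atTop,
    1 / ((n : ℝ) + 1) + 1 / ((⌊ρ * n⌋₊ : ℝ) + 1) ≤ (1 + 1 / ρ) * (Real.log n / √n) := by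
  filter_upwards [eventually_gt_atTop 0, tendsto_log_nat.eventually_ge_atTop 1] with n hn hL
  have h1 := inv_succ_floor_le hρ hn
  have h2 := inv_succ_floor_le one_pos hn
  rw [one_mul, Nat.floor_natCast] at h2
  have h3 : 1 / √(n : ℝ) ≤ Real.log n / √n := by gcongr
  have h4 := mul_le_mul_of_nonneg_left h3 (show 0 ≤ 1 + 1 / ρ by positivity)
  linarith

/-- The threshold distortion for channel inputs of a fixed type. -/
theorem exists_threshold_of_type (hd0 : ∀ s, ∃ t, d s t = 0) (hP : P ∈ stdSimplex ℝ S)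
    (hW : ∀ x, W x ∈ stdSimplex ℝ Y) (hρ : 0 < ρ) {ε : ℝ} (hε0 : 0 < ε) (hε1 : ε < 1)
    {ξ ζ : ℕ → ℝ} (hξ : ξ =O[atTop] fun n : ℕ => Real.log n / n)
    (hζ : ζ =O[atTop] fun n : ℕ => Real.log n / Real.sqrt n) {Φ : X → ℝ}
    (hΦ : Φ ∈ stdSimplex ℝ X) (hI : 0 < mutualInfo Φ W) {D₀ : ℝ} (hD₀ : 0 < D₀)
    (hrdf : rdf d P D₀ = ρ * mutualInfo Φ W) (hdiff : RdfTwiceDifferentiableNear d P D₀) :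
    ∃ K : ℝ, ∀ᶠ n : ℕ in atTop, ∀ x : Fin ⌊ρ * n⌋₊ → X,
      (∀ a, |Φ a - seqType x a| ≤ 1 / (⌊ρ * n⌋₊ : ℝ)) →
      ∃ Dn : ℝ, IsDistortionThreshold d P W ρ (fun _ : Fin n → S => x) (ξ n) (ε + ζ n) Dn ∧
        |rdf d P Dn - (ρ * mutualInfo Φ W -
          √((sourceDispersion d P D₀ + ρ * condInfoVar Φ W) / n) * gaussQInv ε)|
          ≤ K * (Real.log n / n) := by
  obtain ⟨r, Ks, hKs, hr0, hr2, hsrc⟩ := exists_source_expansion hd0 hP hD₀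
    (by rw [hrdf]; positivity) hdiff
  obtain ⟨Kc, hKc, hch⟩ := exists_channel_expansion hW hρ hΦ
  obtain ⟨Kξ, hKξ, hξb⟩ := exists_bound_of_isBigO_log_div hξ
  obtain ⟨Kζ, hKζ, hζb⟩ := exists_bound_of_isBigO_log_div_sqrt hζ
  obtain ⟨b, hb, hub⟩ := exists_forall_abs_le fun z : X × Y =>
    centered (W z.1) (infoDensity Φ W z.1) z.2
  have hVc : 0 ≤ ρ * condInfoVar Φ W := mul_nonneg hρ.le
    (Finset.sum_nonneg fun a _ => mul_nonneg (hΦ.1 a) (distVar_nonneg (hW a) _))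
  -- The probability margin covers ζ, the atypical events, and a unit of slack for the strict
  -- inequality.
  obtain ⟨K', hK', hq⟩ := exists_quantile_pair (B := Y) (K₂ := Kζ + (1 + 1 / ρ) + 1) hP hr0 hVc hb
    hKc (by positivity) hε0 hε1
  rw [hr2] at hq
  have hV : 0 ≤ sourceDispersion d P D₀ + ρ * condInfoVar Φ W :=
    add_nonneg (distVar_nonneg hP _) hVc
  generalize sourceDispersion d P D₀ + ρ * condInfoVar Φ W = V at *
  obtain ⟨C, hC⟩ : ∃ C, C = K' + (Ks + Kc + Kξ) := ⟨_, rfl⟩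
  have hC0 : 0 ≤ C := by rw [hC]; positivity
  refine ⟨C, ?_⟩
  filter_upwards [hsrc (√V * |gaussQInv ε| + 1), hch, hξb, hζb, hq,
    eventually_sqrt_mul_le (√V * |gaussQInv ε|) C, eventually_one_div_add_le hρ,
    eventually_gt_atTop 0, tendsto_log_nat.eventually_ge_atTop 1]
    with n hsrc hch hξ hζ hq hτ hbad hn hL x hx
  obtain ⟨hch1, hch2⟩ := hch x hx
  clear hch
  have hn' : (0 : ℝ) < n := by exact_mod_cast hn
  -- `Dl` has the lower rate, hence small excess probability; `Du` below has the higher rate. They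
  -- bracket the threshold. C is the quantile constant plus all O(log n) errors of the sum.
  obtain ⟨Dl, hDl, hRl, hsl⟩ := hsrc (-(√(V / n) * gaussQInv ε) + -C * (Real.log n / n))
    (hτ _ (by simpa [abs_of_nonneg hC0] using sqrt_div_eq (n := n) hV (gaussQInv ε) (-C)))
  obtain ⟨Du, hDu, hRu, hsu⟩ := hsrc (-(√(V / n) * gaussQInv ε) + C * (Real.log n / n))
    (hτ _ (by simpa [abs_of_nonneg hC0] using sqrt_div_eq (n := n) hV (gaussQInv ε) C))
  have hs2 := mul_sqrt_div (V := V) hn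
  generalize hk : ⌊ρ * n⌋₊ = k at *
  generalize hE : (Fintype.card S : ℝ) = cS at *
  -- The channel densities enter with a minus sign: excess means that the source sum exceeds the
  -- channel sum by more than -nτ.
  obtain ⟨hq1, hq2⟩ := hq k (fun j => W (x j))
    (fun j b => -centered (W (x j)) (infoDensity Φ W (x j)) b) (fun j => hW _)
    (fun j a => by rw [abs_neg]; exact hub (x j, a))
    (fun j => by
      simp_rw [mul_neg]
      rw [Finset.sum_neg_distrib, sum_mul_centered (hW _), neg_zero])
    (by simpa only [neg_sq, sum_mul_centered_sq] using hch2) K' le_rfl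
  have hw : pairWeight (prodWeight fun _ : Fin n => P) (fun _ => prodWeight fun j => W (x j))
      ∈ stdSimplex ℝ ((Fin n → S) × (Fin k → Y)) :=
    pairWeight_mem (prodWeight_mem fun _ => hP) fun _ => prodWeight_mem fun j => hW _
  have hbad1 : prob (pairWeight (prodWeight fun _ : Fin n => P)
      (fun _ => prodWeight fun j => W (x j))) (fun ω =>
        4 * (cS + 1) * Real.log (n + 1) < n * ∑ a, (seqType ω.1 a - P a) ^ 2) ≤ 1 / (n + 1) := by
    rw [← hE, prob_pairWeight_fst _ (fun _ => prodWeight_mem fun j => hW _) fun s : Fin n → S =>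
      4 * ((Fintype.card S : ℝ) + 1) * Real.log (n + 1) < n * ∑ a, (seqType s a - P a) ^ 2]
    exact prob_seqType_sq_gt_le hP hn
  have hbad2 : prob (pairWeight (prodWeight fun _ : Fin n => P)
      (fun _ => prodWeight fun j => W (x j))) (fun ω =>
        (Fintype.card X * Fintype.card Y + 1) * Real.log (k + 1)
          < k * condDiv (seqType x) (condType x ω.2) W) ≤ 1 / (k + 1) :=
    prob_pairWeight_le (prodWeight_mem fun _ => hP) (fun _ y =>
        (Fintype.card X * Fintype.card Y + 1) * Real.log (k + 1)
          < k * condDiv (seqType x) (condType x y) W) fun _ => prob_condDiv_gt_log_le hW x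
  generalize hw' : pairWeight (prodWeight fun _ : Fin n => P)
    (fun _ => prodWeight fun j => W (x j)) = w at *
  have hbadp := prob_or_le hw.1 (fun ω =>
        4 * (cS + 1) * Real.log (n + 1) < n * ∑ a, (seqType ω.1 a - P a) ^ 2) (fun ω =>
        (Fintype.card X * Fintype.card Y + 1) * Real.log (k + 1)
          < k * condDiv (seqType x) (condType x ω.2) W)
  -- the comparison of the excess event with an event for a sum of independent variables
  have key : ∀ ω, 0 < w ω → ¬ (4 * (cS + 1) * Real.log (n + 1)
        < n * ∑ a, (seqType ω.1 a - P a) ^ 2 ∨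
        (Fintype.card X * Fintype.card Y + 1) * Real.log (k + 1)
          < k * condDiv (seqType x) (condType x ω.2) W) →
      ∀ D τ, rdf d P D = rdf d P D₀ + τ →
      |n * (rdf d (seqType ω.1) D - rdf d P D) - ∑ i, r (ω.1 i)| ≤ Ks * Real.log n →
      |n * (rdf d (seqType ω.1) D - (ρ * mutualInfo (seqType x) (condType x ω.2) + ξ n))
        - (n * τ + (∑ i, r (ω.1 i) + ∑ j, -centered (W (x j)) (infoDensity Φ W (x j)) (ω.2 j)))|
        ≤ (Ks + Kc + Kξ) * Real.log n := by
    intro ω hω hgood D τ hD hs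
    have hy : 0 < prodWeight (fun j => W (x j)) ω.2 := by
      rw [← hw'] at hω
      refine ((prodWeight_mem fun j => hW (x j)).1 ω.2).lt_of_ne' fun h0 => hω.ne' ?_
      change _ * prodWeight (fun j => W (x j)) ω.2 = 0
      rw [h0, mul_zero]
    have hc := hch1 ω.2 hy (not_lt.1 fun h => hgood (Or.inr h))
    rw [Finset.sum_neg_distrib]
    rw [abs_le] at *
    rw [hrdf] at hD
    have e : n * (rdf d (seqType ω.1) D - rdf d P D)
      = n * rdf d (seqType ω.1) D - n * (ρ * mutualInfo Φ W) - n * τ := by rw [hD]; ring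
    rw [e] at hs
    constructor <;> linarith [hs.1, hs.2, hc.1, hc.2, hξ.1, hξ.2]
  have hζ1 := abs_le.1 hζ
  have hnl : n * (Real.log n / n) = Real.log n := by field_simp
  have hLs : 0 < Real.log n / √n := div_pos (by linarith) (Real.sqrt_pos.2 hn')
  -- the good event at the larger distortion
  have hl : excessProb d P W ρ (fun _ : Fin n → S => x) (ξ n) Dl ≤ ε + ζ n := by
    rw [excessProb_eq_prob, hw']
    have h0 := prob_le_add (E := fun ω => rdf d (seqType ω.1) Dl
          > ρ * mutualInfo (seqType x) (condType x ω.2) + ξ n)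
      (F := fun ω => √(n * V) * gaussQInv ε + K' * Real.log n
      < ∑ i, r (ω.1 i) + ∑ j, -centered (W (x j)) (infoDensity Φ W (x j)) (ω.2 j))
      (G := fun ω => 4 * (cS + 1) * Real.log (n + 1) < n * ∑ a, (seqType ω.1 a - P a) ^ 2 ∨
        (Fintype.card X * Fintype.card Y + 1) * Real.log (k + 1)
          < k * condDiv (seqType x) (condType x ω.2) W) hw.1 fun ω hω hex => by
      by_cases hgood : 4 * (cS + 1) * Real.log (n + 1) < n * ∑ a, (seqType ω.1 a - P a) ^ 2 ∨
        (Fintype.card X * Fintype.card Y + 1) * Real.log (k + 1)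
          < k * condDiv (seqType x) (condType x ω.2) W
      · exact Or.inr hgood
      left
      have h1 := key ω hω hgood Dl _ hRl (hsl _ (not_lt.1 fun h => hgood (Or.inl h)))
      have h2 : 0 < n * (rdf d (seqType ω.1) Dl
        - (ρ * mutualInfo (seqType x) (condType x ω.2) + ξ n)) := mul_pos hn' (sub_pos.2 hex)
      have h3 := (abs_le.1 h1).2
      have h4 : n * (-(√(V / n) * gaussQInv ε) + -C * (Real.log n / n))
          = -(√(n * V) * gaussQInv ε) - C * Real.log n := by
        rw [← hs2]; linear_combination -C * hnl
      rw [h4, hC] at h3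
      linarith
    linarith
  have hu : ε + ζ n < excessProb d P W ρ (fun _ : Fin n → S => x) (ξ n) Du := by
    rw [excessProb_eq_prob, hw']
    have h0 := prob_le_add (E := fun ω => √(n * V) * gaussQInv ε - K' * Real.log n
      < ∑ i, r (ω.1 i) + ∑ j, -centered (W (x j)) (infoDensity Φ W (x j)) (ω.2 j))
      (F := fun ω => rdf d (seqType ω.1) Du
          > ρ * mutualInfo (seqType x) (condType x ω.2) + ξ n)
      (G := fun ω => 4 * (cS + 1) * Real.log (n + 1) < n * ∑ a, (seqType ω.1 a - P a) ^ 2 ∨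
        (Fintype.card X * Fintype.card Y + 1) * Real.log (k + 1)
          < k * condDiv (seqType x) (condType x ω.2) W) hw.1 fun ω hω hex => by
      by_cases hgood : 4 * (cS + 1) * Real.log (n + 1) < n * ∑ a, (seqType ω.1 a - P a) ^ 2 ∨
        (Fintype.card X * Fintype.card Y + 1) * Real.log (k + 1)
          < k * condDiv (seqType x) (condType x ω.2) W
      · exact Or.inr hgood
      left
      have h1 := key ω hω hgood Du _ hRu (hsu _ (not_lt.1 fun h => hgood (Or.inl h)))
      have h3 := (abs_le.1 h1).1
      have h4 : n * (-(√(V / n) * gaussQInv ε) + C * (Real.log n / n))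
          = -(√(n * V) * gaussQInv ε) + C * Real.log n := by
        rw [← hs2]; linear_combination C * hnl
      rw [h4, hC] at h3
      have h2 : 0 < n * (rdf d (seqType ω.1) Du
        - (ρ * mutualInfo (seqType x) (condType x ω.2) + ξ n)) := by linarith
      exact sub_pos.1 (pos_of_mul_pos_right h2 hn'.le)
    linarith
  obtain ⟨Dn, hDn, hDn0, hDnl⟩ := exists_isDistortionThreshold hDl hl
  have hDnu := le_of_isDistortionThreshold hd0 hP hW hn hDn hu
  refine ⟨Dn, hDn, ?_⟩
  have h1 := rdf_anti hd0 hP hDn0 hDnl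
  have h2 := rdf_anti hd0 hP hDu.le hDnu
  rw [hRl, hrdf] at h1
  rw [hRu, hrdf] at h2
  rw [abs_le]
  constructor <;> linarith

end Threshold

/-! ### Mutual information of joint types for arbitrary inputs. -/

section Output

variable {X Y : Type*} [Fintype X] [Fintype Y] [DecidableEq X] [DecidableEq Y] {W : X → Y → ℝ}

/-- An upper bound for the mutual information of the joint type by a sum of independent variables,
which penalizes input types that are far from capacity achieving. -/
lemma exists_mutualInfo_condType_le (hW : ∀ a, W a ∈ stdSimplex ℝ Y) {q : Y → ℝ} {C : ℝ}
    (hq : q ∈ stdSimplex ℝ Y) (hWq : ∀ a b, 0 < W a b → 0 < q b)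
    (hC : ∀ a, relEnt (W a) q ≤ C) :
    ∃ c : ℝ, 0 < c ∧ ∀ (k : ℕ), 0 < k → ∀ (x : Fin k → X) (y : Fin k → Y),
      (∀ j, 0 < W (x j) (y j)) →
      k * mutualInfo (seqType x) (condType x y) ≤ k * C
        + ∑ j, centered (W (x j)) (fun b => Real.log (W (x j) b / q b)) (y j)
        - c * (k * (∑ a, seqType x a * (C - relEnt (W a) q) + ‖outDist (seqType x) W - q‖) ^ 2)
        + 2 * (k * condDiv (seqType x) (condType x y) W) := by
  obtain ⟨G, hG0, hG⟩ := exists_forall_abs_le fun a => C - relEnt (W a) q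
  refine ⟨1 / (2 * G + 16), by positivity, fun k hk x y hy => ?_⟩
  have hk' : (0 : ℝ) < k := by exact_mod_cast hk
  have hx := seqType_mem hk x
  have hV : ∀ a, 0 < seqType x a → condType x y a ∈ stdSimplex ℝ Y := fun a ha =>
    condType_mem x y (exists_of_seqType_pos ha)
  have hVW : ∀ a b, 0 < seqType x a → 0 < condType x y a b → 0 < W a b := by
    intro a b _ h
    obtain ⟨j, rfl, rfl⟩ := exists_of_condType_pos h
    exact hy j
  have hpos : ∀ b, 0 < outDist (seqType x) (condType x y) b →
      ∃ a, 0 < seqType x a ∧ 0 < condType x y a b := by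
    intro b hb
    obtain ⟨a, _, ha⟩ := Finset.exists_ne_zero_of_sum_ne_zero hb.ne'
    exact ⟨a, (hx.1 a).lt_of_ne' fun h => ha (by rw [h, zero_mul]),
      (condType_nonneg x y a b).lt_of_ne' fun h => ha (by rw [h, mul_zero])⟩
  have h1 := mutualInfo_eq_condDiv_add hx.1 (fun a ha => (hV a ha).1) hVW
    fun a b h h' => hWq a b (hVW a b h h')
  have h2 := relEnt_outDist_le_condDiv hx hV hW hVW
  have h3 := sum_sq_sub_le_relEnt (outDist_mem hx hV) (outDist_mem hx fun a _ => hW a)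
    fun b hb => by
      obtain ⟨a, ha, hab⟩ := hpos b hb
      exact (mul_pos ha (hVW a b ha hab)).trans_le
        (mul_le_outDist hx.1 (fun a _ => (hW a).1) a b)
  have h4 := sum_sq_sub_le_relEnt (outDist_mem hx hV) hq fun b hb => by
      obtain ⟨a, ha, hab⟩ := hpos b hb
      exact hWq a b (hVW a b ha hab)
  have h5 := sum_seqType_mul_condType x y fun a b => Real.log (W a b / q b)
  have h6 := sum_seqType_mul x fun a => C - relEnt (W a) q
  have h7 : ∑ j, Real.log (W (x j) (y j) / q (y j))
      = k * C + ∑ j, centered (W (x j)) (fun b => Real.log (W (x j) b / q b)) (y j)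
        - ∑ j, (C - relEnt (W (x j)) q) := by
    have : (k : ℝ) * C = ∑ _j : Fin k, C := by simp
    rw [this, ← Finset.sum_add_distrib, ← Finset.sum_sub_distrib]
    refine Finset.sum_congr rfl fun j _ => ?_
    simp only [centered, relEnt]; ring
  -- The output type lies between the two laws: its distance to P_xW is controlled by the
  -- conditional divergence, its distance to q by the output divergence. Thus a large ‖P_xW - q‖
  -- forces one of these divergences to be large.
  have hδ : ‖outDist (seqType x) W - q‖ ^ 2
      ≤ 8 * condDiv (seqType x) (condType x y) W
        + 8 * relEnt (outDist (seqType x) (condType x y)) q := by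
    have e1 : ‖outDist (seqType x) W - q‖ ^ 2 ≤ ∑ b, (outDist (seqType x) W b - q b) ^ 2 := by
      rw [← Real.le_sqrt (norm_nonneg _) (Finset.sum_nonneg fun _ _ => sq_nonneg _),
        pi_norm_le_iff_of_nonneg (Real.sqrt_nonneg _)]
      intro b
      rw [Real.norm_eq_abs]
      refine Real.abs_le_sqrt ?_
      exact Finset.single_le_sum (f := fun b => (outDist (seqType x) W b - q b) ^ 2)
        (fun _ _ => sq_nonneg _) (Finset.mem_univ b)
    have e2 : ∑ b, (outDist (seqType x) W b - q b) ^ 2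
        ≤ 2 * ∑ b, (outDist (seqType x) (condType x y) b - outDist (seqType x) W b) ^ 2
          + 2 * ∑ b, (outDist (seqType x) (condType x y) b - q b) ^ 2 := by
      rw [Finset.mul_sum, Finset.mul_sum, ← Finset.sum_add_distrib]
      refine Finset.sum_le_sum fun b _ => ?_
      nlinarith [sq_nonneg (outDist (seqType x) W b - q b
        + 2 * (outDist (seqType x) (condType x y) b - outDist (seqType x) W b)
        - 2 * (outDist (seqType x) (condType x y) b - outDist (seqType x) W b)),
        sq_nonneg ((outDist (seqType x) (condType x y) b - outDist (seqType x) W b)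
          + (outDist (seqType x) (condType x y) b - q b))]
    linarith
  have hγ0 : 0 ≤ ∑ a, seqType x a * (C - relEnt (W a) q) :=
    Finset.sum_nonneg fun a _ => mul_nonneg (hx.1 a) (sub_nonneg.2 (hC a))
  have hγG : ∑ a, seqType x a * (C - relEnt (W a) q) ≤ G := by
    calc _ ≤ ∑ a, seqType x a * G := Finset.sum_le_sum fun a _ =>
          mul_le_mul_of_nonneg_left ((le_abs_self _).trans (hG a)) (hx.1 a)
      _ = G := by rw [← Finset.sum_mul, hx.2, one_mul]
  rw [h5] at h1
  rw [eq_div_iff hk'.ne'] at h6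
  rw [← h6] at h7
  generalize ∑ a, seqType x a * (C - relEnt (W a) q) = γ at *
  generalize ‖outDist (seqType x) W - q‖ = δ at *
  generalize relEnt (outDist (seqType x) (condType x y)) q = R at *
  generalize condDiv (seqType x) (condType x y) W = H at *
  generalize ∑ j, centered (W (x j)) (fun b => Real.log (W (x j) b / q b)) (y j) = U at *
  have e : (k : ℝ) * mutualInfo (seqType x) (condType x y)
      = k * H + (k * C + U - γ * k) - k * R := by
    rw [h1, h7]; field_simp
  -- From (γ + δ)² ≤ 2γ² + 2δ² and γ² ≤ Gγ: the linear divergence deficit also pays for its square,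
  -- as it is bounded by G.
  have hη : 1 / (2 * G + 16) * (γ + δ) ^ 2 ≤ γ + δ ^ 2 / 8 := by
    rw [one_div, inv_mul_le_iff₀ (by positivity)]
    have p1 : γ ^ 2 ≤ G * γ := by nlinarith
    have p2 : 0 ≤ G * δ ^ 2 := by positivity
    nlinarith [sq_nonneg (γ - δ)]
  have hR : γ + δ ^ 2 / 8 ≤ γ + H + R := by linarith
  have := mul_le_mul_of_nonneg_left (hη.trans hR) hk'.le
  rw [e]
  linarith

end Output

/-! ### Arbitrary inputs against i.i.d. letters from a fixed law. -/

section Comparison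

/-- Comparison of Gaussian probabilities with different variances, where the deviation `η` of the
variance is compensated by a quadratic gain. -/
lemma exists_gaussCdf_le {V c K M : ℝ} (hV : 0 < V) (hc : 0 < c) (hM : 0 ≤ M) :
    ∃ K' : ℝ, 0 ≤ K' ∧ ∀ k L η v T : ℝ, 0 < k → 0 ≤ L → 0 ≤ η → |v - k * V| ≤ K * (k * η) →
      |T| ≤ M * √(k * L) → k * V / 2 ≤ v →
      gaussCdf ((T - K' * L) / √(k * V)) ≤ gaussCdf ((T + c * (k * η ^ 2)) / √v) := by
  obtain ⟨w, hw, hwV⟩ : ∃ w, 0 < w ∧ w ^ 2 = V := ⟨√V, Real.sqrt_pos.2 hV, Real.sq_sqrt hV.le⟩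
  -- The constant comes from (2cw²·hη - MKl)² ≥ 0, where h, l, w, b are the square roots of k, L, V,
  -- v: the cross term T(b - hw) is split into the quadratic gain and a multiple of L.
  refine ⟨M ^ 2 * K ^ 2 / (2 * c * w ^ 4), by positivity, ?_⟩
  intro k L η v T hk hL hη hv hT hv2
  obtain ⟨h, hh, rfl⟩ : ∃ h, 0 < h ∧ h ^ 2 = k := ⟨√k, Real.sqrt_pos.2 hk, Real.sq_sqrt hk.le⟩
  obtain ⟨l, hl, rfl⟩ : ∃ l, 0 ≤ l ∧ l ^ 2 = L := ⟨√L, Real.sqrt_nonneg _, Real.sq_sqrt hL⟩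
  have hv0 : 0 < v := lt_of_lt_of_le (by positivity) hv2
  obtain ⟨b, hb, rfl⟩ : ∃ b, 0 < b ∧ b ^ 2 = v := ⟨√v, Real.sqrt_pos.2 hv0, Real.sq_sqrt hv0.le⟩
  subst hwV
  rw [← mul_pow, Real.sqrt_sq (by positivity)] at hT
  rw [← mul_pow] at hv hv2
  rw [← mul_pow h w]
  rw [Real.sqrt_sq hb.le, Real.sqrt_sq (by positivity)]
  apply gaussCdf_mono
  have ha : 0 < h * w := by positivity
  have hba : h * w / 2 ≤ b := by
    by_contra hcon
    have := pow_lt_pow_left₀ (not_le.1 hcon) hb.le two_ne_zero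
    nlinarith
  have hdiff : |b - h * w| * (h * w) ≤ K * (h ^ 2 * η) := by
    have e : b ^ 2 - (h * w) ^ 2 = (b - h * w) * (b + h * w) := by ring
    rw [e, abs_mul, abs_of_pos (a := b + h * w) (by positivity)] at hv
    refine le_trans (mul_le_mul_of_nonneg_left ?_ (abs_nonneg _)) hv
    linarith
  have hdiff2 : |b - h * w| * w ≤ K * (h * η) := by
    refine le_of_mul_le_mul_left ?_ hh
    calc h * (|b - h * w| * w) = |b - h * w| * (h * w) := by ring
      _ ≤ K * (h ^ 2 * η) := hdiff
      _ = _ := by ring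
  have hTb : T * (b - h * w) * w ≤ M * (h * l) * (K * (h * η)) := by
    calc T * (b - h * w) * w ≤ |T * (b - h * w)| * w := by gcongr; exact le_abs_self _
      _ = |T| * (|b - h * w| * w) := by rw [abs_mul]; ring
      _ ≤ _ := by gcongr
  have hsq : 4 * c * w ^ 2 * (M * K * (h * η) * l)
      ≤ 4 * c ^ 2 * w ^ 4 * (h * η) ^ 2 + M ^ 2 * K ^ 2 * l ^ 2 := by
    nlinarith [sq_nonneg (2 * c * w ^ 2 * (h * η) - M * K * l)]
  have hmain : M * K * (h * η) * l
      ≤ c * w ^ 2 * (h * η) ^ 2 + M ^ 2 * K ^ 2 / (2 * c * w ^ 4) * l ^ 2 * w ^ 2 / 2 := by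
    refine le_of_mul_le_mul_left (hsq.trans (le_of_eq ?_)) (show 0 < 4 * c * w ^ 2 by positivity)
    field_simp
    ring
  have hfin : T * (b - h * w) ≤ c * (h ^ 2 * η ^ 2) * (h * w)
      + M ^ 2 * K ^ 2 / (2 * c * w ^ 4) * l ^ 2 * (h * w / 2) := by
    refine le_of_mul_le_mul_right ?_ hw
    refine hTb.trans ?_
    calc M * (h * l) * (K * (h * η)) = h * (M * K * (h * η) * l) := by ring
      _ ≤ h * _ := mul_le_mul_of_nonneg_left hmain hh.le
      _ = _ := by ring
  rw [div_le_div_iff₀ ha hb]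
  have h9 : M ^ 2 * K ^ 2 / (2 * c * w ^ 4) * l ^ 2 * (h * w / 2)
      ≤ M ^ 2 * K ^ 2 / (2 * c * w ^ 4) * l ^ 2 * b := by gcongr
  linarith

/-- Berry–Esseen theorem and Chebyshev's inequality for one group of independent variables. -/
lemma berryEsseen_prob_single {B κ : Type*} [Fintype B] [Fintype κ] [DecidableEq κ]
    {q u : κ → B → ℝ} {b v : ℝ} (hq : ∀ j, q j ∈ stdSimplex ℝ B) (hu : ∀ j a, |u j a| ≤ b)
    (hu0 : ∀ j, ∑ a, q j a * u j a = 0) (hvar : ∑ j, ∑ a, q j a * u j a ^ 2 = v) :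
    (0 < v → ∀ z, |prob (prodWeight q) (fun y => ∑ j, u j (y j) ≤ z) - gaussCdf (z / √v)|
      ≤ 20 * (b / √v)) ∧
    ∀ t, 0 < t → prob (prodWeight q) (fun y => t ≤ |∑ j, u j (y j)|) ≤ v / t ^ 2 := by
  have h := berryEsseen_prob (ι := Fin 0) (A := Unit) (p := fun _ _ => 1) (q := q)
    (r := fun _ _ => 0) (u := u) (b := b) (v := v) (fun i => i.elim0) hq (fun i => i.elim0) hu
    (fun i => i.elim0) hu0 (by simpa using hvar)
  simp only [Finset.univ_eq_empty, Finset.sum_empty, zero_add] at h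
  have key : ∀ E : (κ → B) → Prop, prob (pairWeight (prodWeight fun (_ : Fin 0) (_ : Unit) =>
      (1 : ℝ)) fun _ => prodWeight q) (fun ω => E ω.2) = prob (prodWeight q) E := by
    intro E
    rw [prob_pairWeight]
    simp [prodWeight]
  refine ⟨fun hv z => ?_, fun t ht => ?_⟩
  · rw [← key]; exact h.1 hv z
  · rw [← key]; exact h.2 t ht

variable {X Y : Type*} [Fintype X] [Fintype Y] [DecidableEq X] [DecidableEq Y] {W : X → Y → ℝ}

/-- Among all channel inputs, those drawn from a fixed distribution minimize the probability of
small information, up to lower order terms. -/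
lemma exists_prob_le_prob_add (hW : ∀ a, W a ∈ stdSimplex ℝ Y) {Φ : X → ℝ}
    (hΦ : Φ ∈ stdSimplex ℝ X) {u : X → Y → ℝ} (hu0 : ∀ a, ∑ b, W a b * u a b = 0) {V c K M : ℝ}
    (hV : 0 < V) (hVu : ∑ a, Φ a * ∑ b, W a b * u a b ^ 2 = V) (hc : 0 < c) (hK : 0 ≤ K)
    (hM : 0 ≤ M) :
    ∃ K' θ : ℝ, 0 ≤ K' ∧ 0 < θ ∧ ∀ k : ℕ, 0 < k → ∀ (x : Fin k → X) (η L T : ℝ),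
      0 ≤ η → |∑ j, ∑ b, W (x j) b * u (x j) b ^ 2 - k * V| ≤ K * (k * η) →
      0 ≤ L → L ≤ θ * k → |T| ≤ M * √(k * L) →
      prob (prodWeight fun _ : Fin k => pairWeight Φ W)
          (fun z => ∑ j, u (z j).1 (z j).2 ≤ T - K' * L)
        ≤ prob (prodWeight fun j => W (x j)) (fun y => ∑ j, u (x j) (y j) ≤ T + c * (k * η ^ 2))
          + K' * (1 / √k) := by
  obtain ⟨b, hb0, hb⟩ := exists_forall_abs_le fun z : X × Y => u z.1 z.2
  obtain ⟨K₁, hK₁, hcmp⟩ := exists_gaussCdf_le (K := K) hV hc hM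
  -- If the variance is below kV/2, then η ≥ V/(2(K + 1)) and the gain ckη² is at least 2ek. The
  -- choice of θ ensures |T| ≤ ek. The 60 below is 20 for the i.i.d. letters plus 2·20 for x, whose
  -- standard deviation is at least half of √(kV).
  obtain ⟨e, he, heq⟩ : ∃ e : ℝ, 0 < e ∧ e = c * (V / (2 * (K + 1))) ^ 2 / 2 :=
    ⟨_, by positivity, rfl⟩
  refine ⟨K₁ + 60 * (b / √V) + V / e ^ 2, (e / (M + 1)) ^ 2, by positivity, by positivity, ?_⟩
  intro k hk x η L T hη hv hL hLθ hT
  have hk' : (0 : ℝ) < k := by exact_mod_cast hk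
  have hk1 : (1 : ℝ) ≤ k := by exact_mod_cast hk
  have hsk : 0 < √(k : ℝ) := Real.sqrt_pos.2 hk'
  have hwI := prodWeight_mem (ι := Fin k) fun _ => pairWeight_mem hΦ hW
  have hwx := prodWeight_mem fun j => hW (x j)
  have hmean : ∑ z, pairWeight Φ W z * u z.1 z.2 = 0 := by
    rw [Fintype.sum_prod_type]
    simp_rw [pairWeight, mul_assoc, ← Finset.mul_sum, hu0]
    simp
  have hvarI : ∑ z, pairWeight Φ W z * u z.1 z.2 ^ 2 = V := by
    rw [Fintype.sum_prod_type, ← hVu]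
    simp_rw [pairWeight, mul_assoc, ← Finset.mul_sum]
  obtain ⟨hI, -⟩ := berryEsseen_prob_single (κ := Fin k) (q := fun _ => pairWeight Φ W)
    (u := fun _ z => u z.1 z.2) (b := b) (v := k * V) (fun _ => pairWeight_mem hΦ hW)
    (fun _ z => hb z) (fun _ => hmean) (by simp [hvarI])
  obtain ⟨hX1, hX2⟩ := berryEsseen_prob_single (q := fun j => W (x j)) (u := fun j => u (x j))
    (b := b) (fun j => hW _) (fun j a => hb (x j, a)) (fun j => hu0 _) rfl
  have hI := (abs_le.1 (hI (by positivity) (T - (K₁ + 60 * (b / √V) + V / e ^ 2) * L))).2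
  generalize ∑ j, ∑ b, W (x j) b * u (x j) b ^ 2 = v at *
  have hbV : 0 ≤ b / √V := by positivity
  have hVe : 0 ≤ V / e ^ 2 := by positivity
  have hbk : b / √(k * V) = b / √V * (1 / √k) := by
    rw [Real.sqrt_mul hk'.le]; field_simp
  -- With substantial variance both sides are Gaussian up to O(1/√k). Otherwise the gain is linear
  -- in k, and by Chebyshev's inequality the event on the right has probability 1 - O(1/k).
  rcases le_or_gt (k * V / 2) v with hcase | hcase
  · have hv0 : 0 < v := lt_of_lt_of_le (by positivity) hcase
    have h1 := (abs_le.1 (hX1 hv0 (T + c * (k * η ^ 2)))).1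
    have h2 := hcmp k L η v T hk' hL hη hv hT hcase
    have h3 : gaussCdf ((T - (K₁ + 60 * (b / √V) + V / e ^ 2) * L) / √(k * V))
        ≤ gaussCdf ((T - K₁ * L) / √(k * V)) := by
      refine gaussCdf_mono (div_le_div_of_nonneg_right ?_ (Real.sqrt_nonneg _))
      have : 0 ≤ (60 * (b / √V) + V / e ^ 2) * L := by positivity
      linarith
    have h4 : b / √v ≤ 2 * (b / √(k * V)) := by
      have : √(k * V) / 2 ≤ √v := by
        refine Real.le_sqrt_of_sq_le ?_
        rw [div_pow, Real.sq_sqrt (by positivity)]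
        linarith
      calc b / √v ≤ b / (√(k * V) / 2) := by gcongr
        _ = _ := by field_simp
    rw [hbk] at h4 hI
    have h5 : 0 ≤ (K₁ + V / e ^ 2) * (1 / √k) := by positivity
    linarith
  · have hη2 : V / (2 * (K + 1)) ≤ η := by
      rw [div_le_iff₀ (by positivity)]
      have h1 := (abs_le.1 hv).1
      have h2 : k * V ≤ k * (η * (2 * (K + 1))) := by nlinarith [mul_nonneg hk'.le hη]
      exact le_of_mul_le_mul_left h2 hk'
    have hgain : 2 * e * k ≤ c * (k * η ^ 2) := by
      have : (V / (2 * (K + 1))) ^ 2 ≤ η ^ 2 := by gcongr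
      calc 2 * e * k = c * (k * (V / (2 * (K + 1))) ^ 2) := by rw [heq]; ring
        _ ≤ _ := by gcongr
    have hTk : |T| ≤ e * k := by
      have h1 : √(k * L) ≤ e / (M + 1) * k := by
        rw [Real.sqrt_le_left (by positivity), mul_pow]
        calc k * L ≤ k * ((e / (M + 1)) ^ 2 * k) := by gcongr
          _ = _ := by ring
      calc |T| ≤ M * (e / (M + 1) * k) := hT.trans (by gcongr)
        _ = M / (M + 1) * (e * k) := by field_simp
        _ ≤ 1 * (e * k) := by
          gcongr
          rw [div_le_one (by positivity)]; linarith
        _ = e * k := one_mul _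
    have hlow : 1 - prob (prodWeight fun j => W (x j)) (fun y => e * k ≤ |∑ j, u (x j) (y j)|)
        ≤ prob (prodWeight fun j => W (x j))
          (fun y => ∑ j, u (x j) (y j) ≤ T + c * (k * η ^ 2)) := by
      rw [← prob_not hwx]
      refine prob_mono hwx.1 fun y _ h => ?_
      have h1 := (le_abs_self _).trans (not_le.1 h).le
      have h2 := (abs_le.1 hTk).1
      linarith
    have h1 := hX2 (e * k) (by positivity)
    have h2 := prob_le_one hwI fun z => ∑ j, u (z j).1 (z j).2
      ≤ T - (K₁ + 60 * (b / √V) + V / e ^ 2) * L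
    have h3 : v / (e * k) ^ 2 ≤ V / e ^ 2 * (1 / √k) := by
      have hsk2 : √(k : ℝ) ≤ k := by rw [Real.sqrt_le_left hk'.le]; nlinarith
      calc v / (e * k) ^ 2 ≤ k * V / (e * k) ^ 2 := by
            gcongr
            have : 0 < k * V := by positivity
            linarith
        _ = V / e ^ 2 * (1 / k) := by field_simp
        _ ≤ _ := by gcongr
    have h5 : 0 ≤ (K₁ + 60 * (b / √V)) * (1 / √k) := by positivity
    linarith

end Comparison

/-! ### The converse for inputs depending on the source. -/

section Converse

variable {S T X Y : Type*} [Fintype S] [Fintype T] [Fintype X] [Fintype Y]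
  [DecidableEq S] [DecidableEq X] [DecidableEq Y] {d : S → T → ℝ} {P : S → ℝ} {W : X → Y → ℝ}
  {ρ : ℝ}

/-- For divergence-typical outputs the divergence term of `exists_mutualInfo_condType_le` is O(log
n), and the mutual information is bounded, so that passing from ⌊ρn⌋ to nρ costs O(1). -/
lemma exists_scaled_mutualInfo_le (hW : ∀ a, W a ∈ stdSimplex ℝ Y) (hρ : 0 < ρ) {q : Y → ℝ} {C : ℝ}
    (hq : q ∈ stdSimplex ℝ Y) (hWq : ∀ a b, 0 < W a b → 0 < q b)
    (hC0 : 0 ≤ C) (hC : ∀ a, relEnt (W a) q ≤ C) :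
    ∃ c K : ℝ, 0 < c ∧ 0 ≤ K ∧ ∀ᶠ n : ℕ in atTop, ∀ (x : Fin ⌊ρ * n⌋₊ → X) (y : Fin ⌊ρ * n⌋₊ → Y),
      0 < prodWeight (fun j => W (x j)) y →
      (⌊ρ * n⌋₊ : ℝ) * condDiv (seqType x) (condType x y) W
          ≤ (Fintype.card X * Fintype.card Y + 1) * Real.log ((⌊ρ * n⌋₊ : ℝ) + 1) →
      n * (ρ * mutualInfo (seqType x) (condType x y)) ≤ n * (ρ * C)
        + ∑ j, centered (W (x j)) (fun b => Real.log (W (x j) b / q b)) (y j)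
        - c * ((⌊ρ * n⌋₊ : ℝ) *
          (∑ a, seqType x a * (C - relEnt (W a) q) + ‖outDist (seqType x) W - q‖) ^ 2)
        + K * Real.log n := by
  obtain ⟨c, hc, hI⟩ := exists_mutualInfo_condType_le hW hq hWq hC
  obtain ⟨b, hb0, hb⟩ := exists_forall_abs_le fun z : X × Y =>
    centered (W z.1) (fun b => Real.log (W z.1 b / q b)) z.2
  obtain ⟨A, hA⟩ : ∃ A : ℝ, A = Fintype.card X * Fintype.card Y + 1 := ⟨_, rfl⟩
  have hA0 : 0 ≤ A := by rw [hA]; positivity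
  refine ⟨c, 6 * A + C + b, hc, by positivity, ?_⟩
  filter_upwards [eventually_floor_bounds hρ, tendsto_log_nat.eventually_ge_atTop 1] with n hfl hL
  obtain ⟨hk, hk1, -, hk3, hk4⟩ := hfl
  generalize ⌊ρ * n⌋₊ = k at *
  intro x y hy hdiv
  have hk' : (0 : ℝ) < k := by exact_mod_cast hk
  have hy0 : ∀ j, 0 < W (x j) (y j) := fun j => ((hW _).1 _).lt_of_ne' fun h0 =>
    hy.ne' (Finset.prod_eq_zero (Finset.mem_univ j) h0)
  have hx := seqType_mem hk x
  have h0 : 0 ≤ mutualInfo (seqType x) (condType x y) := mutualInfo_nonneg hx fun a ha =>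
    condType_mem x y (exists_of_seqType_pos ha)
  have h1 := hI k hk x y hy0
  have hU : |∑ j, centered (W (x j)) (fun b => Real.log (W (x j) b / q b)) (y j)| ≤ k * b := by
    refine (Finset.abs_sum_le_sum_abs _ _).trans ?_
    have := Finset.sum_le_card_nsmul Finset.univ
      (fun j => |centered (W (x j)) (fun b => Real.log (W (x j) b / q b)) (y j)|) b
      fun j _ => hb (x j, y j)
    simpa using this
  rw [← hA] at hdiv
  have hη : 0 ≤ c * (k * (∑ a, seqType x a * (C - relEnt (W a) q)
      + ‖outDist (seqType x) W - q‖) ^ 2) := by positivity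
  generalize mutualInfo (seqType x) (condType x y) = I at *
  generalize ∑ j, centered (W (x j)) (fun b => Real.log (W (x j) b / q b)) (y j) = U at *
  generalize condDiv (seqType x) (condType x y) W = H at *
  generalize c * (k * (∑ a, seqType x a * (C - relEnt (W a) q)
      + ‖outDist (seqType x) W - q‖) ^ 2) = E at *
  have hlogk : Real.log (k + 1) ≤ k := by
    have := Real.log_le_sub_one_of_pos (show (0 : ℝ) < k + 1 by positivity)
    linarith
  have h2 : A * Real.log (k + 1) ≤ A * k := mul_le_mul_of_nonneg_left hlogk hA0
  have h3 : A * Real.log (k + 1) ≤ A * (2 * Real.log n) := mul_le_mul_of_nonneg_left hk4 hA0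
  have hIle : I ≤ C + b + 2 * A := by
    refine le_of_mul_le_mul_left ?_ hk'
    linarith [(abs_le.1 hU).2]
  have h4 : (n * ρ - k) * I ≤ 1 * I := mul_le_mul_of_nonneg_right ((le_abs_self _).trans hk1) h0
  have h5 : C + b + 2 * A ≤ (C + b + 2 * A) * Real.log n :=
    le_mul_of_one_le_right (by positivity) hL
  have h6 : k * C ≤ n * ρ * C := mul_le_mul_of_nonneg_right hk3 hC0
  linarith

/-- Cauchy–Schwarz after subtracting the zero mean. For typical sources it gives O(√(n log n)), the
range of T in which the comparison of inputs is valid. -/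
lemma abs_sum_le_of_seqType_sq_le {n : ℕ} (hn : 0 < n) {r : S → ℝ} (hr0 : ∑ a, P a * r a = 0)
    {s : Fin n → S} {t : ℝ} (h : n * ∑ a, (seqType s a - P a) ^ 2 ≤ t) :
    |∑ i, r (s i)| ≤ √(∑ a, r a ^ 2) * √(n * t) := by
  have hn' : (0 : ℝ) < n := by exact_mod_cast hn
  have h1 := sum_seqType_mul s r
  rw [eq_div_iff hn'.ne'] at h1
  have h2 : ∑ i, r (s i) = n * ∑ a, (seqType s a - P a) * r a := by
    simp_rw [sub_mul]
    rw [Finset.sum_sub_distrib, hr0, sub_zero, ← h1, mul_comm]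
  rw [← Real.sqrt_mul (Finset.sum_nonneg fun _ _ => sq_nonneg _)]
  refine Real.abs_le_sqrt ?_
  rw [h2, mul_pow]
  calc n ^ 2 * (∑ a, (seqType s a - P a) * r a) ^ 2
      ≤ n ^ 2 * ((∑ a, (seqType s a - P a) ^ 2) * ∑ a, r a ^ 2) := by
        gcongr
        exact Finset.sum_mul_sq_le_sq_mul_sq _ _ _
    _ = (∑ a, r a ^ 2) * (n * (n * ∑ a, (seqType s a - P a) ^ 2)) := by ring
    _ ≤ _ := by gcongr

/-- Averages a comparison made conditionally on the source word: the channel law v may depend on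
that word, its competitor v' does not. Exceptional source words cost at most their probability. -/
lemma le_prob_pairWeight {A B B' : Type*} [Fintype A] [Fintype B] [Fintype B'] {w : A → ℝ}
    {v : A → B → ℝ} {v' : B' → ℝ} (hw : w ∈ stdSimplex ℝ A) (hv : ∀ a, v a ∈ stdSimplex ℝ B)
    (hv' : v' ∈ stdSimplex ℝ B') {E : A × B → Prop} {F : A × B' → Prop} {G : A → Prop} {c : ℝ}
    (hc : 0 ≤ c)
    (h : ∀ a, ¬ G a → prob v' (fun b => F (a, b)) ≤ prob (v a) (fun b => E (a, b)) + c) :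
    prob (pairWeight w fun _ => v') F ≤ prob (pairWeight w v) E + (prob w G + c) := by
  classical
  rw [prob_pairWeight, prob_pairWeight]
  have hcw : c = ∑ a, w a * c := by rw [← Finset.sum_mul, hw.2, one_mul]
  rw [hcw, prob, ← Finset.sum_add_distrib, ← Finset.sum_add_distrib]
  refine Finset.sum_le_sum fun a _ => ?_
  have hwa := hw.1 a
  by_cases hG : G a
  · rw [if_pos hG]
    have h1 := mul_le_mul_of_nonneg_left (prob_le_one hv' fun b => F (a, b)) hwa
    have h2 := mul_nonneg hwa (prob_nonneg (hv a).1 fun b => E (a, b))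
    have h3 := mul_nonneg hwa hc
    linarith
  · rw [if_neg hG]
    have h1 := mul_le_mul_of_nonneg_left (h a hG) hwa
    linarith

/-- The converse bound for the threshold distortion, for arbitrary channel inputs. -/
theorem exists_threshold_le (hd0 : ∀ s, ∃ t, d s t = 0) (hP : P ∈ stdSimplex ℝ S)
    (hW : ∀ x, W x ∈ stdSimplex ℝ Y) (hρ : 0 < ρ) {ε : ℝ} (hε0 : 0 < ε) (hε1 : ε < 1)
    {ξ ζ : ℕ → ℝ} (hξ : ξ =O[atTop] fun n : ℕ => Real.log n / n)
    (hζ : ζ =O[atTop] fun n : ℕ => Real.log n / Real.sqrt n) {D₀ : ℝ} (hD₀ : 0 < D₀)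
    (hrdf : rdf d P D₀ = ρ * capacity W) (hdiff : RdfTwiceDifferentiableNear d P D₀)
    (hVV : vMin W = vMax W) (hV : 0 < vMin W) :
    ∃ K : ℝ, ∀ᶠ n : ℕ in atTop, ∀ (f : (Fin n → S) → (Fin ⌊ρ * n⌋₊ → X)) (Dn : ℝ),
      IsDistortionThreshold d P W ρ f (ξ n) (ε + ζ n) Dn →
      rdf d P Dn ≤ ρ * capacity W -
        √(jsccDispersion d P W ρ D₀ / n) * gaussQInv ε + K * (Real.log n / n) := by
  obtain ⟨hC, Φ, q, Kv, hΦ, hq, hKv, hWq, hrel, -, hvar, hvdiff⟩ := exists_capacity_output hW hVV hV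
  obtain ⟨r, Ks, hKs, hr0, hr2, hsrc⟩ := exists_source_expansion hd0 hP hD₀
    (by rw [hrdf]; positivity) hdiff
  obtain ⟨c, Kc, hc, hKc, hch⟩ := exists_scaled_mutualInfo_le hW hρ hq hWq hC.le hrel
  obtain ⟨Kξ, hKξ, hξb⟩ := exists_bound_of_isBigO_log_div hξ
  obtain ⟨Kζ, hKζ, hζb⟩ := exists_bound_of_isBigO_log_div_sqrt hζ
  obtain ⟨u, hu⟩ : ∃ u : X → Y → ℝ, u = fun a => centered (W a) fun b => Real.log (W a b / q b) :=
    ⟨_, rfl⟩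
  have hu0 : ∀ a, ∑ b, W a b * u a b = 0 := fun a => by rw [hu]; exact sum_mul_centered (hW a) _
  have huv : ∀ a, ∑ b, W a b * u a b ^ 2 = distVar (W a) fun b => Real.log (W a b / q b) :=
    fun a => by rw [hu]; rfl
  have hcu : ∀ a b, centered (W a) (fun b => Real.log (W a b / q b)) b = u a b :=
    fun a b => by rw [hu]
  simp_rw [hcu] at hch
  simp_rw [← huv] at hvar hvdiff
  obtain ⟨b, hb, hub⟩ := exists_forall_abs_le fun z : X × Y => u z.1 z.2
  obtain ⟨K₃, hK₃⟩ : ∃ K₃, K₃ = Ks + Kξ + Kc + 1 := ⟨_, rfl⟩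
  have hK₃0 : 0 ≤ K₃ := by rw [hK₃]; positivity
  have hVJ : 0 ≤ sourceDispersion d P D₀ + ρ * vMin W :=
    add_nonneg (distVar_nonneg hP _) (by positivity)
  obtain ⟨M₀, hM₀⟩ : ∃ M₀, M₀ = √(sourceDispersion d P D₀ + ρ * vMin W) * |gaussQInv ε| + 1 :=
    ⟨_, rfl⟩
  obtain ⟨M₁, hM₁⟩ : ∃ M₁, M₁ = √(∑ a, r a ^ 2) * √(8 * (Fintype.card S + 1)) := ⟨_, rfl⟩
  have hM₀0 : 0 ≤ M₀ := by rw [hM₀]; positivity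
  have hM₁0 : 0 ≤ M₁ := by rw [hM₁]; positivity
  obtain ⟨Kd, θ, hKd, hθ, hcmp⟩ := exists_prob_le_prob_add (c := c) (K := Kv)
    (M := (M₀ + M₁ + K₃) * √(2 / ρ)) hW hΦ hu0 hV hvar hc hKv (by positivity)
  -- The competitor consists of i.i.d. input-output pairs. Its variance k V_min differs from nρ
  -- V_min by at most V_min, whence K₁; K₂ also contains the comparison error of order 1/√k.
  obtain ⟨K', hK', hqt⟩ := exists_quantile_pair (B := X × Y) (V := ρ * vMin W) (b := b)
    (K₁ := vMin W) (K₂ := Kζ + (1 + 1 / ρ) + Kd * √(2 / ρ) + 1) hP hr0 (by positivity) hb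
    hV.le (by positivity) hε0 hε1
  rw [hr2] at hqt
  obtain ⟨C, hCdef⟩ : ∃ C, C = K' + (K₃ + Kd) := ⟨_, rfl⟩
  have hC0 : 0 ≤ C := by rw [hCdef]; positivity
  refine ⟨C, ?_⟩
  have hlogn : ∀ᶠ n : ℕ in atTop, Real.log n ≤ θ * ρ / 2 * n := by
    have h1 : (fun n : ℕ => Real.log (n : ℝ)) =o[atTop] fun n : ℕ => (n : ℝ) :=
      Real.isLittleO_log_id_atTop.comp_tendsto tendsto_natCast_atTop_atTop
    filter_upwards [h1.bound (show 0 < θ * ρ / 2 by positivity),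
      tendsto_log_nat.eventually_ge_atTop 0] with n hn hL
    simpa [abs_of_nonneg hL] using hn
  have hlogn1 : ∀ᶠ n : ℕ in atTop, Real.log n ≤ n := Eventually.of_forall fun n =>
    (Real.log_le_self n.cast_nonneg)
  filter_upwards [hsrc M₀, hch, hξb, hζb, hqt, eventually_floor_bounds hρ, hlogn, hlogn1,
    eventually_sqrt_mul_le (√(sourceDispersion d P D₀ + ρ * vMin W) * |gaussQInv ε|) C,
    eventually_one_div_add_le hρ, eventually_gt_atTop 0, tendsto_log_nat.eventually_ge_atTop 1,
    eventually_log_succ_le]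
    with n hsrc hch hξ hζ hqt hfl hlogn hlogn1 hτ hbad hn hL hsucc
  intro f Dn hDn
  obtain ⟨hk, hk1, hk2, -, -⟩ := hfl
  have hn' : (0 : ℝ) < n := by exact_mod_cast hn
  have hτ0 := sqrt_div_eq (n := n) hVJ (gaussQInv ε) C
  rw [abs_of_nonneg hC0] at hτ0
  have hτ1 := hτ _ hτ0
  rw [← hM₀] at hτ1
  obtain ⟨D, hD, hRD, hsD⟩ := hsrc _ hτ1
  have hnτ : n * (-(√((sourceDispersion d P D₀ + ρ * vMin W) / n) * gaussQInv ε)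
      + C * (Real.log n / n))
      = -(√(n * (sourceDispersion d P D₀ + ρ * vMin W)) * gaussQInv ε) + C * Real.log n := by
    have hnl : n * (Real.log n / n) = Real.log n := by field_simp
    rw [← mul_sqrt_div hn]
    linear_combination C * hnl
  clear hsrc hτ
  change rdf d P Dn ≤ ρ * capacity W -
    √((sourceDispersion d P D₀ + ρ * vMin W) / n) * gaussQInv ε + C * (Real.log n / n)
  have hgoal : ρ * capacity W -
    √((sourceDispersion d P D₀ + ρ * vMin W) / n) * gaussQInv ε + C * (Real.log n / n)
      = rdf d P D := by rw [hRD, hrdf]; ring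
  rw [hgoal]
  -- It suffices that at D, whose rate is the claimed bound, the excess probability is still above ε
  -- + ζ_n.
  refine rdf_anti hd0 hP hD.le (le_of_isDistortionThreshold hd0 hP hW hn hDn ?_)
  generalize -(√((sourceDispersion d P D₀ + ρ * vMin W) / n) * gaussQInv ε)
      + C * (Real.log n / n) = τ at *
  generalize sourceDispersion d P D₀ + ρ * vMin W = VJ at *
  generalize ⌊ρ * n⌋₊ = k at *
  generalize Real.log (n : ℝ) = L at *
  have hk' : (0 : ℝ) < k := by exact_mod_cast hk
  have hnk : n ≤ 2 / ρ * k := by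
    rw [div_mul_eq_mul_div, le_div_iff₀ hρ]; exact hk2
  have hfl1 : |k * vMin W - n * (ρ * vMin W)| ≤ vMin W := by
    have e : k * vMin W - n * (ρ * vMin W) = -((n * ρ - k) * vMin W) := by ring
    rw [e, abs_neg, abs_mul, abs_of_pos hV]
    exact mul_le_of_le_one_left hV.le hk1
  obtain ⟨-, hq2⟩ := hqt k (fun _ => pairWeight Φ W) (fun _ z => -u z.1 z.2)
    (fun _ => pairWeight_mem hΦ hW) (fun _ z => by rw [abs_neg]; exact hub z) (fun _ => by
      simp_rw [Fintype.sum_prod_type, pairWeight, mul_neg, mul_assoc, Finset.sum_neg_distrib,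
        ← Finset.mul_sum, hu0]
      simp) (by
      simp_rw [Fintype.sum_prod_type, pairWeight, neg_sq, mul_assoc, ← Finset.mul_sum, hvar]
      simpa using hfl1) K' le_rfl
  have hcS : (0 : ℝ) ≤ 4 * (Fintype.card S + 1) := by positivity
  have hL0 : 0 ≤ L := by linarith
  have hsnL : √(n * L) ≤ √(2 / ρ) * √(k * L) := by
    rw [← Real.sqrt_mul (by positivity), ← mul_assoc]
    gcongr
  rw [excessProb_eq_prob]
  have hwx : ∀ s, (prodWeight fun j => W (f s j)) ∈ stdSimplex ℝ (Fin k → Y) :=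
    fun s => prodWeight_mem fun j => hW _
  have hmix := le_prob_pairWeight (w := prodWeight fun _ : Fin n => P)
    (v := fun s => prodWeight fun j => W (f s j)) (v' := prodWeight fun _ : Fin k => pairWeight Φ W)
    (E := fun ω => rdf d (seqType ω.1) D
      > ρ * mutualInfo (seqType (f ω.1)) (condType (f ω.1) ω.2) + ξ n)
    (F := fun ω => √(n * VJ) * gaussQInv ε - K' * L
      < ∑ i, r (ω.1 i) + ∑ j, -u (ω.2 j).1 (ω.2 j).2)
    (G := fun s => 4 * (Fintype.card S + 1) * Real.log (n + 1)
      < n * ∑ a, (seqType s a - P a) ^ 2) (c := Kd * (1 / √k) + 1 / (k + 1))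
    (prodWeight_mem fun _ => hP) hwx (prodWeight_mem fun _ => pairWeight_mem hΦ hW)
    (by positivity) fun s hs => by
      rw [not_lt] at hs
      have hsrc := (abs_le.1 (hsD s hs)).1
      obtain ⟨R, hR⟩ : ∃ R, R = ∑ i, r (s i) := ⟨_, rfl⟩
      have hRabs : |R| ≤ M₁ * √(n * L) := by
        rw [hR, hM₁, mul_assoc, ← Real.sqrt_mul (by positivity)]
        refine (abs_sum_le_of_seqType_sq_le hn hr0
          (hs.trans (mul_le_mul_of_nonneg_left hsucc hcS))).trans (le_of_eq ?_)
        congr 2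
        ring
      obtain ⟨η, hη⟩ : ∃ η, η = ∑ a, seqType (f s) a * (capacity W - relEnt (W a) q)
          + ‖outDist (seqType (f s)) W - q‖ := ⟨_, rfl⟩
      have hx := seqType_mem hk (f s)
      have hη0 : 0 ≤ η := by
        rw [hη]
        exact add_nonneg (Finset.sum_nonneg fun a _ => mul_nonneg (hx.1 a)
          (sub_nonneg.2 (hrel a))) (norm_nonneg _)
      have hv : |∑ j, ∑ b, W (f s j) b * u (f s j) b ^ 2 - k * vMin W| ≤ Kv * (k * η) := by
        have h1 := hvdiff _ hx
        have h2 := sum_seqType_mul (f s) fun a => ∑ b, W a b * u a b ^ 2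
        rw [eq_div_iff hk'.ne'] at h2
        rw [← h2, mul_comm (k : ℝ) (vMin W), ← sub_mul, abs_mul, abs_of_pos hk', ← mul_assoc,
          mul_right_comm, hη]
        exact mul_le_mul_of_nonneg_right h1 hk'.le
      -- Given the source word, this is the level that the channel sum must not exceed for an
      -- excess, without the quadratic penalty; K₃ collects the logarithmic errors.
      have hT : |n * τ + R - K₃ * L| ≤ (M₀ + M₁ + K₃) * √(2 / ρ) * √(k * L) := by
        have h1 : |n * τ| ≤ M₀ * √(n * L) := by
          have e : |n * τ| = √n * (√n * |τ|) := by
            rw [abs_mul, abs_of_pos hn', ← mul_assoc, Real.mul_self_sqrt hn'.le]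
          rw [e, mul_comm M₀]
          refine mul_le_mul (Real.sqrt_le_sqrt ?_) hτ1 (by positivity) (Real.sqrt_nonneg _)
          exact le_mul_of_one_le_right hn'.le hL
        have h2 : L ≤ √(n * L) := by
          refine Real.le_sqrt_of_sq_le ?_
          rw [sq]
          exact mul_le_mul_of_nonneg_right hlogn1 hL0
        have h3 : |n * τ + R - K₃ * L| ≤ |n * τ| + |R| + K₃ * L := by
          refine (abs_sub _ _).trans ?_
          rw [abs_of_nonneg (a := K₃ * L) (by positivity)]
          linarith [abs_add_le (n * τ) R]
        have h4 : K₃ * L ≤ K₃ * √(n * L) := mul_le_mul_of_nonneg_left h2 hK₃0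
        have h5 := mul_le_mul_of_nonneg_left hsnL (show 0 ≤ M₀ + M₁ + K₃ by positivity)
        linarith
      have hLk : L ≤ θ * k := by
        refine hlogn.trans ?_
        have := mul_le_mul_of_nonneg_left hk2 hθ.le
        linarith
      have h1 := hcmp k hk (f s) η L _ hη0 hv hL0 hLk hT
      have h2 : prob (prodWeight fun _ : Fin k => pairWeight Φ W) (fun z =>
          √(n * VJ) * gaussQInv ε - K' * L < ∑ i, r (s i) + ∑ j, -u (z j).1 (z j).2)
          ≤ prob (prodWeight fun _ : Fin k => pairWeight Φ W) (fun z =>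
            ∑ j, u (z j).1 (z j).2 ≤ n * τ + R - K₃ * L - Kd * L) := by
        refine prob_mono (prodWeight_mem fun _ => pairWeight_mem hΦ hW).1 fun z _ hz => ?_
        rw [Finset.sum_neg_distrib, ← hR] at hz
        rw [hnτ, hCdef]
        linarith
      have h3 := prob_le_add (E := fun y => ∑ j, u (f s j) (y j)
          ≤ n * τ + R - K₃ * L + c * (k * η ^ 2))
        (F := fun y => rdf d (seqType s) D
          > ρ * mutualInfo (seqType (f s)) (condType (f s) y) + ξ n)
        (G := fun y => (Fintype.card X * Fintype.card Y + 1) * Real.log (k + 1)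
          < k * condDiv (seqType (f s)) (condType (f s) y) W) (hwx s).1 fun y hy hEy => by
        by_cases hgood : (Fintype.card X * Fintype.card Y + 1) * Real.log (k + 1)
          < k * condDiv (seqType (f s)) (condType (f s) y) W
        · exact Or.inr hgood
        left
        have h4 := hch (f s) y hy (not_lt.1 hgood)
        rw [← hη] at h4
        rw [hRD, hrdf, ← hR] at hsrc
        have h5 := (abs_le.1 hξ).2
        refine lt_of_mul_lt_mul_left ?_ hn'.le
        rw [hK₃] at hEy
        linarith
      have h6 := prob_condDiv_gt_log_le hW (f s)
      linarith
  have hG := prob_seqType_sq_gt_le hP hn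
  have hζ1 := (abs_le.1 hζ).2
  have hsn : 0 < √(n : ℝ) := Real.sqrt_pos.2 hn'
  have hsk : 0 < √(k : ℝ) := Real.sqrt_pos.2 hk'
  have hkn : Kd * (1 / √k) ≤ Kd * √(2 / ρ) * (L / √n) := by
    rw [mul_assoc]
    refine mul_le_mul_of_nonneg_left ?_ hKd
    have h1 : √(n : ℝ) ≤ √(2 / ρ) * √k := by
      rw [← Real.sqrt_mul (by positivity)]
      exact Real.sqrt_le_sqrt hnk
    calc 1 / √k ≤ √(2 / ρ) * (1 / √n) := by
          rw [mul_one_div, div_le_div_iff₀ hsk hsn, one_mul]; exact h1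
      _ ≤ √(2 / ρ) * (L / √n) := by gcongr
  have hLs : 0 < L / √n := by positivity
  linarith

end Converse

end

end JSCC

theorem mainTheorem4 {S T X Y : Type*} [Fintype S] [Fintype T] [Fintype X] [Fintype Y]
    [DecidableEq S] [DecidableEq X] [DecidableEq Y]
    (P : S → ℝ) (hP : P ∈ stdSimplex ℝ S)
    (d : S → T → ℝ) (hd : ∀ s t, 0 ≤ d s t) (hd0 : ∀ s, ∃ t, d s t = 0)
    (W : X → Y → ℝ) (hW : ∀ x, W x ∈ stdSimplex ℝ Y)
    (ρ : ℝ) (hρ : 0 < ρ) (ε : ℝ) (hε0 : 0 < ε) (hε1 : ε < 1)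
    (ξ ζ : ℕ → ℝ)
    (hξ : ξ =O[atTop] fun n : ℕ => Real.log n / n)
    (hζ : ζ =O[atTop] fun n : ℕ => Real.log n / Real.sqrt n) :
    -- channel inputs of a fixed type that approximates `Φ`
    (∀ Φ ∈ stdSimplex ℝ X, 0 < mutualInfo Φ W →
      ∀ Dstar : ℝ, 0 < Dstar → rdf d P Dstar = ρ * mutualInfo Φ W →
        RdfTwiceDifferentiableNear d P Dstar →
        ∃ K : ℝ, ∀ᶠ n : ℕ in atTop, ∀ x : Fin ⌊ρ * n⌋₊ → X,
          (∀ a, |Φ a - seqType x a| ≤ 1 / (⌊ρ * n⌋₊ : ℝ)) →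
          ∃ Dn : ℝ, IsDistortionThreshold d P W ρ (fun _ : Fin n → S => x) (ξ n) (ε + ζ n) Dn ∧
            |rdf d P Dn - (ρ * mutualInfo Φ W -
              Real.sqrt ((sourceDispersion d P Dstar + ρ * condInfoVar Φ W) / n) * gaussQInv ε)|
              ≤ K * (Real.log n / n)) ∧
    -- arbitrary channel inputs, which may depend on the source sequence
    (∀ Dstar : ℝ, 0 < Dstar → rdf d P Dstar = ρ * capacity W →
      RdfTwiceDifferentiableNear d P Dstar →
      vMin W = vMax W → 0 < vMin W →
      ∃ K : ℝ, ∀ᶠ n : ℕ in atTop, ∀ (f : (Fin n → S) → (Fin ⌊ρ * n⌋₊ → X)) (Dn : ℝ),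
        IsDistortionThreshold d P W ρ f (ξ n) (ε + ζ n) Dn →
        rdf d P Dn ≤ ρ * capacity W -
          Real.sqrt (jsccDispersion d P W ρ Dstar / n) * gaussQInv ε + K * (Real.log n / n)) := by
  refine ⟨fun Φ hΦ hI Dstar hD hrdf hdiff => ?_, fun Dstar hD hrdf hdiff hVV hV => ?_⟩
  · exact exists_threshold_of_type hd0 hP hW hρ hε0 hε1 hξ hζ hΦ hI hD hrdf hdiff
  · exact exists_threshold_le hd0 hP hW hρ hε0 hε1 hξ hζ hD hrdf hdiff hVV hV
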